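/- All graphs are simple (no loops or parallel edges), and paths are identified with their edge sets. Let $F$ be a matching in a graph. An \emph{$F$-AAP} (augmenting $F$-alternating path) is a simple path with at least one edge in which every other edge belongs to $F$ and whose two endpoints belong to no edge of $F$. For a family $\mathcal A=(A_1,\dots,A_m)$ of sets, an \emph{$\mathcal A$-rainbow set} is a set $\{x_{i_1},\dots,x_{i_r}\}$ with $i_1<\dots<i_r$ and $x_{i_j}\in A_{i_j}$ for every $j$; an $F$-AAP is \emph{$\mathcal A$-rainbow} if the set of its edges outside $F$ is an $\mathcal A$-rainbow set. For $w\ge 1$, a \emph{$w$-origamistrip} with endpoints $x,y$ consists of distinct vertices $x,y,u_1,\dots,u_w,v_1,\dots,v_w$ and the three matchings $M=\{u_1v_1,\dots,u_wv_w\}$, $A=\{xu_1,v_1u_2,v_2u_3,\dots,v_{w-1}u_w,v_wy\}$ and $B=\{xv_1,u_1v_2,u_2v_3,\dots,u_{w-1}v_w,u_wy\}$; the $u_i$ and $v_i$ are its interior vertices. Write $P^A=A\cup M$ and $P^B=B\cup M$. A \emph{$k$-badge with skeleton $F$} is a family of $2k$ paths obtained as follows. Take a finite loopless multigraph $H$ with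 a positive integer weight $w(e)$ on each edge $e$, of total weight $k$, and for every edge $e=xy$ of $H$ a $w(e)$-origamistrip with endpoints $x,y$, such that the interior vertex sets of the origamistrips are pairwise disjoint and contain no vertex of $H$, and such that $F$ is the union of the matchings $M$ of the origamistrips. The family contains, for every edge $e$ of $H$, the paths $P^A$ and $P^B$ of its origamistrip, each repeated $w(e)$ times. A \emph{generalized $k$-badge with skeleton $F$} is a family obtained from a $k$-badge with skeleton $F$ by adding edges of $F$ to, and deleting edges of $F$ from, each member of the family arbitrarily. \textbf{Theorem.} Let $F$ be a matching of (finite) size $k$ in a graph $G$, let $t\ge 0$ be an integer, and let $\mathcal A=(A_1,\dots,A_m)$ be a family of sets of edges of $G$ such that the union of any $t+1$ of the sets $A_i$ (with distinct indices) contains an $F$-AAP. Let $J=\{j : A_j\subseteq F\}$. If there is no $\mathcal A$-rainbow $F$-AAP, then \begin{enumerate} \item $m\le 2k+t$, and \item if $m=2k+t$, then $|J|=t$ and the $2k$ sets $A_j$, $j\notin J$, form a generalized $k$-badge with skeleton $F$. \end{enumerate} -/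

import Mathlib

namespace RainbowAAP

variable {V : Type*}

/-- A set `S` is rainbow with respect to the family `A` if it is the image of a partial choice
function of `A`: the function is defined on a set `I` of indices and picks `x i ∈ A i`. -/
def IsRainbowSet {ι α : Type*} (A : ι → Set α) (S : Set α) : Prop :=
  ∃ (I : Set ι) (x : ι → α), (∀ i ∈ I, x i ∈ A i) ∧ x '' I = S

/-- The vertex `v` belongs to no edge of `F`. -/
def Uncovered (F : Set (Sym2 V)) (v : V) : Prop :=
  ∀ e ∈ F, v ∉ e

/-- `p` is an augmenting `F`-alternating path (`F`-AAP): a simple path with at least one edge,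
of any two consecutive edges of which exactly one is in `F`, and both of whose endpoints belong
to no edge of `F`. -/
structure IsAAP {G : SimpleGraph V} (F : Set (Sym2 V)) {a b : V} (p : G.Walk a b) : Prop where
  isPath : p.IsPath
  length_pos : 0 < p.length
  alternating : p.edges.IsChain (fun e f => e ∈ F ↔ f ∉ F)
  start_uncovered : Uncovered F a
  end_uncovered : Uncovered F b

/-- The edge set `S` contains (all edges of) an `F`-AAP of `G`. -/
def ContainsAAP (G : SimpleGraph V) (F S : Set (Sym2 V)) : Prop :=
  ∃ (a b : V) (p : G.Walk a b), IsAAP F p ∧ {e | e ∈ p.edges} ⊆ S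

/-- There is an `A`-rainbow `F`-AAP in `G`: an `F`-AAP whose set of non-`F` edges is a rainbow set
of `A`. -/
def HasRainbowAAP (G : SimpleGraph V) (F : Set (Sym2 V)) {ι : Type*} (A : ι → Set (Sym2 V)) :
    Prop :=
  ∃ (a b : V) (p : G.Walk a b), IsAAP F p ∧ IsRainbowSet A ({e | e ∈ p.edges} \ F)

/-- An `m`-origamistrip in the vertex set `V`, with `m ≥ 1`, endpoints `x`, `y` and interior
vertices `u 1, …, u m, v 1, …, v m`, all distinct. (Values of `u` and `v` at other indices are
irrelevant.) -/
structure Origamistrip (V : Type*) where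
  m : ℕ
  one_le_m : 1 ≤ m
  u : ℕ → V
  v : ℕ → V
  x : V
  y : V
  u_injOn : Set.InjOn u (Set.Icc 1 m)
  v_injOn : Set.InjOn v (Set.Icc 1 m)
  u_ne_v : ∀ i ∈ Set.Icc 1 m, ∀ j ∈ Set.Icc 1 m, u i ≠ v j
  x_ne_y : x ≠ y
  x_ne_u : ∀ i ∈ Set.Icc 1 m, x ≠ u i
  x_ne_v : ∀ i ∈ Set.Icc 1 m, x ≠ v i
  y_ne_u : ∀ i ∈ Set.Icc 1 m, y ≠ u i
  y_ne_v : ∀ i ∈ Set.Icc 1 m, y ≠ v i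

namespace Origamistrip

/-- The interior vertices of an origamistrip. -/
def interior (O : Origamistrip V) : Set V :=
  O.u '' Set.Icc 1 O.m ∪ O.v '' Set.Icc 1 O.m

/-- The skeleton `{u₁v₁, …, uₘvₘ}`. -/
def skeleton (O : Origamistrip V) : Set (Sym2 V) :=
  {e | ∃ i ∈ Set.Icc 1 O.m, e = s(O.u i, O.v i)}

/-- The matching `{xu₁, v₁u₂, v₂u₃, …, vₘ₋₁uₘ, vₘy}`. -/
def matchingA (O : Origamistrip V) : Set (Sym2 V) :=
  {s(O.x, O.u 1), s(O.v O.m, O.y)} ∪ {e | ∃ i, 1 ≤ i ∧ i < O.m ∧ e = s(O.v i, O.u (i + 1))}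

/-- The matching `{xv₁, u₁v₂, u₂v₃, …, uₘ₋₁vₘ, uₘy}`. -/
def matchingB (O : Origamistrip V) : Set (Sym2 V) :=
  {s(O.x, O.v 1), s(O.u O.m, O.y)} ∪ {e | ∃ i, 1 ≤ i ∧ i < O.m ∧ e = s(O.u i, O.v (i + 1))}

/-- The path `x u₁ v₁ u₂ v₂ … uₘ vₘ y`, as an edge set. -/
def pathA (O : Origamistrip V) : Set (Sym2 V) := O.matchingA ∪ O.skeleton

/-- The path `x v₁ u₁ v₂ u₂ … vₘ uₘ y`, as an edge set. -/
def pathB (O : Origamistrip V) : Set (Sym2 V) := O.matchingB ∪ O.skeleton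

end Origamistrip

/-- The data from which a badge is built: a loopless multigraph `H` with `n` edges, numbered by
`Fin n`, where the edge `e` of `H` joins `(strip e).x` and `(strip e).y` and has weight
`(strip e).m`, and for each edge of `H` an origamistrip with the same endpoints. The interiors of
the strips are pairwise disjoint, and they contain no vertex of `H`. Different strips may share
one or both endpoints. -/
structure Badge (V : Type*) where
  n : ℕ
  strip : Fin n → Origamistrip V
  interior_disjoint : ∀ e f, e ≠ f → Disjoint (strip e).interior (strip f).interior
  x_notMem_interior : ∀ e f, (strip e).x ∉ (strip f).interior
  y_notMem_interior : ∀ e f, (strip e).y ∉ (strip f).interior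

namespace Badge

/-- The total weight; a badge of weight `k` is a `k`-badge. -/
def weight (B : Badge V) : ℕ := ∑ e, (B.strip e).m

/-- The skeleton: the union of the skeletons of the strips. -/
def skeleton (B : Badge V) : Set (Sym2 V) := ⋃ e, (B.strip e).skeleton

/-- The index set of the collection of paths of a badge: every edge `e` of `H` contributes two
paths, each repeated as many times as the weight of `e`. -/
abbrev Index (B : Badge V) : Type := Σ e : Fin B.n, Bool × Fin (B.strip e).m

/-- The collection of paths of a badge: each of `pathA` and `pathB` of the strip of `e`, repeated
as many times as the weight of `e`. -/
def path (B : Badge V) (c : B.Index) : Set (Sym2 V) :=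
  if c.2.1 then (B.strip c.1).pathA else (B.strip c.1).pathB

end Badge

/-- The family `A` is a generalized `k`-badge with skeleton `F`: up to reindexing, it arises from
the collection of paths of a `k`-badge with skeleton `F` by adding edges of `F` to, and deleting
edges of `F` from, each member of the collection. -/
def IsGeneralizedBadge (k : ℕ) (F : Set (Sym2 V)) {ι : Type*} (A : ι → Set (Sym2 V)) : Prop :=
  ∃ B : Badge V, B.weight = k ∧ B.skeleton = F ∧
    ∃ φ : ι ≃ B.Index, ∀ i, symmDiff (A i) (B.path (φ i)) ⊆ F

end RainbowAAP

/-!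
An augmenting path for the matching `F` amounts to a matching of size `|F| + 1` in the union of `F`
and the edges of the path (`IsAAP.hasMat`, `exists_isAAP`). So, with `E c` the part of the `c`-th
set outside `F`, the hypotheses say that any `t + 1` of the sets `E c` form with `F` a graph with a
matching of size `|F| + 1`, while no such matching has edges of distinct colours outside `F`. The
structure `Inst` records this, and everything but the last part of the proof is about matchings.

**The bound.** For a rainbow set `T`, the matching number of `F ∪ T` is `|F|`; consider the covered
vertices that are missed by some maximum matching of `F ∪ T`. If `t + 1` colours are not used by
`T`, one of their edges can be added to `T` so that a further vertex becomes missable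
(`exists_edge_enlarging`, which rests on Gallai's lemma `not_both_missed_trans` and Berge's theorem
`exists_augmenting`). As only `2|F|` vertices are covered, there are at most `2|F| + t` colours;
`Inst.bound` is a version of this for any rainbow set to start from.

**Contraction.** Suppose now that there are exactly `2|F| + t` colours. Then `Inst.bound` is tight,
and there is a triangle: an uncovered vertex `x` and an edge `uv` of `F` such that `xu` and `xv`
have two distinct colours `i` and `j` (`Inst.exists_triangle`). Identifying `u` and `v` with `x` and
giving up `i` and `j` leads to an extremal family for `F - uv` (`Triangle.contr_inst`). By induction
on `|F|` exactly `t` of the sets `E c` are empty (`card_empty_eq`). These are left out, and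
`t = 0` from here on.

**The badge.** By induction again, each contraction of a triangle is a badge. If a third colour
contains `xu` or `xv`, then exchanging it with `i` or `j` in the triangle shows that it contracts to
the same set (`Triangle.contr_eq_of_mem`, by a count of the colours in `BadgeFamily.eq_of_replace`).
The strip of this set ends at `x`, and the family arises by inserting the pair `u`, `v` at that end
(`Triangle.isBadgeFamily_of_mem`). If no triangle has an edge of a third colour, then `E i` and
`E j` are `{xu, vy}` and `{xv, uy}` for some uncovered `y`, which is seen by contracting another
triangle (`Triangle.exists_pair`; directly if `|F| = 1`), and the family arises by adding a strip of weight one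
(`Triangle.isBadgeFamily_of_pair`). In both cases the other sets are unchanged by the contraction,
because odd cycles of length five through `x` with three colours are impossible
(`Inst.no_five_cycle`).
-/

namespace RainbowAAP

/-! ### Matchings as finite sets of edges -/

section Matchings

variable {V : Type*} [DecidableEq V]

set_option linter.unusedSectionVars false

/-- A finite set of edges is a matching: no loops, and distinct edges share no vertex. -/
def IsMat (M : Finset (Sym2 V)) : Prop :=
  (∀ e ∈ M, ¬ e.IsDiag) ∧ ∀ e ∈ M, ∀ f ∈ M, ∀ v, v ∈ e → v ∈ f → e = f

/-- The vertices covered by a finite set of edges. -/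
def cov (M : Finset (Sym2 V)) : Finset V := M.biUnion Sym2.toFinset

lemma mem_cov {M : Finset (Sym2 V)} {v : V} : v ∈ cov M ↔ ∃ e ∈ M, v ∈ e := by
  simp [cov]

lemma cov_insert_mk (a b : V) (M : Finset (Sym2 V)) :
    cov (insert s(a, b) M) = insert a (insert b (cov M)) := by
  ext v
  simp only [mem_cov, Finset.mem_insert, exists_eq_or_imp, Sym2.mem_iff, or_assoc]

lemma cov_mono {M N : Finset (Sym2 V)} (h : M ⊆ N) : cov M ⊆ cov N := by
  intro v hv
  obtain ⟨e, he, hve⟩ := mem_cov.1 hv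
  exact mem_cov.2 ⟨e, h he, hve⟩

lemma mem_cov_left {M : Finset (Sym2 V)} {a b : V} (h : s(a, b) ∈ M) : a ∈ cov M :=
  mem_cov.2 ⟨_, h, Sym2.mem_mk_left a b⟩

lemma mem_cov_right {M : Finset (Sym2 V)} {a b : V} (h : s(a, b) ∈ M) : b ∈ cov M :=
  mem_cov.2 ⟨_, h, Sym2.mem_mk_right a b⟩

lemma exists_mk_of_mem_cov {M : Finset (Sym2 V)} {a : V} (h : a ∈ cov M) :
    ∃ b, s(a, b) ∈ M := by
  obtain ⟨e, he, hae⟩ := mem_cov.1 h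
  obtain ⟨b, rfl⟩ := Sym2.mem_iff_exists.1 hae
  exact ⟨b, he⟩

lemma isMat_empty : IsMat (∅ : Finset (Sym2 V)) := by simp [IsMat]

namespace IsMat

variable {M N : Finset (Sym2 V)}

lemma mono (hN : IsMat N) (h : M ⊆ N) : IsMat M :=
  ⟨fun e he => hN.1 e (h he), fun e he f hf => hN.2 e (h he) f (h hf)⟩

lemma ne (hM : IsMat M) {a b : V} (h : s(a, b) ∈ M) : a ≠ b := by
  have := hM.1 _ h
  simpa using this

lemma partner_unique (hM : IsMat M) {a b c : V} (hb : s(a, b) ∈ M) (hc : s(a, c) ∈ M) :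
    b = c := by
  have := hM.2 _ hb _ hc a (Sym2.mem_mk_left _ _) (Sym2.mem_mk_left _ _)
  exact Sym2.congr_right.1 this

lemma insert_mk (hM : IsMat M) {a b : V} (hab : a ≠ b) (ha : a ∉ cov M) (hb : b ∉ cov M) :
    IsMat (insert s(a, b) M) := by
  have key : ∀ f ∈ M, ∀ v, v ∈ s(a, b) → v ∉ f := by
    intro f hf v hv hvf
    rcases Sym2.mem_iff.1 hv with rfl | rfl
    · exact ha (mem_cov.2 ⟨f, hf, hvf⟩)
    · exact hb (mem_cov.2 ⟨f, hf, hvf⟩)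
  refine ⟨?_, ?_⟩
  · intro e he
    rcases Finset.mem_insert.1 he with rfl | he
    · simpa using hab
    · exact hM.1 e he
  · intro e he f hf v hve hvf
    rcases Finset.mem_insert.1 he with rfl | he <;> rcases Finset.mem_insert.1 hf with rfl | hf
    · rfl
    · exact absurd hvf (key f hf v hve)
    · exact absurd hve (key e he v hvf)
    · exact hM.2 e he f hf v hve hvf

lemma notMem_of_notMem_cov {a b : V} (ha : a ∉ cov M) : s(a, b) ∉ M :=
  fun h => ha (mem_cov_left h)

lemma card_insert_mk {a b : V} (ha : a ∉ cov M) :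
    (insert s(a, b) M).card = M.card + 1 :=
  Finset.card_insert_of_notMem (notMem_of_notMem_cov ha)

lemma cov_erase (hM : IsMat M) {a b : V} (h : s(a, b) ∈ M) :
    cov (M.erase s(a, b)) = ((cov M).erase a).erase b := by
  ext v
  simp only [mem_cov, Finset.mem_erase]
  constructor
  · rintro ⟨e, ⟨hne, he⟩, hv⟩
    refine ⟨?_, ?_, e, he, hv⟩
    · rintro rfl; exact hne (hM.2 _ he _ h v hv (Sym2.mem_mk_right _ _))
    · rintro rfl; exact hne (hM.2 _ he _ h v hv (Sym2.mem_mk_left _ _))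
  · rintro ⟨h1, h2, e, he, hv⟩
    refine ⟨e, ⟨?_, he⟩, hv⟩
    rintro rfl
    rcases Sym2.mem_iff.1 hv with rfl | rfl <;> contradiction

lemma erase (hM : IsMat M) (e : Sym2 V) : IsMat (M.erase e) := hM.mono (Finset.erase_subset _ _)

lemma card_cov (hM : IsMat M) : (cov M).card = 2 * M.card := by
  unfold cov
  rw [Finset.card_biUnion]
  · rw [Finset.sum_congr rfl (fun e he => Sym2.card_toFinset_of_not_isDiag e (hM.1 e he))]
    simp [mul_comm]
  · intro e he f hf hef
    rw [Function.onFun, Finset.disjoint_left]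
    intro v hv hv'
    exact hef (hM.2 e he f hf v (Sym2.mem_toFinset.1 hv) (Sym2.mem_toFinset.1 hv'))

/-- A matching with vertices in `W` and at least `|W| / 2` edges covers `W`. -/
lemma cov_eq_of_subset (hM : IsMat M) {W : Finset V} (h : cov M ⊆ W) (hc : W.card ≤ 2 * M.card) :
    cov M = W :=
  Finset.eq_of_subset_of_card_le h (by rw [hM.card_cov]; exact hc)

end IsMat

/-- The alternation relation on consecutive edges: one lies in `M` only, the other in `N` only. -/
def AltStep (M N : Finset (Sym2 V)) (e f : Sym2 V) : Prop :=
  (e ∈ M ∧ e ∉ N ∧ f ∈ N ∧ f ∉ M) ∨ (e ∈ N ∧ e ∉ M ∧ f ∈ M ∧ f ∉ N)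

/-- There is an `M`-`N`-alternating path from `z` to `z'` whose first edge is in `M`, realised in
any graph that contains both matchings. -/
def AltPath (M N : Finset (Sym2 V)) (z z' : V) : Prop :=
  ∀ G : SimpleGraph V, (∀ e ∈ M ∪ N, e ∈ G.edgeSet) → ∃ p : G.Walk z z', p.IsPath ∧
    0 < p.length ∧ (∀ e ∈ p.edges, e ∈ M ∪ N) ∧ (∀ v ∈ p.support, v ∈ cov M ∪ cov N) ∧
    (∀ e ∈ p.edges.head?, e ∈ M ∧ e ∉ N) ∧ p.edges.IsChain (AltStep M N)

/-- Exchange along the component of `M ∆ N` that starts at a vertex `z` covered by `M` only. This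
component is a path; `z'` is its other end, and `M'`, `N'` arise from `M`, `N` by switching along
it. In the first alternative the path has even length, in the second it has odd length. -/
lemma exists_exchange (n : ℕ) : ∀ {M N : Finset (Sym2 V)}, M.card + N.card = n → IsMat M →
    IsMat N → ∀ {z : V}, z ∈ cov M → z ∉ cov N →
    ∃ (z' : V) (M' N' : Finset (Sym2 V)), z' ≠ z ∧ IsMat M' ∧ IsMat N' ∧
      M' ⊆ M ∪ N ∧ N' ⊆ M ∪ N ∧
      Relation.ReflTransGen (fun a b => s(a, b) ∈ M ∪ N) z z' ∧ AltPath M N z z' ∧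
      ((z' ∈ cov N ∧ z' ∉ cov M ∧ cov M' = insert z' ((cov M).erase z) ∧
          cov N' = insert z ((cov N).erase z')) ∨
       (z' ∈ cov M ∧ z' ∉ cov N ∧ cov M' = ((cov M).erase z).erase z' ∧
          cov N' = insert z (insert z' (cov N)))) := by
  induction n with
  | zero =>
    intro M N hn hM hN z hz hz'
    have : M = ∅ := Finset.card_eq_zero.1 (by omega)
    subst this; simp [mem_cov] at hz
  | succ n ih =>
    intro M N hn hM hN z hz hzN
    obtain ⟨a, ha⟩ := exists_mk_of_mem_cov hz
    have hza : z ≠ a := hM.ne ha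
    have haN : s(z, a) ∉ N := IsMat.notMem_of_notMem_cov hzN
    by_cases haC : a ∈ cov N
    · have hM1 := hM.erase s(z, a)
      have hcM1 := hM.cov_erase ha
      have hcard : N.card + (M.erase s(z, a)).card = n := by
        rw [Finset.card_erase_of_mem ha]
        have : 0 < M.card := Finset.card_pos.2 ⟨_, ha⟩
        omega
      obtain ⟨z', N', M', hne, hN', hM', hNs, hMs, hr, hp, hcase⟩ :=
        ih hcard hN hM1 haC (by rw [hcM1]; simp)
      have hsub : N ∪ M.erase s(z, a) ⊆ M ∪ N :=
        Finset.union_subset Finset.subset_union_right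
          ((Finset.erase_subset _ _).trans Finset.subset_union_left)
      have hz'z : z' ≠ z := by
        rintro rfl
        rcases hcase with h | h
        · have := h.1; rw [hcM1] at this; simp at this
        · exact hzN h.1
      have hzN' : z ∉ cov N' := by
        rcases hcase with h | h
        · rw [h.2.2.1]; simp [hz'z.symm, hzN]
        · rw [h.2.2.1]; simp [hzN]
      have haN' : a ∉ cov N' := by
        rcases hcase with h | h
        · rw [h.2.2.1]; simp [hne.symm]
        · rw [h.2.2.1]; simp
      refine ⟨z', M', insert s(z, a) N', hz'z, hM', hN'.insert_mk hza hzN' haN', hMs.trans hsub,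
        ?_, ?_, ?_, ?_⟩
      · intro e he
        rcases Finset.mem_insert.1 he with rfl | he
        · exact Finset.mem_union_left _ ha
        · exact hsub (hNs he)
      · refine Relation.ReflTransGen.head (b := a) (Finset.mem_union_left _ ha) ?_
        exact Relation.ReflTransGen.mono (fun x y h => hsub h) _ _ hr
      · intro G hG
        obtain ⟨p, hp1, hp2, hp3, hp4, hp5, hp6⟩ := hp G (fun e he => hG e (hsub he))
        have hadj : G.Adj z a := hG _ (Finset.mem_union_left _ ha)
        have hnot : ∀ e ∈ p.edges, e ≠ s(z, a) := by
          intro e he heq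
          have := hp3 e he
          rw [heq] at this
          simp [haN] at this
        refine ⟨.cons hadj p, ?_, by simp, ?_, ?_, ?_, ?_⟩
        · rw [SimpleGraph.Walk.cons_isPath_iff]
          refine ⟨hp1, fun h => ?_⟩
          have := hp4 z h
          rw [hcM1] at this
          rcases Finset.mem_union.1 this with h | h
          · exact hzN h
          · simp at h
        · intro e he
          rw [SimpleGraph.Walk.edges_cons, List.mem_cons] at he
          rcases he with rfl | he
          · exact Finset.mem_union_left _ ha
          · exact hsub (hp3 e he)
        · intro v hv
          rw [SimpleGraph.Walk.support_cons, List.mem_cons] at hv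
          rcases hv with rfl | hv
          · exact Finset.mem_union_left _ hz
          · rcases Finset.mem_union.1 (hp4 v hv) with h | h
            · exact Finset.mem_union_right _ h
            · exact Finset.mem_union_left _ (cov_mono (Finset.erase_subset _ _) h)
        · intro e he
          simp only [SimpleGraph.Walk.edges_cons, List.head?_cons, Option.mem_def,
            Option.some.injEq] at he
          subst he
          exact ⟨ha, haN⟩
        · rw [SimpleGraph.Walk.edges_cons, List.isChain_cons]
          refine ⟨?_, ?_⟩
          · intro f hf
            have h5 := hp5 f hf
            have hfm : f ∈ p.edges := List.mem_of_mem_head? hf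
            refine Or.inl ⟨ha, haN, h5.1, fun h => h5.2 ?_⟩
            exact Finset.mem_erase.2 ⟨hnot f hfm, h⟩
          · refine List.IsChain.imp_of_mem_imp ?_ hp6
            intro e f he hf h
            have e1 := hnot e he
            have f1 := hnot f hf
            simp only [AltStep, Finset.mem_erase, ne_eq, e1, f1, not_false_eq_true,
              true_and] at h ⊢
            exact h.symm
      · rcases hcase with h | h
        · right
          obtain ⟨h1, h2, h3, h4⟩ := h
          have h1M : z' ∈ cov M := cov_mono (Finset.erase_subset _ _) h1
          refine ⟨h1M, h2, ?_, ?_⟩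
          · rw [h4, hcM1]
            have haM : a ∈ cov M := mem_cov_right ha
            ext v
            simp only [Finset.mem_insert, Finset.mem_erase]
            by_cases hva : v = a
            · subst hva; simp [haM, hza.symm, hne.symm]
            · simp [hva]
          · rw [cov_insert_mk, h3]
            ext v
            simp only [Finset.mem_insert, Finset.mem_erase]
            by_cases hva : v = a
            · subst hva; simp [haC]
            · simp [hva]
        · left
          obtain ⟨h1, h2, h3, h4⟩ := h
          have h2M : z' ∉ cov M := by
            rw [hcM1] at h2
            simp only [Finset.mem_erase, not_and] at h2
            intro h
            exact h2 hne hz'z h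
          refine ⟨h1, h2M, ?_, ?_⟩
          · rw [h4, hcM1]
            have haM : a ∈ cov M := mem_cov_right ha
            ext v
            simp only [Finset.mem_insert, Finset.mem_erase]
            by_cases hva : v = a
            · subst hva; simp [haM, hza.symm]
            · simp [hva]
          · rw [cov_insert_mk, h3]
            ext v
            simp only [Finset.mem_insert, Finset.mem_erase]
            by_cases hva : v = a
            · subst hva; simp [haC, hne.symm]
            · simp [hva]
    · refine ⟨a, M.erase s(z, a), insert s(z, a) N, hza.symm, hM.erase _,
        hN.insert_mk hza hzN haC, (Finset.erase_subset _ _).trans Finset.subset_union_left, ?_,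
        Relation.ReflTransGen.single (Finset.mem_union_left _ ha), ?_,
        Or.inr ⟨mem_cov_right ha, haC, hM.cov_erase ha, cov_insert_mk _ _ _⟩⟩
      · intro e he
        rcases Finset.mem_insert.1 he with rfl | he
        · exact Finset.mem_union_left _ ha
        · exact Finset.mem_union_right _ he
      · intro G hG
        have hadj : G.Adj z a := hG _ (Finset.mem_union_left _ ha)
        refine ⟨.cons hadj .nil, by simp [hza], by simp, ?_, ?_, ?_, by simp⟩
        · simp [ha]
        · intro v hv
          simp only [SimpleGraph.Walk.support_cons, SimpleGraph.Walk.support_nil, List.mem_cons,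
            List.not_mem_nil, or_false] at hv
          rcases hv with rfl | rfl
          · exact Finset.mem_union_left _ hz
          · exact Finset.mem_union_left _ (mem_cov_right ha)
        · intro e he
          simp only [SimpleGraph.Walk.edges_cons, SimpleGraph.Walk.edges_nil, List.head?_cons,
            Option.mem_def, Option.some.injEq] at he
          subst he
          exact ⟨ha, haN⟩

/-- Berge's theorem: if `N` is larger than `M`, some component of `M ∆ N` is a path whose two ends
are missed by `M`. The path is found in `M ∪ N'` for a matching `N' ⊆ M ∪ N`. -/
lemma exists_augmenting (n : ℕ) : ∀ {M N : Finset (Sym2 V)}, (cov N \ cov M).card = n → IsMat M →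
    IsMat N → M.card < N.card →
    ∃ (p q : V) (N' : Finset (Sym2 V)), p ≠ q ∧ p ∉ cov M ∧ q ∉ cov M ∧ N' ⊆ M ∪ N ∧
      Relation.ReflTransGen (fun a b => s(a, b) ∈ M ∪ N) p q ∧ AltPath N' M p q := by
  induction n using Nat.strong_induction_on with
  | _ n ih =>
    intro M N hn hM hN hlt
    have hcard : (cov M).card < (cov N).card := by rw [hM.card_cov, hN.card_cov]; omega
    obtain ⟨z, hzN, hzM⟩ := Finset.exists_mem_notMem_of_card_lt_card hcard
    obtain ⟨z', N', M', hne, hN', hM', hNs, hMs, hr, hp, hcase⟩ :=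
      exists_exchange _ rfl hN hM hzN hzM
    rcases hcase with ⟨h1, h2, h3, h4⟩ | ⟨h1, h2, h3, h4⟩
    · have hlt2 : (cov N' \ cov M).card < n := by
        rw [← hn, h3]
        apply Finset.card_lt_card
        rw [Finset.ssubset_iff_of_subset]
        · exact ⟨z, by simp only [Finset.mem_sdiff]; exact ⟨hzN, hzM⟩, by
            simp only [Finset.mem_sdiff, Finset.mem_insert, Finset.mem_erase]
            rintro ⟨h | h, _⟩
            · exact hne h.symm
            · exact h.1 rfl⟩
        · intro v hv
          simp only [Finset.mem_sdiff, Finset.mem_insert, Finset.mem_erase] at hv ⊢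
          rcases hv with ⟨rfl | h, h'⟩
          · exact absurd h1 h'
          · exact ⟨h.2, h'⟩
      have hcardN : N'.card = N.card := by
        have e1 := hN'.card_cov
        have e2 := hN.card_cov
        rw [h3, Finset.card_insert_of_notMem (by simp [hne, h2]),
          Finset.card_erase_of_mem hzN] at e1
        have : 0 < (cov N).card := Finset.card_pos.2 ⟨z, hzN⟩
        omega
      obtain ⟨p, q, N'', hpq, hp1, hq1, hsub, hrr, hpp⟩ := ih _ hlt2 rfl hM hN' (by omega)
      have hss : M ∪ N' ⊆ M ∪ N :=
        Finset.union_subset Finset.subset_union_left (hNs.trans (by rw [Finset.union_comm]))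
      exact ⟨p, q, N'', hpq, hp1, hq1, hsub.trans hss,
        Relation.ReflTransGen.mono (fun x y h => hss h) _ _ hrr, hpp⟩
    · refine ⟨z, z', N, hne.symm, hzM, h2, Finset.subset_union_right, ?_, hp⟩
      rw [Finset.union_comm]
      exact hr

end Matchings

end RainbowAAP

namespace RainbowAAP

/-! ### Enlarging the set of missable vertices -/

section Missable

variable {V : Type*} [DecidableEq V]

set_option linter.unusedSectionVars false

/-- The edge set `Z` contains a matching of size `k`. -/
def HasMat (Z : Set (Sym2 V)) (k : ℕ) : Prop :=
  ∃ M : Finset (Sym2 V), IsMat M ∧ ↑M ⊆ Z ∧ M.card = k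

/-- Some matching of size `k` in `Z` misses `v`. If `k` is the matching number of `Z`, these `v`
form the set `D` of the Gallai–Edmonds decomposition. -/
def Missable (Z : Set (Sym2 V)) (k : ℕ) (v : V) : Prop :=
  ∃ M : Finset (Sym2 V), IsMat M ∧ ↑M ⊆ Z ∧ M.card = k ∧ v ∉ cov M

lemma HasMat.mono {Z Z' : Set (Sym2 V)} {k : ℕ} (h : HasMat Z k) (hZ : Z ⊆ Z') : HasMat Z' k := by
  obtain ⟨M, h1, h2, h3⟩ := h
  exact ⟨M, h1, h2.trans hZ, h3⟩

lemma Missable.mono {Z Z' : Set (Sym2 V)} {k : ℕ} {v : V} (h : Missable Z k v) (hZ : Z ⊆ Z') :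
    Missable Z' k v := by
  obtain ⟨M, h1, h2, h3, h4⟩ := h
  exact ⟨M, h1, h2.trans hZ, h3, h4⟩

lemma HasMat.of_le {Z : Set (Sym2 V)} {M : Finset (Sym2 V)} (hM : IsMat M) (hZ : ↑M ⊆ Z) {k : ℕ}
    (hk : k ≤ M.card) : HasMat Z k := by
  obtain ⟨M', h1, h2⟩ := Finset.exists_subset_card_eq hk
  exact ⟨M', hM.mono h1, (Finset.coe_subset.2 h1).trans hZ, h2⟩

/-- If a matching of size `k` misses both ends of an edge, adding the edge gives size `k + 1`. -/
lemma HasMat.of_insert {Z : Set (Sym2 V)} {M : Finset (Sym2 V)} (hM : IsMat M) {a b : V}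
    (hZ : ↑M ⊆ Z) (hab : a ≠ b) (ha : a ∉ cov M) (hb : b ∉ cov M) (hZab : s(a, b) ∈ Z) :
    HasMat Z (M.card + 1) := by
  refine ⟨insert s(a, b) M, hM.insert_mk hab ha hb, ?_, IsMat.card_insert_mk ha⟩
  intro e he
  rcases Finset.mem_insert.1 he with rfl | he
  · exact hZab
  · exact hZ he

/-- The edges of `Z` that avoid the vertex `w`. -/
def avoiding (Z : Set (Sym2 V)) (w : V) : Set (Sym2 V) := {e ∈ Z | w ∉ e}

lemma notMem_cov_of_avoiding {Z : Set (Sym2 V)} {w : V} {M : Finset (Sym2 V)}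
    (h : ↑M ⊆ avoiding Z w) : w ∉ cov M := by
  intro hw
  obtain ⟨e, he, hwe⟩ := mem_cov.1 hw
  exact (h he).2 hwe

lemma subset_avoiding {Z : Set (Sym2 V)} {w : V} {M : Finset (Sym2 V)}
    (h : ↑M ⊆ Z) (hw : w ∉ cov M) : ↑M ⊆ avoiding Z w :=
  fun e he => ⟨h he, fun hwe => hw (mem_cov.2 ⟨e, he, hwe⟩)⟩

lemma card_of_cov_card_eq {M N : Finset (Sym2 V)} (hM : IsMat M) (hN : IsMat N) {a : ℕ}
    (h : (cov M).card = (cov N).card + 2 * a) : M.card = N.card + a := by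
  have := hM.card_cov
  have := hN.card_cov
  omega

/-- `exists_exchange` with the sizes of the new matchings in place of the path. -/
lemma exists_exchange_card {M N : Finset (Sym2 V)} (hM : IsMat M) (hN : IsMat N) {z : V}
    (hz : z ∈ cov M) (hzN : z ∉ cov N) :
    ∃ (z' : V) (M' N' : Finset (Sym2 V)), z' ≠ z ∧ IsMat M' ∧ IsMat N' ∧
      M' ⊆ M ∪ N ∧ N' ⊆ M ∪ N ∧
      ((z' ∈ cov N ∧ z' ∉ cov M ∧ cov M' = insert z' ((cov M).erase z) ∧
          cov N' = insert z ((cov N).erase z') ∧ M'.card = M.card ∧ N'.card = N.card) ∨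
       (z' ∈ cov M ∧ z' ∉ cov N ∧ cov M' = ((cov M).erase z).erase z' ∧
          cov N' = insert z (insert z' (cov N)) ∧ M'.card + 1 = M.card ∧
          N'.card = N.card + 1)) := by
  obtain ⟨z', M', N', hne, hM', hN', h1, h2, -, -, h⟩ := exists_exchange _ rfl hM hN hz hzN
  refine ⟨z', M', N', hne, hM', hN', h1, h2, ?_⟩
  rcases h with ⟨a, b, c, d⟩ | ⟨a, b, c, d⟩
  · refine Or.inl ⟨a, b, c, d, ?_, ?_⟩
    · have : (cov M').card = (cov M).card + 2 * 0 := by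
        rw [c, Finset.card_insert_of_notMem (by simp [b]), Finset.card_erase_of_mem hz]
        have : 0 < (cov M).card := Finset.card_pos.2 ⟨z, hz⟩
        omega
      exact card_of_cov_card_eq hM' hM this
    · have : (cov N').card = (cov N).card + 2 * 0 := by
        rw [d, Finset.card_insert_of_notMem (by simp [hzN]), Finset.card_erase_of_mem a]
        have : 0 < (cov N).card := Finset.card_pos.2 ⟨z', a⟩
        omega
      exact card_of_cov_card_eq hN' hN this
  · refine Or.inr ⟨a, b, c, d, ?_, ?_⟩
    · have : (cov M).card = (cov M').card + 2 * 1 := by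
        have hz'e : z' ∈ (cov M).erase z := Finset.mem_erase.2 ⟨hne, a⟩
        rw [c, Finset.card_erase_of_mem hz'e]
        have : 0 < ((cov M).erase z).card := Finset.card_pos.2 ⟨z', hz'e⟩
        have := Finset.card_erase_add_one hz
        omega
      exact (card_of_cov_card_eq hM hM' this).symm
    · have : (cov N').card = (cov N).card + 2 * 1 := by
        rw [d, Finset.card_insert_of_notMem (by simp [hzN, hne.symm]),
          Finset.card_insert_of_notMem b]
      exact card_of_cov_card_eq hN' hN this

/-- Gallai's lemma: on the missable vertices, "no maximum matching misses both" is transitive. -/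
lemma not_both_missed_trans {Z : Set (Sym2 V)} {k : ℕ} (hmax : ¬ HasMat Z (k + 1)) {a b c : V}
    (hb : Missable Z k b)
    (hab : ∀ M : Finset (Sym2 V), IsMat M → ↑M ⊆ Z → M.card = k → a ∉ cov M → b ∉ cov M → a = b)
    (hbc : ∀ M : Finset (Sym2 V), IsMat M → ↑M ⊆ Z → M.card = k → b ∉ cov M → c ∉ cov M → b = c)
    (M : Finset (Sym2 V)) (hM : IsMat M) (hMZ : ↑M ⊆ Z) (hMk : M.card = k) (ha : a ∉ cov M)
    (hc : c ∉ cov M) : a = c := by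
  by_contra hac
  by_cases hbM : b ∈ cov M
  · obtain ⟨N, hN, hNZ, hNk, hbN⟩ := hb
    obtain ⟨z', M', N', hne, hM', hN', h1, h2, h⟩ := exists_exchange_card hM hN hbM hbN
    have hU : ((M ∪ N : Finset (Sym2 V)) : Set (Sym2 V)) ⊆ Z := by
      rw [Finset.coe_union]; exact Set.union_subset hMZ hNZ
    have hM'Z : (M' : Set (Sym2 V)) ⊆ Z := (Finset.coe_subset.2 h1).trans hU
    have hN'Z : (N' : Set (Sym2 V)) ⊆ Z := (Finset.coe_subset.2 h2).trans hU
    rcases h with ⟨g1, g2, g3, g4, g5, g6⟩ | ⟨g1, g2, g3, g4, g5, g6⟩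
    · have hbM' : b ∉ cov M' := by rw [g3]; simp [hne.symm]
      by_cases hz'a : z' = a
      · have hcM' : c ∉ cov M' := by
          rw [g3, hz'a]; simp [hc, Ne.symm hac]
        have := hbc M' hM' hM'Z (by omega) hbM' hcM'
        rw [this] at hbM
        exact hc hbM
      · have haM' : a ∉ cov M' := by
          rw [g3]; simp [ha, Ne.symm hz'a]
        have := hab M' hM' hM'Z (by omega) haM' hbM'
        rw [← this] at hbM
        exact ha hbM
    · exact hmax ⟨N', hN', hN'Z, by omega⟩
  · exact hac ((hab M hM hMZ hMk ha hbM).trans (hbc M hM hMZ hMk hbM hc))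

/-- The step of Edmonds' algorithm in terms of missable vertices. If the matching number of `Z` is
`k` and `Z ∪ L` has a larger matching, then a single edge of `L`, added to `Z`, gives a larger
matching or a new missable vertex. -/
lemma exists_edge_enlarging (k : ℕ) : ∀ {Z L : Set (Sym2 V)}, HasMat Z k → ¬ HasMat Z (k + 1) →
    HasMat (Z ∪ L) (k + 1) →
    ∃ e ∈ L, HasMat (insert e Z) (k + 1) ∨ ∃ z, Missable (insert e Z) k z ∧ ¬ Missable Z k z := by
  induction k with
  | zero =>
    rintro Z L - hZ ⟨N, hN, hNZ, hNc⟩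
    obtain ⟨e, rfl⟩ := Finset.card_eq_one.1 hNc
    have he : e ∈ Z ∪ L := hNZ (by simp)
    rcases he with he | he
    · exact absurd ⟨{e}, hN, by simpa using he, by simp⟩ hZ
    · exact ⟨e, he, Or.inl ⟨{e}, hN, by simp, by simp⟩⟩
  | succ k ih =>
    intro Z L hk hmax hZL
    by_contra hcon
    push Not at hcon
    have hins : ∀ {e}, e ∈ Z ∪ L → ¬ HasMat (insert e Z) (k + 1 + 1) := by
      rintro e (he | he)
      · rwa [Set.insert_eq_of_mem he]
      · exact (hcon e he).1
    have hinsD : ∀ {e}, e ∈ Z ∪ L → ∀ {z}, Missable (insert e Z) (k + 1) z →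
        Missable Z (k + 1) z := by
      rintro e (he | he) z hz
      · rwa [Set.insert_eq_of_mem he] at hz
      · exact (hcon e he).2 z hz
    by_cases hcross : ∃ d w, s(d, w) ∈ Z ∪ L ∧ Missable Z (k + 1) d ∧ ¬ Missable Z (k + 1) w
    · -- `w` is then covered by every maximum matching, and the induction is applied to `Z - w`.
      obtain ⟨d, w, hdw, ⟨M, hM, hMZ, hMk, hdM⟩, hw⟩ := hcross
      have hwM : w ∈ cov M := by
        by_contra h; exact hw ⟨M, hM, hMZ, hMk, h⟩
      have hdw' : d ≠ w := by rintro rfl; exact hdM hwM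
      -- The partner `w'` of `w` is missable as well, and the edge `ww'` lies in `Z` itself.
      obtain ⟨w', hw'⟩ := exists_mk_of_mem_cov hwM
      have hw'w : w ≠ w' := hM.ne hw'
      have hw'D : Missable Z (k + 1) w' := by
        have hdM' : d ∉ cov (M.erase s(w, w')) :=
          fun h => hdM (cov_mono (Finset.erase_subset _ _) h)
        refine hinsD hdw ⟨insert s(d, w) (M.erase s(w, w')), ?_, ?_, ?_, ?_⟩
        · exact (hM.erase _).insert_mk hdw' hdM' (by rw [hM.cov_erase hw']; simp)
        · intro f hf
          rcases Finset.mem_insert.1 hf with rfl | hf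
          · exact Or.inl rfl
          · exact Or.inr (hMZ (Finset.mem_of_mem_erase hf))
        · rw [IsMat.card_insert_mk hdM', Finset.card_erase_of_mem hw']
          omega
        · rw [cov_insert_mk, hM.cov_erase hw']
          have : w' ≠ d := by rintro rfl; exact hdM (mem_cov_right hw')
          simp [this, hw'w.symm]
      obtain ⟨Q, hQ, hQZ, hQk, hw'Q⟩ := hw'D
      have haZ : avoiding Z w ⊆ Z := fun e he => he.1
      have h1 : HasMat (avoiding Z w) k := by
        refine ⟨M.erase s(w, w'), hM.erase _, subset_avoiding ?_ ?_, ?_⟩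
        · exact (Finset.coe_subset.2 (Finset.erase_subset _ _)).trans hMZ
        · rw [hM.cov_erase hw']; simp
        · rw [Finset.card_erase_of_mem hw']; omega
      have h2 : ¬ HasMat (avoiding Z w) (k + 1) := by
        rintro ⟨N, hN, hNZ, hNc⟩
        exact hw ⟨N, hN, hNZ.trans haZ, hNc, notMem_cov_of_avoiding hNZ⟩
      have h3 : HasMat (avoiding Z w ∪ avoiding L w) (k + 1) := by
        have hun : avoiding (Z ∪ L) w = avoiding Z w ∪ avoiding L w := by
          ext e; simp only [avoiding, Set.mem_ofPred_eq, Set.mem_union]; tauto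
        rw [← hun]
        obtain ⟨N, hN, hNZ, hNc⟩ := hZL
        by_cases hwN : w ∈ cov N
        · obtain ⟨w', hw'⟩ := exists_mk_of_mem_cov hwN
          refine ⟨N.erase s(w, w'), hN.erase _, subset_avoiding ?_ ?_, ?_⟩
          · exact (Finset.coe_subset.2 (Finset.erase_subset _ _)).trans hNZ
          · rw [hN.cov_erase hw']; simp
          · rw [Finset.card_erase_of_mem hw']; omega
        · exact HasMat.of_le hN (subset_avoiding hNZ hwN) (by omega)
      obtain ⟨e, he, hcase⟩ := ih h1 h2 h3
      have heZL : e ∈ Z ∪ L := Or.inr he.1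
      have hsub : insert e (avoiding Z w) ⊆ avoiding (insert e Z) w := by
        rintro f (rfl | hf)
        · exact ⟨Or.inl rfl, he.2⟩
        · exact ⟨Or.inr hf.1, hf.2⟩
      have haZe : avoiding (insert e Z) w ⊆ insert e Z := fun f hf => hf.1
      rcases hcase with ⟨N, hN, hNZ, hNc⟩ | ⟨z, ⟨N, hN, hNZ, hNc, hzN⟩, hz⟩
      · exact hw (hinsD heZL ⟨N, hN, (hNZ.trans hsub).trans haZe, hNc,
          notMem_cov_of_avoiding (hNZ.trans hsub)⟩)
      · have hwN : w ∉ cov N := notMem_cov_of_avoiding (hNZ.trans hsub)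
        have hzZ : ¬ Missable Z (k + 1) z := by
          rintro ⟨Q, hQ, hQZ, hQk, hzQ⟩
          have hwQ : w ∈ cov Q := by
            by_contra h; exact hw ⟨Q, hQ, hQZ, hQk, h⟩
          obtain ⟨w', hw'⟩ := exists_mk_of_mem_cov hwQ
          refine hz ⟨Q.erase s(w, w'), hQ.erase _, subset_avoiding ?_ ?_, ?_, ?_⟩
          · exact (Finset.coe_subset.2 (Finset.erase_subset _ _)).trans hQZ
          · rw [hQ.cov_erase hw']; simp
          · rw [Finset.card_erase_of_mem hw']; omega
          · exact fun h => hzQ (cov_mono (Finset.erase_subset _ _) h)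
        have hzw : z ≠ w := by
          rintro rfl
          obtain ⟨Q, hQ, hQZ, hQk⟩ := h1
          exact hz ⟨Q, hQ, hQZ, hQk, notMem_cov_of_avoiding hQZ⟩
        have hw'z : w' ≠ z := by rintro rfl; exact hzZ ⟨Q, hQ, hQZ, hQk, hw'Q⟩
        have hzQ : z ∈ cov Q := by
          by_contra h; exact hzZ ⟨Q, hQ, hQZ, hQk, h⟩
        obtain ⟨y, Q', P', yne, hQ', hP', t1, t2, t⟩ := exists_exchange_card hQ hN hzQ hzN
        have hU : ((Q ∪ N : Finset (Sym2 V)) : Set (Sym2 V)) ⊆ insert e Z := by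
          rw [Finset.coe_union]
          exact Set.union_subset (hQZ.trans (Set.subset_insert _ _))
            ((hNZ.trans hsub).trans haZe)
        have hQ'Z : (Q' : Set (Sym2 V)) ⊆ insert e Z := (Finset.coe_subset.2 t1).trans hU
        have hP'Z : (P' : Set (Sym2 V)) ⊆ insert e Z := (Finset.coe_subset.2 t2).trans hU
        rcases t with ⟨r1, r2, r3, r4, r5, r6⟩ | ⟨r1, r2, r3, r4, r5, r6⟩
        · exact hzZ (hinsD heZL ⟨Q', hQ', hQ'Z, by omega, by rw [r3]; simp [yne.symm]⟩)
        · by_cases hyw : y = w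
          · -- The alternating path from `z` ends at `w`; the edge `ww'` repairs the loss of
            -- one edge.
            subst hyw
            have hyQ' : y ∉ cov Q' := by rw [r3]; simp
            have hw'Q' : w' ∉ cov Q' := by rw [r3]; simp [hw'Q]
            refine hzZ (hinsD heZL ⟨insert s(y, w') Q', hQ'.insert_mk hw'w hyQ' hw'Q', ?_,
              ?_, ?_⟩)
            · intro f hf
              rcases Finset.mem_insert.1 hf with rfl | hf
              · exact Or.inr (hMZ hw')
              · exact hQ'Z hf
            · rw [IsMat.card_insert_mk hyQ']; omega
            · rw [cov_insert_mk, r3]; simp [hw'z.symm, yne.symm]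
          · refine hw (hinsD heZL ⟨P', hP', hP'Z, by omega, ?_⟩)
            rw [r4]; simp [Ne.symm hyw, hzw.symm, hwN]
    · push Not at hcross
      obtain ⟨M, hM, hMZ, hMk⟩ := hk
      obtain ⟨N, hN, hNZ, hNk⟩ := hZL
      obtain ⟨p, q, N', hpq, hp, hq, -, hreach, -⟩ :=
        exists_augmenting _ rfl hM hN (by omega)
      have key : ∀ b, Relation.ReflTransGen (fun a b => s(a, b) ∈ M ∪ N) p b →
          Missable Z (k + 1) b ∧ ∀ M : Finset (Sym2 V), IsMat M → ↑M ⊆ Z → M.card = k + 1 →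
            p ∉ cov M → b ∉ cov M → p = b := by
        intro b hb
        induction hb with
        | refl => exact ⟨⟨M, hM, hMZ, hMk, hp⟩, fun _ _ _ _ _ _ => rfl⟩
        | @tail b c hb hbc ih =>
          have hbcZ : s(b, c) ∈ Z ∪ L := by
            rcases Finset.mem_union.1 hbc with h | h
            · exact Or.inl (hMZ h)
            · exact hNZ h
          have hbc' : b ≠ c := by
            rcases Finset.mem_union.1 hbc with h | h
            · exact hM.ne h
            · exact hN.ne h
          refine ⟨hcross b c hbcZ ih.1, not_both_missed_trans hmax ih.1 ih.2 ?_⟩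
          intro Q hQ hQZ hQk hbQ hcQ
          exfalso
          refine hins hbcZ ?_
          rw [← hQk]
          exact HasMat.of_insert hQ (hQZ.trans (Set.subset_insert _ _)) hbc' hbQ hcQ (Or.inl rfl)
      exact hpq ((key q hreach).2 M hM hMZ hMk hp hq)

end Missable

end RainbowAAP

namespace RainbowAAP

/-! ### Families of edge sets without a rainbow augmentation -/

section Families

variable {V ι : Type*} [DecidableEq V] [DecidableEq ι]

set_option linter.unusedSectionVars false

/-- The edges of `T` can be given distinct colours from `S`, where `E c` is the set of edges that
may receive the colour `c`. -/
def Rainbow (E : ι → Set (Sym2 V)) (S : Finset ι) (T : Finset (Sym2 V)) : Prop :=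
  ∃ c : Sym2 V → ι, Set.InjOn c T ∧ ∀ e ∈ T, c e ∈ S ∧ e ∈ E (c e)

namespace Rainbow

variable {E : ι → Set (Sym2 V)} {S S' : Finset ι} {T T' : Finset (Sym2 V)}

lemma mono (h : Rainbow E S T) (hT : T' ⊆ T) (hS : S ⊆ S') : Rainbow E S' T' := by
  obtain ⟨c, h1, h2⟩ := h
  exact ⟨c, h1.mono (Finset.coe_subset.2 hT), fun e he => ⟨hS (h2 e (hT he)).1, (h2 e (hT he)).2⟩⟩

lemma insert {e : Sym2 V} {d : ι} (h : Rainbow E S T) (hd : d ∉ S) (he : e ∈ E d) :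
    Rainbow E (insert d S) (insert e T) := by
  obtain ⟨c, h1, h2⟩ := h
  by_cases heT : e ∈ T
  · rw [Finset.insert_eq_of_mem heT]
    exact ⟨c, h1, fun f hf => ⟨Finset.mem_insert_of_mem (h2 f hf).1, (h2 f hf).2⟩⟩
  have hne : ∀ {f}, f ∈ T → f ≠ e := fun hf hfe => heT (hfe ▸ hf)
  refine ⟨Function.update c e d, ?_, ?_⟩
  · intro f hf g hg hfg
    rcases Finset.mem_insert.1 (Finset.mem_coe.1 hf) with rfl | hf' <;>
      rcases Finset.mem_insert.1 (Finset.mem_coe.1 hg) with rfl | hg'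
    · rfl
    · rw [Function.update_self, Function.update_of_ne (hne hg')] at hfg
      exact absurd (hfg ▸ (h2 g hg').1) hd
    · rw [Function.update_self, Function.update_of_ne (hne hf')] at hfg
      exact absurd (hfg ▸ (h2 f hf').1) hd
    · rw [Function.update_of_ne (hne hg'), Function.update_of_ne (hne hf')] at hfg
      exact h1 hf' hg' hfg
  · intro f hf
    rcases Finset.mem_insert.1 hf with rfl | hf
    · rw [Function.update_self]
      exact ⟨Finset.mem_insert_self _ _, he⟩
    · rw [Function.update_of_ne (hne hf)]
      exact ⟨Finset.mem_insert_of_mem (h2 f hf).1, (h2 f hf).2⟩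

lemma empty [Nonempty ι] : Rainbow E S ∅ :=
  ⟨fun _ => Classical.arbitrary ι, by simp, by simp⟩

/-- Edges that belong to all the sets of enough colours can be coloured in any way. -/
lemma of_card_le [Nonempty ι] (hc : T.card ≤ S.card) (h : ∀ e ∈ T, ∀ d ∈ S, e ∈ E d) :
    Rainbow E S T := by
  obtain ⟨f, hf⟩ : ∃ f : T ↪ S, True := by
    have : Nonempty (T ↪ S) := by
      rw [Function.Embedding.nonempty_iff_card_le]
      simpa using hc
    exact ⟨this.some, trivial⟩
  classical
  refine ⟨fun e => if he : e ∈ T then (f ⟨e, he⟩ : ι) else Classical.arbitrary ι, ?_, ?_⟩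
  · intro a ha b hb hab
    have ha' : a ∈ T := ha
    have hb' : b ∈ T := hb
    simp only [ha', hb', dite_true] at hab
    have := f.injective (Subtype.ext hab)
    simpa using this
  · intro e he
    simp only [he, dite_true]
    exact ⟨(f ⟨e, he⟩).2, h e he _ (f ⟨e, he⟩).2⟩

lemma erase {e : Sym2 V} (h : Rainbow E S T) (he : e ∈ T) :
    ∃ d ∈ S, e ∈ E d ∧ Rainbow E (S.erase d) (T.erase e) := by
  obtain ⟨c, h1, h2⟩ := h
  refine ⟨c e, (h2 e he).1, (h2 e he).2, c, h1.mono (by simp), ?_⟩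
  intro f hf
  obtain ⟨hfe, hf⟩ := Finset.mem_erase.1 hf
  exact ⟨Finset.mem_erase.2 ⟨fun h => hfe (h1 hf he h), (h2 f hf).1⟩, (h2 f hf).2⟩

end Rainbow

/-- `F` is a matching, any `t + 1` of the sets `E c`, `c ∈ S`, form with `F` a graph that contains
a matching larger than `F`, but no such matching uses edges of distinct colours outside `F`. The
sets `E c` are taken disjoint from `F`. -/
structure Inst (F : Finset (Sym2 V)) (E : ι → Set (Sym2 V)) (S : Finset ι) (t : ℕ) : Prop where
  mat : IsMat F
  nodiag : ∀ c, ∀ e ∈ E c, ¬ e.IsDiag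
  disj : ∀ c, ∀ e ∈ E c, e ∉ F
  aug : ∀ I ⊆ S, I.card = t + 1 → HasMat (↑F ∪ ⋃ i ∈ I, E i) (F.card + 1)
  norb : ∀ N : Finset (Sym2 V), IsMat N → N.card = F.card + 1 → ¬ Rainbow E S (N \ F)

/-- The vertices covered by `F` that are missed by some matching of size `|F|` in `F ∪ T`. -/
noncomputable def missed (F T : Finset (Sym2 V)) : Finset V :=
  @Finset.filter V (Missable (↑F ∪ ↑T) F.card) (Classical.decPred _) (cov F)

lemma mem_missed {F T : Finset (Sym2 V)} {v : V} :
    v ∈ missed F T ↔ v ∈ cov F ∧ Missable (↑F ∪ ↑T) F.card v := by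
  simp [missed]

namespace Inst

variable {F : Finset (Sym2 V)} {E : ι → Set (Sym2 V)} {S : Finset ι} {t : ℕ}

lemma not_hasMat (h : Inst F E S t) {T : Finset (Sym2 V)} (hT : Rainbow E S T) :
    ¬ HasMat (↑F ∪ ↑T : Set (Sym2 V)) (F.card + 1) := by
  rintro ⟨N, hN, hNZ, hNc⟩
  refine h.norb N hN hNc (hT.mono ?_ subset_rfl)
  intro e he
  obtain ⟨h1, h2⟩ := Finset.mem_sdiff.1 he
  rcases hNZ h1 with h | h
  · exact absurd h h2
  · exact h

/-- A rainbow set that leaves `t + 1` colours unused can be extended by an edge that makes another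
vertex missable. -/
lemma exists_extension (h : Inst F E S t) {T : Finset (Sym2 V)} (hT : Rainbow E S T)
    (hc : T.card + t + 1 ≤ S.card) :
    ∃ e ∉ T, Rainbow E S (insert e T) ∧ missed F T ⊂ missed F (insert e T) := by
  obtain ⟨c, h1, h2⟩ := hT
  have hT : Rainbow E S T := ⟨c, h1, h2⟩
  have hcard : t + 1 ≤ (S \ T.image c).card := by
    have := Finset.le_card_sdiff (T.image c) S
    have := Finset.card_image_le (s := T) (f := c)
    omega
  obtain ⟨I, hI, hIc⟩ := Finset.exists_subset_card_eq hcard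
  have hIS : I ⊆ S := hI.trans Finset.sdiff_subset
  have haug := (h.aug I hIS hIc).mono
    (Set.union_subset_union_left (⋃ i ∈ I, E i) (Set.subset_union_left (t := (T : Set (Sym2 V)))))
  obtain ⟨e, he, hcase⟩ :=
    exists_edge_enlarging F.card (Z := ↑F ∪ ↑T) ⟨F, h.mat, Set.subset_union_left, rfl⟩
      (h.not_hasMat hT) haug
  have hcoe : (insert e (↑F ∪ ↑T) : Set (Sym2 V)) = ↑F ∪ ↑(insert e T) := by
    rw [Finset.coe_insert, Set.union_insert]
  obtain ⟨i, hiI, hei⟩ : ∃ i ∈ I, e ∈ E i := by simpa using he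
  have hiT : i ∉ T.image c := (Finset.mem_sdiff.1 (hI hiI)).2
  have hT' : Rainbow E S (insert e T) := by
    have hr : Rainbow E (S.erase i) T := by
      refine ⟨c, h1, fun f hf => ⟨Finset.mem_erase.2 ⟨?_, (h2 f hf).1⟩, (h2 f hf).2⟩⟩
      rintro rfl
      exact hiT (Finset.mem_image_of_mem _ hf)
    have := hr.insert (Finset.notMem_erase _ _) hei
    rwa [Finset.insert_erase (hIS hiI)] at this
  rw [hcoe] at hcase
  rcases hcase with hcase | ⟨z, hz, hz'⟩
  · exact absurd hcase (h.not_hasMat hT')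
  · refine ⟨e, fun heT => ?_, hT', ?_⟩
    · rw [Finset.insert_eq_of_mem heT] at hz
      exact hz' hz
    · rw [Finset.ssubset_iff_of_subset]
      · refine ⟨z, mem_missed.2 ⟨?_, hz⟩, fun h => hz' (mem_missed.1 h).2⟩
        by_contra hzF
        exact hz' ⟨F, h.mat, Set.subset_union_left, rfl, hzF⟩
      · intro v hv
        rw [mem_missed] at hv ⊢
        refine ⟨hv.1, hv.2.mono (Set.union_subset_union_right _ ?_)⟩
        simp

lemma card_missed_le (F T : Finset (Sym2 V)) (hF : IsMat F) :
    (missed F T).card ≤ 2 * F.card := by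
  rw [← hF.card_cov]
  exact Finset.card_le_card fun v hv => (mem_missed.1 hv).1

/-- The counting bound: a rainbow set makes few vertices missable. For `T = ∅` it bounds the number
of colours. -/
lemma bound (h : Inst F E S t) {T : Finset (Sym2 V)} (hT : Rainbow E S T) :
    (missed F T).card + S.card ≤ T.card + 2 * F.card + t := by
  generalize hn : 2 * F.card - (missed F T).card = n
  induction n using Nat.strong_induction_on generalizing T with
  | _ n ih =>
    have hle := card_missed_le F T h.mat
    by_cases hc : T.card + t + 1 ≤ S.card
    · obtain ⟨e, he, hT', hlt⟩ := h.exists_extension hT hc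
      have hlt := Finset.card_lt_card hlt
      have hle' := card_missed_le F (insert e T) h.mat
      have := ih _ (by omega) hT' rfl
      rw [Finset.card_insert_of_notMem he] at this
      omega
    · omega

/-- In the extremal case there is a rainbow set that makes every vertex missable. -/
lemma exists_full (h : Inst F E S t) [Nonempty ι] (hS : S.card = 2 * F.card + t) :
    ∃ T, Rainbow E S T ∧ ∀ v ∈ cov F, Missable (↑F ∪ ↑T) F.card v := by
  have key : ∀ n ≤ 2 * F.card, ∃ T, Rainbow E S T ∧ T.card = n ∧ n ≤ (missed F T).card := by
    intro n
    induction n with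
    | zero => exact fun _ => ⟨∅, Rainbow.empty, by simp, by simp⟩
    | succ n ih =>
      intro hn
      obtain ⟨T, hT, hTn, hm⟩ := ih (by omega)
      obtain ⟨e, he, hT', hlt⟩ := h.exists_extension hT (by omega)
      have hlt := Finset.card_lt_card hlt
      exact ⟨insert e T, hT', by rw [Finset.card_insert_of_notMem he, hTn], by omega⟩
  obtain ⟨T, hT, hTn, hm⟩ := key _ le_rfl
  refine ⟨T, hT, ?_⟩
  have : missed F T = cov F :=
    Finset.eq_of_subset_of_card_le (fun v hv => (mem_missed.1 hv).1) (by rw [h.mat.card_cov]; omega)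
  intro v hv
  rw [← this] at hv
  exact (mem_missed.1 hv).2

/-- An odd cycle of length five through an uncovered vertex `x` would make four vertices missable
with three colours. -/
lemma no_five_cycle (h : Inst F E S t) (hS : S.card = 2 * F.card + t) {x u v a b : V} {i j l : ι}
    (hx : x ∉ cov F) (huv : s(u, v) ∈ F) (hab : s(a, b) ∈ F) (hne : s(u, v) ≠ s(a, b))
    (hi : i ∈ S) (hj : j ∈ S) (hl : l ∈ S) (hij : i ≠ j) (hil : i ≠ l) (hjl : j ≠ l)
    (h1 : s(x, u) ∈ E i) (h2 : s(v, a) ∈ E j) (h3 : s(b, x) ∈ E l) : False := by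
  have hxu : x ≠ u := by rintro rfl; exact hx (mem_cov_left huv)
  have hxv : x ≠ v := by rintro rfl; exact hx (mem_cov_right huv)
  have hxa : x ≠ a := by rintro rfl; exact hx (mem_cov_left hab)
  have hxb : x ≠ b := by rintro rfl; exact hx (mem_cov_right hab)
  have huv' := h.mat.ne huv
  have hab' := h.mat.ne hab
  have hdisj : ∀ w, w ∈ s(u, v) → w ∈ s(a, b) → False := fun w hw hw' =>
    hne (h.mat.2 _ huv _ hab w hw hw')
  have hua : u ≠ a := fun h => hdisj u (by simp) (by simp [h])
  have hub : u ≠ b := fun h => hdisj u (by simp) (by simp [h])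
  have hva : v ≠ a := fun h => hdisj v (by simp) (by simp [h])
  have hvb : v ≠ b := fun h => hdisj v (by simp) (by simp [h])
  have : Nonempty ι := ⟨i⟩
  set T : Finset (Sym2 V) := {s(x, u), s(v, a), s(b, x)} with hT
  have hTr : Rainbow E S T := by
    have := (((Rainbow.empty (E := E) (S := ∅)).insert (by simp) h3).insert (d := j)
      (by simp [hjl]) h2).insert (d := i) (by simp [hij, hil]) h1
    refine this.mono (by simp [hT]) ?_
    intro c hc
    simp only [Finset.mem_insert, Finset.notMem_empty, or_false] at hc
    rcases hc with rfl | rfl | rfl <;> assumption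
  have hTc : T.card ≤ 3 := Finset.card_le_three
  -- `F₁` misses `u`, `v`, `x`, and `F₂` misses `a` and `b` in addition.
  have hF1 := h.mat.erase s(u, v)
  have hc1 := h.mat.cov_erase huv
  have hab1 : s(a, b) ∈ F.erase s(u, v) := Finset.mem_erase.2 ⟨hne.symm, hab⟩
  have hF2 := hF1.erase s(a, b)
  have hc2 := hF1.cov_erase hab1
  have hcard1 := Finset.card_erase_add_one huv
  have hcard2 := Finset.card_erase_add_one hab1
  set F1 := F.erase s(u, v) with hF1d
  set F2 := F1.erase s(a, b) with hF2d
  have hF1F : F1 ⊆ F := Finset.erase_subset _ _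
  have hF2F : F2 ⊆ F := (Finset.erase_subset _ _).trans hF1F
  have single : ∀ p q r, s(p, q) ∈ T → p ≠ q → p ∉ cov F1 → q ∉ cov F1 → r ∉ cov F1 → r ≠ p →
      r ≠ q → Missable (↑F ∪ ↑T) F.card r := by
    intro p q r hpq hne hp hq hr hrp hrq
    refine ⟨insert s(p, q) F1, hF1.insert_mk hne hp hq, ?_, ?_, ?_⟩
    · intro e he
      rcases Finset.mem_insert.1 he with rfl | he
      · exact Or.inr hpq
      · exact Or.inl (hF1F he)
    · rw [IsMat.card_insert_mk hp]; omega
    · rw [cov_insert_mk]; simp [hrp, hrq, hr]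
  have double : ∀ p q p' q' r, s(p, q) ∈ T → s(p', q') ∈ T → p ≠ q → p' ≠ q' → p ∉ cov F2 →
      q ∉ cov F2 → p' ∉ cov F2 → q' ∉ cov F2 → p' ≠ p → p' ≠ q → q' ≠ p → q' ≠ q →
      r ∉ cov F2 → r ≠ p → r ≠ q → r ≠ p' → r ≠ q' → Missable (↑F ∪ ↑T) F.card r := by
    intro p q p' q' r hpq hpq' hne hne' hp hq hp' hq' d1 d2 d3 d4 hr r1 r2 r3 r4
    have hp'' : p' ∉ cov (insert s(p, q) F2) := by rw [cov_insert_mk]; simp [d1, d2, hp']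
    have hq'' : q' ∉ cov (insert s(p, q) F2) := by rw [cov_insert_mk]; simp [d3, d4, hq']
    refine ⟨insert s(p', q') (insert s(p, q) F2), (hF2.insert_mk hne hp hq).insert_mk hne' hp'' hq'',
      ?_, ?_, ?_⟩
    · intro e he
      rcases Finset.mem_insert.1 he with rfl | he
      · exact Or.inr hpq'
      rcases Finset.mem_insert.1 he with rfl | he
      · exact Or.inr hpq
      · exact Or.inl (hF2F he)
    · rw [IsMat.card_insert_mk hp'', IsMat.card_insert_mk hp]; omega
    · rw [cov_insert_mk, cov_insert_mk]; simp [r1, r2, r3, r4, hr]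
  have t1 : s(x, u) ∈ T := by simp [hT]
  have t2 : s(v, a) ∈ T := by simp [hT]
  have t3 : s(b, x) ∈ T := by simp [hT]
  have mu : Missable (↑F ∪ ↑T) F.card u :=
    double v a b x u t2 t3 hva hxb.symm (by simp [hc2, hc1]) (by simp [hc2])
      (by simp [hc2]) (by simp [hc2, hc1, hx]) hvb.symm hab'.symm hxv hxa (by simp [hc2, hc1])
      huv' hua hub hxu.symm
  have mv : Missable (↑F ∪ ↑T) F.card v :=
    single x u v t1 hxu (by simp [hc1, hx]) (by simp [hc1]) (by simp [hc1]) hxv.symm huv'.symm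
  have mb : Missable (↑F ∪ ↑T) F.card b :=
    double x u v a b t1 t2 hxu hva (by simp [hc2, hc1, hx]) (by simp [hc2, hc1])
      (by simp [hc2, hc1]) (by simp [hc2]) hxv.symm huv'.symm hxa.symm hua.symm
      (by simp [hc2]) hxb.symm hub.symm hvb.symm hab'.symm
  have ma : Missable (↑F ∪ ↑T) F.card a := by
    have hF1' := h.mat.erase s(a, b)
    have hc1' := h.mat.cov_erase hab
    have hcard' := Finset.card_erase_add_one hab
    have hb : b ∉ cov (F.erase s(a, b)) := by simp [hc1']
    have hx' : x ∉ cov (F.erase s(a, b)) := by simp [hc1', hx]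
    refine ⟨insert s(b, x) (F.erase s(a, b)), hF1'.insert_mk hxb.symm hb hx', ?_, ?_, ?_⟩
    · intro e he
      rcases Finset.mem_insert.1 he with rfl | he
      · exact Or.inr t3
      · exact Or.inl (Finset.mem_of_mem_erase he)
    · rw [IsMat.card_insert_mk hb]; omega
    · rw [cov_insert_mk, hc1']; simp [hab', hxa.symm]
  have hsub : ({u, v, a, b} : Finset V) ⊆ missed F T := by
    intro w hw
    simp only [Finset.mem_insert, Finset.mem_singleton] at hw
    rw [mem_missed]
    rcases hw with rfl | rfl | rfl | rfl
    · exact ⟨mem_cov_left huv, mu⟩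
    · exact ⟨mem_cov_right huv, mv⟩
    · exact ⟨mem_cov_left hab, ma⟩
    · exact ⟨mem_cov_right hab, mb⟩
  have h4 : ({u, v, a, b} : Finset V).card = 4 := by
    rw [Finset.card_insert_of_notMem (by simp [huv', hua, hub]),
      Finset.card_insert_of_notMem (by simp [hva, hvb]), Finset.card_pair hab']
  have := Finset.card_le_card hsub
  have := h.bound hTr
  omega

/-- In the extremal case some uncovered vertex `x` forms a triangle of two colours with an edge of
`F`. -/
lemma exists_triangle (h : Inst F E S t) (hS : S.card = 2 * F.card + t) (hF : 0 < F.card) :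
    ∃ (x u v : V) (i j : ι), x ∉ cov F ∧ s(u, v) ∈ F ∧ i ∈ S ∧ j ∈ S ∧ i ≠ j ∧
      s(x, u) ∈ E i ∧ s(x, v) ∈ E j := by
  have : Nonempty ι := by
    obtain ⟨i, hi⟩ := Finset.card_pos.1 (show 0 < S.card by omega)
    exact ⟨i⟩
  obtain ⟨T, hT, hfull⟩ := h.exists_full hS
  have hmax := h.not_hasMat hT
  have hFT : ((F : Finset (Sym2 V)) : Set (Sym2 V)) ⊆ ↑F ∪ ↑T := Set.subset_union_left
  -- For every covered `u`, some matching in `F ∪ T` trades `u` for an uncovered vertex.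
  have trade : ∀ u ∈ cov F, ∃ (r : V) (M' : Finset (Sym2 V)), r ∉ cov F ∧ IsMat M' ∧
      ↑M' ⊆ (↑F ∪ ↑T : Set (Sym2 V)) ∧ cov M' = insert r ((cov F).erase u) ∧
      M'.card = F.card ∧ ∃ b, r ≠ b ∧ s(r, b) ∈ T := by
    intro u hu
    obtain ⟨M, hM, hMZ, hMk, huM⟩ := hfull u hu
    obtain ⟨r, F', M', hne, hF', hM', h1, h2, hcase⟩ := exists_exchange_card h.mat hM hu huM
    have hU : ((F ∪ M : Finset (Sym2 V)) : Set (Sym2 V)) ⊆ ↑F ∪ ↑T := by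
      rw [Finset.coe_union]; exact Set.union_subset hFT hMZ
    rcases hcase with ⟨g1, g2, g3, g4, g5, g6⟩ | ⟨g1, g2, g3, g4, g5, g6⟩
    · refine ⟨r, F', g2, hF', (Finset.coe_subset.2 h1).trans hU, g3, g5, ?_⟩
      obtain ⟨b, hb⟩ := exists_mk_of_mem_cov g1
      refine ⟨b, hM.ne hb, ?_⟩
      rcases hMZ hb with hb | hb
      · exact absurd (mem_cov_left hb) g2
      · exact hb
    · exact absurd ⟨M', hM', (Finset.coe_subset.2 h2).trans hU, by omega⟩ hmax
  obtain ⟨e0, he0⟩ := Finset.card_pos.1 hF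
  induction e0 using Sym2.ind with
  | _ u0 v0 =>
  obtain ⟨r, -, hr, -, -, -, -, u, hru, hruT⟩ := trade u0 (mem_cov_left he0)
  have hu : u ∈ cov F := by
    by_contra hu
    exact hmax (HasMat.of_insert h.mat hFT hru hr hu (Or.inr hruT))
  obtain ⟨v, huv⟩ := exists_mk_of_mem_cov hu
  have huv' := h.mat.ne huv
  have hrv : r ≠ v := by rintro rfl; exact hr (mem_cov_right huv)
  -- It suffices that `rv` has a colour, too.
  suffices hrvT : s(r, v) ∈ T by
    obtain ⟨c, hc1, hc2⟩ := hT
    refine ⟨r, u, v, c s(r, u), c s(r, v), hr, huv, (hc2 _ hruT).1, (hc2 _ hrvT).1, ?_,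
      (hc2 _ hruT).2, (hc2 _ hrvT).2⟩
    intro heq
    exact huv' (Sym2.congr_right.1 (hc1 hruT hrvT heq))
  -- Among the matchings of `F ∪ T` that trade `u` for `r`, choose one closest to `F`.
  obtain ⟨F', ⟨hF', hF'Z, hF'c⟩, hmin⟩ := WellFounded.has_min
    (measure fun M : Finset (Sym2 V) => (M \ F).card).wf
    {M | IsMat M ∧ (M : Set (Sym2 V)) ⊆ ↑F ∪ ↑T ∧ cov M = insert r ((cov F).erase u)} (by
      obtain ⟨r', M', hr', hM', hM'Z, hM'c, hM'k, -⟩ := trade u hu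
      have hrr : r' = r := by
        by_contra hne
        refine hmax ?_
        rw [← hM'k]
        refine HasMat.of_insert hM' hM'Z hru ?_ ?_ (Or.inr hruT)
        · rw [hM'c]; simp [hr, Ne.symm hne]
        · rw [hM'c]; simp; rintro rfl; exact hr' hu
      exact ⟨M', hM', hM'Z, hrr ▸ hM'c⟩)
  have hF'k : F'.card = F.card := by
    have h1 := hF'.card_cov
    rw [hF'c, Finset.card_insert_of_notMem (by simp [hr]), Finset.card_erase_of_mem hu,
      h.mat.card_cov] at h1
    omega
  have huF' : u ∉ cov F' := by rw [hF'c]; simp [hru.symm]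
  obtain ⟨b, hrb⟩ := exists_mk_of_mem_cov (show r ∈ cov F' by rw [hF'c]; simp)
  have hrb' := hF'.ne hrb
  have hrbF : s(r, b) ∉ F := IsMat.notMem_of_notMem_cov hr
  have hrbT : s(r, b) ∈ T := (hF'Z hrb).resolve_left hrbF
  by_cases hbv : b = v
  · exact hbv ▸ hrbT
  exfalso
  have hbF : b ∈ cov F ∧ b ≠ u := by
    have := mem_cov_right hrb
    rw [hF'c] at this
    simp only [Finset.mem_insert, Finset.mem_erase] at this
    rcases this with h | h
    · exact absurd h.symm hrb'
    · exact ⟨h.2, h.1⟩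
  set K := F' \ F with hK
  have hKT : K ⊆ T := by
    intro e he
    obtain ⟨h1, h2⟩ := Finset.mem_sdiff.1 he
    exact (hF'Z h1).resolve_left h2
  have hKr : Rainbow E S K := hT.mono hKT subset_rfl
  have hF'K : (F' : Set (Sym2 V)) ⊆ ↑F ∪ ↑K := by
    intro e he
    by_cases heF : e ∈ F
    · exact Or.inl heF
    · exact Or.inr (Finset.mem_sdiff.2 ⟨he, heF⟩)
  have hcardK : K.card = (F \ F').card := by
    have h1 := Finset.card_sdiff_add_card_inter F' F
    have h2 := Finset.card_sdiff_add_card_inter F F'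
    rw [Finset.inter_comm] at h2
    rw [← hK] at h1
    omega
  -- Every edge of `F \ F'` has a vertex that becomes missable through `F'`.
  have hevery : ∀ f ∈ F \ F', ∃ w ∈ missed F K, w ∈ f := by
    intro f hf
    obtain ⟨hfF, hfF'⟩ := Finset.mem_sdiff.1 hf
    induction f using Sym2.ind with
    | _ p q =>
    have hce := h.mat.cov_erase hfF
    have hFe := h.mat.erase s(p, q)
    have hcarde := Finset.card_erase_add_one hfF
    have hpq := h.mat.ne hfF
    have hrp : r ≠ p := by rintro rfl; exact hr (mem_cov_left hfF)
    have hrq : r ≠ q := by rintro rfl; exact hr (mem_cov_right hfF)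
    obtain ⟨z, M', N', hz, hM', hN', s1, s2, hcase⟩ := exists_exchange_card hF' hFe
      (mem_cov_left hrb) (by rw [hce]; simp [hr])
    have hN'F : N' ⊆ F' ∪ F := s2.trans
      (Finset.union_subset_union_right (Finset.erase_subset _ _))
    have hN'K : (N' : Set (Sym2 V)) ⊆ ↑F ∪ ↑K := by
      intro e he
      rcases Finset.mem_union.1 (hN'F he) with h | h
      · exact hF'K h
      · exact Or.inl h
    rcases hcase with ⟨g1, g2, g3, g4, g5, g6⟩ | ⟨g1, g2, g3, g4, g5, g6⟩
    · -- The exchange path ends at `u`; this would yield a matching closer to `F`.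
      exfalso
      have hzu : z = u := by
        by_contra hzu
        refine g2 ?_
        rw [hF'c]
        simp only [Finset.mem_insert, Finset.mem_erase]
        exact Or.inr ⟨hzu, cov_mono (Finset.erase_subset _ _) g1⟩
      subst hzu
      rw [hce] at g1
      simp only [Finset.mem_erase] at g1
      have hpN' : p ∉ cov N' := by rw [g4, hce]; simp [hrp.symm]
      have hqN' : q ∉ cov N' := by rw [g4, hce]; simp [hrq.symm]
      have hQ : insert s(p, q) N' ∈ {M | IsMat M ∧ (M : Set (Sym2 V)) ⊆ ↑F ∪ ↑T ∧
          cov M = insert r ((cov F).erase z)} := by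
        refine ⟨hN'.insert_mk hpq hpN' hqN', ?_, ?_⟩
        · intro e he
          rcases Finset.mem_insert.1 he with rfl | he
          · exact Or.inl hfF
          · exact (hN'K he).imp id (fun h => hKT h)
        · rw [cov_insert_mk, g4, hce]
          have hp := mem_cov_left hfF
          have hq := mem_cov_right hfF
          ext w
          simp only [Finset.mem_insert, Finset.mem_erase]
          by_cases hwp : w = p
          · subst hwp; simp [hp, g1.2.1.symm]
          · by_cases hwq : w = q
            · subst hwq; simp [hq, g1.1.symm]
            · simp [hwp, hwq]
      have hle : K.card ≤ (insert s(p, q) N' \ F).card := not_lt.1 (hmin _ hQ)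
      have hsub : insert s(p, q) N' \ F ⊆ K := by
        intro e he
        obtain ⟨h1, h2⟩ := Finset.mem_sdiff.1 he
        rcases Finset.mem_insert.1 h1 with rfl | h1
        · exact absurd hfF h2
        · exact (hN'K h1).resolve_left h2
      have heq := Finset.eq_of_subset_of_card_le hsub hle
      have hpF' : p ∈ cov F' := by
        rw [hF'c]
        simp only [Finset.mem_insert, Finset.mem_erase]
        exact Or.inr ⟨g1.2.1.symm, mem_cov_left hfF⟩
      obtain ⟨y, hy⟩ := exists_mk_of_mem_cov hpF'
      have hyF : s(p, y) ∉ F := by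
        intro hyF
        rw [h.mat.partner_unique hyF hfF] at hy
        exact hfF' hy
      have hyN : s(p, y) ∈ insert s(p, q) N' \ F := by
        rw [heq]; exact Finset.mem_sdiff.2 ⟨hy, hyF⟩
      have := hQ.1.partner_unique (Finset.mem_sdiff.1 hyN).1 (Finset.mem_insert_self _ _)
      rw [this] at hyF
      exact hyF hfF
    · have hzpq : z = p ∨ z = q := by
        by_contra hcon
        push Not at hcon
        refine g2 ?_
        rw [hce]
        rw [hF'c] at g1
        simp only [Finset.mem_insert, Finset.mem_erase] at g1 ⊢
        exact ⟨hcon.2, hcon.1, (g1.resolve_left hz).2⟩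
      rcases hzpq with rfl | rfl
      · refine ⟨q, mem_missed.2 ⟨mem_cov_right hfF, N', hN', hN'K, by omega, ?_⟩, by simp⟩
        rw [g4, hce]; simp [hpq.symm, hrq.symm]
      · refine ⟨p, mem_missed.2 ⟨mem_cov_left hfF, N', hN', hN'K, by omega, ?_⟩, by simp⟩
        rw [g4, hce]; simp [hpq, hrp.symm]
  have : Nonempty V := ⟨r⟩
  choose! g hg1 hg2 using hevery
  have hginj : Set.InjOn g ((F \ F' : Finset (Sym2 V)) : Set (Sym2 V)) := by
    intro e he f hf hef
    exact h.mat.2 e (Finset.mem_sdiff.1 he).1 f (Finset.mem_sdiff.1 hf).1 (g e)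
      (hg2 e he) (hef ▸ hg2 f hf)
  have hmK : K.card ≤ (missed F K).card := by
    rw [hcardK, ← Finset.card_image_of_injOn hginj]
    refine Finset.card_le_card fun w hw => ?_
    obtain ⟨f, hf, rfl⟩ := Finset.mem_image.1 hw
    exact hg1 f hf
  have huK : u ∈ missed F K := mem_missed.2 ⟨hu, F', hF', hF'K, hF'k, huF'⟩
  have huvF' : s(u, v) ∈ F \ F' := Finset.mem_sdiff.2 ⟨huv, fun h => huF' (mem_cov_left h)⟩
  have hvK : v ∉ missed F K := by
    intro hvK
    -- otherwise both ends of `uv` are missable, which is one vertex too many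
    have hlt : (F \ F').card < (missed F K).card := by
      rw [← Finset.card_image_of_injOn hginj]
      refine Finset.card_lt_card ?_
      rw [Finset.ssubset_iff_of_subset]
      · have huniq : ∀ w ∈ s(u, v), w ∈ (F \ F').image g → w = g s(u, v) := by
          intro w hw hwi
          obtain ⟨f, hf, rfl⟩ := Finset.mem_image.1 hwi
          have := h.mat.2 f (Finset.mem_sdiff.1 hf).1 _ huv (g f) (hg2 f hf) hw
          rw [this]
        by_cases hgu : g s(u, v) = u
        · exact ⟨v, hvK, fun hcon => huv' (hgu.symm.trans (huniq v (by simp) hcon).symm)⟩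
        · exact ⟨u, huK, fun hcon => hgu (huniq u (by simp) hcon).symm⟩
      · intro w hw
        obtain ⟨f, hf, rfl⟩ := Finset.mem_image.1 hw
        exact hg1 f hf
    have := h.bound hKr
    omega
  have hbK : b ∉ missed F K := by
    intro hbK
    obtain ⟨-, Q, hQ, hQZ, hQk, hbQ⟩ := mem_missed.1 hbK
    have hrQ : r ∉ cov Q := by
      intro hrQ
      obtain ⟨y, hy⟩ := exists_mk_of_mem_cov hrQ
      have hyF' : s(r, y) ∈ F' := by
        rcases hQZ hy with h | h
        · exact absurd (mem_cov_left h) hr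
        · exact (Finset.mem_sdiff.1 h).1
      rw [hF'.partner_unique hyF' hrb] at hy
      exact hbQ (mem_cov_right hy)
    refine h.not_hasMat hKr ?_
    rw [← hQk]
    exact HasMat.of_insert hQ hQZ hrb' hrQ hbQ (hF'K hrb)
  set K' := insert s(r, u) K with hK'
  have hK'r : Rainbow E S K' := by
    refine hT.mono ?_ subset_rfl
    intro e he
    rcases Finset.mem_insert.1 he with rfl | he
    · exact hruT
    · exact hKT he
  have hruK' : s(r, u) ∈ (↑F ∪ ↑K' : Set (Sym2 V)) := Or.inr (Finset.mem_insert_self _ _)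
  have hKK' : (↑F ∪ ↑K : Set (Sym2 V)) ⊆ ↑F ∪ ↑K' :=
    Set.union_subset_union_right _ (Finset.coe_subset.2 (Finset.subset_insert _ _))
  have hvK' : v ∈ missed F K' := by
    have hce := h.mat.cov_erase huv
    have hcarde := Finset.card_erase_add_one huv
    have hr' : r ∉ cov (F.erase s(u, v)) := by rw [hce]; simp [hr]
    refine mem_missed.2 ⟨mem_cov_right huv, insert s(r, u) (F.erase s(u, v)),
      (h.mat.erase _).insert_mk hru hr' (by rw [hce]; simp), ?_, ?_, ?_⟩
    · intro e he
      rcases Finset.mem_insert.1 he with rfl | he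
      · exact hruK'
      · exact Or.inl (Finset.mem_of_mem_erase he)
    · rw [IsMat.card_insert_mk hr']; omega
    · rw [cov_insert_mk, hce]; simp [huv'.symm, hrv.symm]
  have hbK' : b ∈ missed F K' := by
    have hce := hF'.cov_erase hrb
    have hcarde := Finset.card_erase_add_one hrb
    have hr' : r ∉ cov (F'.erase s(r, b)) := by rw [hce]; simp
    refine mem_missed.2 ⟨hbF.1, insert s(r, u) (F'.erase s(r, b)),
      (hF'.erase _).insert_mk hru hr' (by rw [hce]; simp [huF']), ?_, ?_, ?_⟩
    · intro e he
      rcases Finset.mem_insert.1 he with rfl | he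
      · exact hruK'
      · exact hKK' (hF'K (Finset.mem_of_mem_erase he))
    · rw [IsMat.card_insert_mk hr']; omega
    · rw [cov_insert_mk, hce]; simp [hbF.2, hrb'.symm]
  have hsub : insert v (insert b (missed F K)) ⊆ missed F K' := by
    intro w hw
    rcases Finset.mem_insert.1 hw with rfl | hw
    · exact hvK'
    rcases Finset.mem_insert.1 hw with rfl | hw
    · exact hbK'
    · rw [mem_missed] at hw ⊢
      exact ⟨hw.1, hw.2.mono hKK'⟩
  have hc := Finset.card_le_card hsub
  rw [Finset.card_insert_of_notMem (by simp [Ne.symm hbv, hvK]),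
    Finset.card_insert_of_notMem hbK] at hc
  have := h.bound hK'r
  have : K'.card ≤ K.card + 1 := Finset.card_insert_le _ _
  omega

end Inst
end Families
end RainbowAAP

namespace RainbowAAP

/-! ### Contraction of a triangle -/

section Contraction

variable {V ι : Type*} [DecidableEq V] [DecidableEq ι]

set_option linter.unusedSectionVars false

/-- The map that identifies `u` and `v` with `x`. -/
def fold (x u v w : V) : V := if w = u ∨ w = v then x else w

/-- The images of the sets `E c` when `u` and `v` are identified with `x`, without the loops. The
vertex type is kept, so that `u` and `v` become isolated vertices. -/
def contr (x u v : V) (E : ι → Set (Sym2 V)) (c : ι) : Set (Sym2 V) :=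
  {e | ¬ e.IsDiag ∧ ∃ f ∈ E c, f.map (fold x u v) = e}

/-- The triangle `xuv`, where `x` is uncovered, `uv ∈ F`, and `xu` and `xv` have the distinct
colours `i` and `j`. -/
structure Triangle (F : Finset (Sym2 V)) (E : ι → Set (Sym2 V)) (S : Finset ι) (x u v : V)
    (i j : ι) : Prop where
  hx : x ∉ cov F
  huv : s(u, v) ∈ F
  hi : i ∈ S
  hj : j ∈ S
  hij : i ≠ j
  hxu : s(x, u) ∈ E i
  hxv : s(x, v) ∈ E j

variable {F : Finset (Sym2 V)} {E : ι → Set (Sym2 V)} {S : Finset ι} {t : ℕ} {x u v : V} {i j : ι}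

lemma fold_comm (x u v : V) : fold x u v = fold x v u := by
  funext w; simp only [fold, or_comm]

lemma contr_comm (x u v : V) (E : ι → Set (Sym2 V)) : contr x u v E = contr x v u E := by
  funext c; simp only [contr, fold_comm x u v]

lemma fold_of_ne {w : V} (hu : w ≠ u) (hv : w ≠ v) : fold x u v w = w := by
  simp [fold, hu, hv]

lemma fold_eq (w : V) : (w = u ∨ w = v) ∧ fold x u v w = x ∨
    (w ≠ u ∧ w ≠ v) ∧ fold x u v w = w := by
  unfold fold
  by_cases h : w = u ∨ w = v
  · simp [h]
  · push Not at h
    simp [h]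

lemma mem_contr {c : ι} {a b : V} (hab : a ≠ b)
    (ha : a ≠ x ∧ a ≠ u ∧ a ≠ v) (hb : b ≠ u ∧ b ≠ v) (h : s(a, b) ∈ E c) :
    s(a, b) ∈ contr x u v E c := by
  refine ⟨by simpa using hab, _, h, ?_⟩
  rw [Sym2.map_mk, fold_of_ne ha.2.1 ha.2.2, fold_of_ne hb.1 hb.2]

namespace Triangle

lemma symm (T : Triangle F E S x u v i j) : Triangle F E S x v u j i :=
  ⟨T.hx, Sym2.eq_swap ▸ T.huv, T.hj, T.hi, T.hij.symm, T.hxv, T.hxu⟩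

lemma x_ne_u (T : Triangle F E S x u v i j) : x ≠ u := by
  rintro rfl; exact T.hx (mem_cov_left T.huv)

lemma x_ne_v (T : Triangle F E S x u v i j) : x ≠ v := T.symm.x_ne_u

lemma u_ne_v (T : Triangle F E S x u v i j) (h : Inst F E S t) : u ≠ v := h.mat.ne T.huv

lemma mem_contr_x (T : Triangle F E S x u v i j) {c : ι} {y a : V} (hy : y = x ∨ y = u ∨ y = v)
    (ha : a ≠ x ∧ a ≠ u ∧ a ≠ v) (h : s(y, a) ∈ E c) :
    s(x, a) ∈ contr x u v E c := by
  refine ⟨by simpa using ha.1.symm, _, h, ?_⟩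
  have : fold x u v y = x := by
    rcases hy with rfl | rfl | rfl
    · exact fold_of_ne T.x_ne_u T.x_ne_v
    · simp [fold]
    · simp [fold]
  rw [Sym2.map_mk, this, fold_of_ne ha.2.1 ha.2.2]

/-- The edges of the contracted graph: those away from the triangle are old edges, and those at
`x` come from `x`, `u` or `v`. -/
lemma of_mem_contr (T : Triangle F E S x u v i j) {c : ι} {a b : V}
    (h : s(a, b) ∈ contr x u v E c) :
    a ≠ b ∧ (a ≠ u ∧ a ≠ v) ∧ (b ≠ u ∧ b ≠ v) ∧ (a ≠ x → b ≠ x → s(a, b) ∈ E c) ∧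
      (a = x → s(x, b) ∈ E c ∨ s(u, b) ∈ E c ∨ s(v, b) ∈ E c) := by
  obtain ⟨hd, f, hf, hfe⟩ := h
  have hab : a ≠ b := by simpa using hd
  have hxu := T.x_ne_u
  have hxv := T.x_ne_v
  have key : ∀ p q, s(p, q) ∈ E c → fold x u v p = a → fold x u v q = b →
      (a ≠ u ∧ a ≠ v) ∧ (b ≠ u ∧ b ≠ v) ∧ (a ≠ x → b ≠ x → s(a, b) ∈ E c) ∧
      (a = x → s(x, b) ∈ E c ∨ s(u, b) ∈ E c ∨ s(v, b) ∈ E c) := by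
    intro p q hpq hp hq
    rcases fold_eq (x := x) (u := u) (v := v) p with ⟨h1, h2⟩ | ⟨h1, h2⟩ <;>
      rcases fold_eq (x := x) (u := u) (v := v) q with ⟨h3, h4⟩ | ⟨h3, h4⟩
    · exact absurd ((hp.symm.trans h2).trans (h4.symm.trans hq)) hab
    · rw [hp] at h2; rw [hq] at h4
      subst h2; subst h4
      refine ⟨⟨hxu, hxv⟩, h3, fun h => absurd rfl h, fun _ => ?_⟩
      rcases h1 with rfl | rfl
      · exact Or.inr (Or.inl hpq)
      · exact Or.inr (Or.inr hpq)
    · rw [hp] at h2; rw [hq] at h4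
      subst h2; subst h4
      exact ⟨h1, ⟨hxu, hxv⟩, fun _ h => absurd rfl h, fun h => absurd h hab⟩
    · rw [hp] at h2; rw [hq] at h4
      subst h2; subst h4
      exact ⟨h1, h3, fun _ _ => hpq, fun h => Or.inl (h ▸ hpq)⟩
  refine ⟨hab, ?_⟩
  induction f using Sym2.ind with
  | _ p q =>
  rw [Sym2.map_mk, Sym2.eq_iff] at hfe
  rcases hfe with ⟨h1, h2⟩ | ⟨h1, h2⟩
  · exact key p q hf h1 h2
  · exact key q p (Sym2.eq_swap ▸ hf) h2 h1

lemma erase_cov (T : Triangle F E S x u v i j) (h : Inst F E S t) {w : V} :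
    w ∈ cov (F.erase s(u, v)) ↔ w ∈ cov F ∧ w ≠ u ∧ w ≠ v := by
  rw [h.mat.cov_erase T.huv]
  simp only [Finset.mem_erase]
  tauto

/-- An edge outside `F` at a vertex of the triangle leads to a contracted edge at `x`. -/
lemma mem_union_of_mem (T : Triangle F E S x u v i j) (h : Inst F E S t) {I : Finset ι} {y a : V}
    (hy : y = x ∨ y = u ∨ y = v) (ha : a ≠ x ∧ a ≠ u ∧ a ≠ v)
    (hm : s(y, a) ∈ (↑F ∪ ⋃ c ∈ I, E c : Set (Sym2 V))) :
    s(x, a) ∈ (↑(F.erase s(u, v)) ∪ ⋃ c ∈ I, contr x u v E c : Set (Sym2 V)) := by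
  rcases hm with hm | hm
  · exfalso
    rcases hy with rfl | rfl | rfl
    · exact T.hx (mem_cov_left hm)
    · exact ha.2.2 (h.mat.partner_unique hm T.huv)
    · exact ha.2.1 (h.mat.partner_unique hm T.symm.huv)
  · obtain ⟨c, hc, hm⟩ : ∃ c ∈ I, s(y, a) ∈ E c := by simpa using hm
    refine Or.inr ?_
    simp only [Set.mem_iUnion]
    exact ⟨c, hc, T.mem_contr_x hy ha hm⟩

/-- The contracted graph contains a matching larger than the contracted `F`. -/
lemma contr_aug (T : Triangle F E S x u v i j) (h : Inst F E S t) {I : Finset ι}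
    (haug : HasMat (↑F ∪ ⋃ c ∈ I, E c) (F.card + 1)) :
    HasMat (↑(F.erase s(u, v)) ∪ ⋃ c ∈ I, contr x u v E c) ((F.erase s(u, v)).card + 1) := by
  obtain ⟨N, hN, hNZ, hNc⟩ := haug
  have hcard := Finset.card_erase_add_one T.huv
  have hF1 := h.mat.erase s(u, v)
  set F1 := F.erase s(u, v) with hF1d
  set Z : Set (Sym2 V) := ↑F1 ∪ ⋃ c ∈ I, contr x u v E c with hZ
  set X : Finset V := {x, u, v} with hX
  have hmX : ∀ {y}, y ∈ X ↔ y = x ∨ y = u ∨ y = v := by intro y; simp [hX]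
  have hnX : ∀ {y}, y ∉ X → y ≠ x ∧ y ≠ u ∧ y ≠ v := by
    intro y hy; rw [hmX] at hy; push Not at hy; exact hy
  -- `N₁` consists of the edges of `N` away from the triangle, `B` of the others.
  set N1 := N.filter (fun e => ∀ y ∈ X, y ∉ e) with hN1
  set B := N.filter (fun e => ¬ ∀ y ∈ X, y ∉ e) with hB
  have hNB : N1.card + B.card = N.card := Finset.card_filter_add_card_filter_not _
  have hN1N : N1 ⊆ N := Finset.filter_subset _ _
  have hBN : B ⊆ N := Finset.filter_subset _ _
  have hN1m := hN.mono hN1N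
  have hBm := hN.mono hBN
  have hN1X : ∀ y ∈ X, y ∉ cov N1 := by
    intro y hy hyc
    obtain ⟨e, he, hye⟩ := mem_cov.1 hyc
    exact (Finset.mem_filter.1 he).2 y hy hye
  have hN1Z : (N1 : Set (Sym2 V)) ⊆ Z := by
    intro e he
    have hX' := (Finset.mem_filter.1 he).2
    rcases hNZ (hN1N he) with hF | hE
    · refine Or.inl (Finset.mem_erase.2 ⟨?_, hF⟩)
      rintro rfl
      exact hX' u (by simp [hX]) (by simp)
    · refine Or.inr ?_
      simp only [Set.mem_iUnion] at hE ⊢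
      obtain ⟨c, hc, hE⟩ := hE
      refine ⟨c, hc, ?_⟩
      induction e using Sym2.ind with
      | _ p q =>
      have hp : p ∉ X := fun hp => hX' p hp (by simp)
      have hq : q ∉ X := fun hq => hX' q hq (by simp)
      exact mem_contr (hN.ne (hN1N he)) (hnX hp) (hnX hq).2 hE
  -- the vertices outside the triangle that `N` joins to it
  set O := cov B \ X with hO
  have hOz : ∀ a ∈ O, a ∉ cov N1 ∧ a ≠ x ∧ s(x, a) ∈ Z := by
    intro a ha
    obtain ⟨haB, haX⟩ := Finset.mem_sdiff.1 ha
    obtain ⟨b, hb⟩ := exists_mk_of_mem_cov haB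
    have hbX : b ∈ X := by
      by_contra hbX
      refine (Finset.mem_filter.1 hb).2 fun y hy hy' => ?_
      rcases Sym2.mem_iff.1 hy' with rfl | rfl <;> contradiction
    refine ⟨fun haN => ?_, (hnX haX).1, ?_⟩
    · obtain ⟨e, he, hae⟩ := mem_cov.1 haN
      have := hN.2 e (hN1N he) _ (hBN hb) a hae (by simp)
      subst this
      exact (Finset.mem_filter.1 he).2 b hbX (by simp)
    · refine T.mem_union_of_mem h (hmX.1 hbX) (hnX haX) ?_
      rw [Sym2.eq_swap]
      exact hNZ (hBN hb)
  have hOc : 2 * B.card ≤ O.card + 3 := by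
    rw [← hBm.card_cov]
    have : (cov B).card - X.card ≤ O.card := Finset.le_card_sdiff X (cov B)
    have : X.card ≤ 3 := Finset.card_le_three
    omega
  have hB3 : B.card ≤ 3 := by
    have hex : ∀ e ∈ B, ∃ y ∈ X, y ∈ e := by
      intro e he
      have := (Finset.mem_filter.1 he).2
      push Not at this
      exact this
    have : Nonempty V := ⟨x⟩
    choose! g hg1 hg2 using hex
    have hinj : Set.InjOn g (B : Set (Sym2 V)) := fun e he f hf hef =>
      hBm.2 e he f hf (g e) (hg2 e he) (hef ▸ hg2 f hf)
    calc B.card ≤ X.card := Finset.card_le_card_of_injOn g hg1 hinj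
      _ ≤ 3 := Finset.card_le_three
  have hxN1 : x ∉ cov N1 := hN1X x (by simp [hX])
  have add : ∀ {M : Finset (Sym2 V)} {a : V}, IsMat M → (M : Set (Sym2 V)) ⊆ Z → a ∈ O →
      x ∉ cov M → a ∉ cov M → HasMat Z (M.card + 1) := fun hM hMZ ha hx ha' =>
    HasMat.of_insert hM hMZ (hOz _ ha).2.1.symm hx ha' (hOz _ ha).2.2
  have hxF1 : x ∉ cov F1 := fun hx => T.hx (cov_mono (Finset.erase_subset _ _) hx)
  have hF1Z : (F1 : Set (Sym2 V)) ⊆ Z := Set.subset_union_left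
  rcases lt_or_ge B.card 2 with h2 | h2
  · exact HasMat.of_le hN1m hN1Z (by omega)
  obtain ⟨a, ha⟩ := Finset.card_pos.1 (show 0 < O.card by omega)
  by_cases hB2 : B.card = 2
  · have := add hN1m hN1Z ha hxN1 (hOz a ha).1
    rwa [show N1.card + 1 = F1.card + 1 by omega] at this
  -- Three edges of `N` become edges at `x`; an exchange with `F₁` makes room for one of them.
  by_cases haF : a ∈ cov F1
  · obtain ⟨z, M', N', hne, hM', hN', s1, s2, hcase⟩ :=
      exists_exchange_card hF1 hN1m haF (hOz a ha).1
    have hU : ((F1 ∪ N1 : Finset (Sym2 V)) : Set (Sym2 V)) ⊆ Z := by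
      rw [Finset.coe_union]; exact Set.union_subset hF1Z hN1Z
    rcases hcase with ⟨g1, g2, g3, g4, g5, g6⟩ | ⟨g1, g2, g3, g4, g5, g6⟩
    · have := add hM' ((Finset.coe_subset.2 s1).trans hU) ha
        (by
          rw [g3]
          simp only [Finset.mem_insert, Finset.mem_erase, not_or, not_and]
          exact ⟨by rintro rfl; exact hxN1 g1, fun _ => hxF1⟩)
        (by rw [g3]; simp [hne.symm])
      rwa [g5] at this
    · obtain ⟨o, ho⟩ := Finset.card_pos.1 (show 0 < ((O.erase a).erase z).card by
        have := Finset.pred_card_le_card_erase (s := O) (a := a)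
        have := Finset.pred_card_le_card_erase (s := O.erase a) (a := z)
        omega)
      simp only [Finset.mem_erase] at ho
      have := add hN' ((Finset.coe_subset.2 s2).trans hU) ho.2.2
        (by
          rw [g4]
          simp only [Finset.mem_insert, not_or]
          exact ⟨(hOz a ha).2.1.symm, by rintro rfl; exact hxF1 g1, hxN1⟩)
        (by rw [g4]; simp [ho.1, ho.2.1, (hOz o ho.2.2).1])
      rwa [show N'.card + 1 = F1.card + 1 by omega] at this
  · exact add hF1 hF1Z ha hxF1 haF

/-- Contracting a triangle removes one edge from `F` and uses two colours. -/
lemma contr_inst (T : Triangle F E S x u v i j) (h : Inst F E S t) :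
    Inst (F.erase s(u, v)) (contr x u v E) ((S.erase i).erase j) t where
  mat := h.mat.erase _
  nodiag := fun c e he => he.1
  disj := by
    intro c e he heF
    induction e using Sym2.ind with
    | _ a b =>
    obtain ⟨h1, h2, h3, h4, h5⟩ := T.of_mem_contr he
    have hF := Finset.mem_of_mem_erase heF
    refine h.disj c _ (h4 ?_ ?_) hF
    · rintro rfl; exact T.hx (mem_cov_left hF)
    · rintro rfl; exact T.hx (mem_cov_right hF)
  aug := fun I hI hIc => T.contr_aug h (h.aug I
    (hI.trans ((Finset.erase_subset _ _).trans (Finset.erase_subset _ _))) hIc)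
  norb := by
    intro N hN hNc hR
    have hcard := Finset.card_erase_add_one T.huv
    set F1 := F.erase s(u, v) with hF1
    have hxu := T.x_ne_u
    have hxv := T.x_ne_v
    have huv := T.u_ne_v h
    have hiS : i ∉ (S.erase i).erase j := by simp
    have hjS : j ∉ (S.erase i).erase j := by simp
    have hmem : ∀ e ∈ N, e ∉ F1 → ∃ c ∈ (S.erase i).erase j, e ∈ contr x u v E c := by
      obtain ⟨c, -, hc⟩ := hR
      exact fun e he heF => ⟨c e, hc e (Finset.mem_sdiff.2 ⟨he, heF⟩)⟩
    have hcovN : ∀ w ∈ cov N, w ≠ u ∧ w ≠ v := by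
      intro w hw
      obtain ⟨w', hw'⟩ := exists_mk_of_mem_cov hw
      by_cases hF : s(w, w') ∈ F1
      · exact ((T.erase_cov h).1 (mem_cov_left hF)).2
      · obtain ⟨c, -, hc⟩ := hmem _ hw' hF
        exact (T.of_mem_contr hc).2.1
    have huN : u ∉ cov N := fun h => (hcovN u h).1 rfl
    have hvN : v ∉ cov N := fun h => (hcovN v h).2 rfl
    -- colours of contracted edges away from `x` are colours of the edges themselves
    have lift : ∀ {S' : Finset ι} {M : Finset (Sym2 V)}, x ∉ cov M →
        Rainbow (contr x u v E) S' M → Rainbow E S' M := by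
      rintro S' M hxM ⟨c, hc1, hc2⟩
      refine ⟨c, hc1, fun e he => ⟨(hc2 e he).1, ?_⟩⟩
      have := (hc2 e he).2
      induction e using Sym2.ind with
      | _ a b =>
      refine (T.of_mem_contr this).2.2.2.1 ?_ ?_
      · rintro rfl; exact hxM (mem_cov_left he)
      · rintro rfl; exact hxM (mem_cov_right he)
    by_cases hxN : x ∈ cov N
    · obtain ⟨a, ha⟩ := exists_mk_of_mem_cov hxN
      have haN := mem_cov_right ha
      have haF : s(x, a) ∉ F1 := fun hh => T.hx (mem_cov_left (Finset.mem_of_mem_erase hh))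
      obtain ⟨d, hd, had, hR'⟩ := hR.erase (Finset.mem_sdiff.2 ⟨ha, haF⟩)
      have hce := hN.cov_erase ha
      have hcarde := Finset.card_erase_add_one ha
      have hNe := hN.erase s(x, a)
      set N0 := N.erase s(x, a) with hN0
      have hN0' : (N \ F1).erase s(x, a) = N0 \ F1 := by
        ext e; simp only [Finset.mem_erase, Finset.mem_sdiff, hN0]; tauto
      rw [hN0'] at hR'
      have hxN0 : x ∉ cov N0 := by rw [hce]; simp
      have haN0 : a ∉ cov N0 := by rw [hce]; simp
      have huN0 : u ∉ cov N0 := fun h => huN (cov_mono (Finset.erase_subset _ _) h)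
      have hvN0 : v ∉ cov N0 := fun h => hvN (cov_mono (Finset.erase_subset _ _) h)
      have hR0 : Rainbow E (((S.erase i).erase j).erase d) (N0 \ F1) :=
        lift (fun hh => hxN0 (cov_mono Finset.sdiff_subset hh)) hR'
      have hau := hcovN a haN
      have hxa := hN.ne ha
      have hdS := hd
      simp only [Finset.mem_erase] at hdS
      -- two disjoint edges that replace `xa`
      have fin : ∀ y p q : V, s(y, a) ∈ E d → s(p, q) ∈ F ∨ s(p, q) ∈ E i ∨ s(p, q) ∈ E j →
          y ≠ a → p ≠ q → y ∉ cov N0 → p ∉ cov N0 → q ∉ cov N0 → y ≠ p → y ≠ q → a ≠ p →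
          a ≠ q → False := by
        intro y p q hya hpq hya' hpq' hy hp hq h1 h2 h3 h4
        have hp' : p ∉ cov (insert s(y, a) N0) := by
          rw [cov_insert_mk]; simp [h1.symm, h3.symm, hp]
        have hq' : q ∉ cov (insert s(y, a) N0) := by
          rw [cov_insert_mk]; simp [h2.symm, h4.symm, hq]
        refine h.norb (insert s(p, q) (insert s(y, a) N0))
          ((hNe.insert_mk hya' hy haN0).insert_mk hpq' hp' hq') ?_ ?_
        · rw [IsMat.card_insert_mk hp', IsMat.card_insert_mk hy]; omega
        · have r1 := hR0.insert (Finset.notMem_erase _ _) hya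
          rw [Finset.insert_erase hd] at r1
          have hsd : N0 \ F ⊆ N0 \ F1 :=
            Finset.sdiff_subset_sdiff subset_rfl (Finset.erase_subset _ _)
          have hsub : ∀ e ∈ insert s(p, q) (insert s(y, a) N0) \ F, e = s(p, q) ∨
              e ∈ insert s(y, a) (N0 \ F1) := by
            intro e he
            obtain ⟨he1, he2⟩ := Finset.mem_sdiff.1 he
            rcases Finset.mem_insert.1 he1 with rfl | he1
            · exact Or.inl rfl
            rcases Finset.mem_insert.1 he1 with rfl | he1
            · exact Or.inr (Finset.mem_insert_self _ _)
            · exact Or.inr (Finset.mem_insert_of_mem (hsd (Finset.mem_sdiff.2 ⟨he1, he2⟩)))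
          have hSS : (S.erase i).erase j ⊆ S :=
            (Finset.erase_subset _ _).trans (Finset.erase_subset _ _)
          rcases hpq with hpq | hpq | hpq
          · refine r1.mono (fun e he => (hsub e he).resolve_left ?_) hSS
            rintro rfl
            exact (Finset.mem_sdiff.1 he).2 hpq
          · exact (r1.insert hiS hpq).mono (fun e he => Finset.mem_insert.2 (hsub e he))
              (Finset.insert_subset T.hi hSS)
          · exact (r1.insert hjS hpq).mono (fun e he => Finset.mem_insert.2 (hsub e he))
              (Finset.insert_subset T.hj hSS)
      rcases (T.of_mem_contr had).2.2.2.2 rfl with h1 | h1 | h1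
      · exact fin x u v h1 (Or.inl T.huv) hxa huv hxN0 huN0 hvN0 hxu hxv hau.1 hau.2
      · exact fin u x v h1 (Or.inr (Or.inr T.hxv)) hau.1.symm hxv huN0 hxN0 hvN0 hxu.symm huv
          hxa.symm hau.2
      · exact fin v x u h1 (Or.inr (Or.inl T.hxu)) hau.2.symm hxu hvN0 hxN0 huN0 hxv.symm huv.symm
          hxa.symm hau.1
    · refine h.norb (insert s(u, v) N) (hN.insert_mk huv huN hvN) ?_ ?_
      · rw [IsMat.card_insert_mk huN]; omega
      · refine (lift (fun hh => hxN (cov_mono Finset.sdiff_subset hh)) hR).mono ?_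
          ((Finset.erase_subset _ _).trans (Finset.erase_subset _ _))
        intro e he
        obtain ⟨he1, he2⟩ := Finset.mem_sdiff.1 he
        rcases Finset.mem_insert.1 he1 with rfl | he1
        · exact absurd T.huv he2
        · exact Finset.mem_sdiff.2 ⟨he1, fun h => he2 (Finset.mem_of_mem_erase h)⟩

lemma card_colours (T : Triangle F E S x u v i j) :
    ((S.erase i).erase j).card + 2 = S.card := by
  have h1 := Finset.card_erase_add_one T.hi
  have h2 := Finset.card_erase_add_one (Finset.mem_erase.2 ⟨T.hij.symm, T.hj⟩)
  omega

/-- A colour whose contracted set is empty has only edges of the triangle. -/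
lemma of_contr_eq_empty (T : Triangle F E S x u v i j) (h : Inst F E S t) {c : ι}
    (hc : contr x u v E c = ∅) {e : Sym2 V} (he : e ∈ E c) : e = s(x, u) ∨ e = s(x, v) := by
  induction e using Sym2.ind with
  | _ a b =>
  have hne : a ≠ b := by simpa using h.nodiag c _ he
  have hF := h.disj c _ he
  have hm : s(a, b) ∉ contr x u v E c := by rw [hc]; simp
  have hxu := T.x_ne_u
  have hxv := T.x_ne_v
  have h1 : ∀ p q, s(p, q) ∈ E c → p ≠ q → q = x ∨ q = u ∨ q = v := by
    intro p q hpq hne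
    by_contra hq
    push Not at hq
    by_cases hp : p = x ∨ p = u ∨ p = v
    · have := T.mem_contr_x hp hq hpq
      rw [hc] at this; exact this
    · push Not at hp
      have := mem_contr hne hp hq.2 hpq
      rw [hc] at this; exact this
  have huvF : s(u, v) ∉ E c := fun h' => h.disj c _ h' T.huv
  have hvuF : s(v, u) ∉ E c := fun h' => h.disj c _ h' T.symm.huv
  rcases h1 a b he hne with rfl | rfl | rfl <;>
    rcases h1 b a (Sym2.eq_swap ▸ he) hne.symm with rfl | rfl | rfl <;>
    first
      | exact absurd rfl hne
      | exact absurd he huvF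
      | exact absurd he hvuF
      | simp [Sym2.eq_swap]

end Triangle

/-- In the extremal case exactly `t` of the sets are empty. -/
theorem card_empty_eq (n : ℕ) : ∀ {F : Finset (Sym2 V)} {E : ι → Set (Sym2 V)} {S : Finset ι}
    {t : ℕ}, F.card = n → Inst F E S t → S.card = 2 * F.card + t →
    ∃ J ⊆ S, J.card = t ∧ ∀ c ∈ S, E c = ∅ ↔ c ∈ J := by
  induction n with
  | zero =>
    intro F E S t hn h hS
    refine ⟨S, subset_rfl, by omega, fun c hc => ⟨fun _ => hc, fun _ => ?_⟩⟩
    rw [Set.eq_empty_iff_forall_notMem]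
    intro e he
    have hF : F = ∅ := Finset.card_eq_zero.1 hn
    have : Nonempty ι := ⟨c⟩
    refine h.norb {e} ⟨by simpa using h.nodiag c e he, ?_⟩ (by simp [hn]) ?_
    · intro a ha b hb _ _ _
      rw [Finset.mem_singleton.1 ha, Finset.mem_singleton.1 hb]
    · rw [hF, Finset.sdiff_empty]
      refine Rainbow.of_card_le (S := {c}) (by simp) ?_ |>.mono subset_rfl (by simpa using hc)
      simpa using he
  | succ n ih =>
    intro F E S t hn h hS
    obtain ⟨x, u, v, i, j, h1, h2, h3, h4, h5, h6, h7⟩ := h.exists_triangle hS (by omega)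
    have T : Triangle F E S x u v i j := ⟨h1, h2, h3, h4, h5, h6, h7⟩
    have step : ∀ {i j : ι}, Triangle F E S x u v i j → ∃ J ⊆ (S.erase i).erase j, J.card = t ∧
        ∀ c ∈ (S.erase i).erase j, contr x u v E c = ∅ ↔ c ∈ J := by
      intro i j T
      have hc := Finset.card_erase_add_one T.huv
      have := T.card_colours
      exact ih (by omega) (T.contr_inst h) (by omega)
    obtain ⟨J, hJS, hJt, hJ⟩ := step T
    have hJS' : J ⊆ S := hJS.trans ((Finset.erase_subset _ _).trans (Finset.erase_subset _ _))
    have hiJ : i ∉ J := fun hi => by simpa using hJS hi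
    have hjJ : j ∉ J := fun hj => by simpa using hJS hj
    -- The triangle alone contains no matching larger than `F`, so a colour added to `J` has an
    -- edge outside it.
    have hout : ∀ d ∈ S, d ∉ J → contr x u v E d ≠ ∅ := by
      intro d hd hdJ hemp
      obtain ⟨N, hN, hNZ, hNc⟩ := h.aug (insert d J) (Finset.insert_subset hd hJS')
        (by rw [Finset.card_insert_of_notMem hdJ, hJt])
      have hcov : cov N ⊆ insert x (cov F) := by
        intro w hw
        obtain ⟨e, he, hwe⟩ := mem_cov.1 hw
        rcases hNZ he with hF | hE
        · exact Finset.mem_insert_of_mem (mem_cov.2 ⟨e, hF, hwe⟩)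
        · obtain ⟨c, hc, hE⟩ : ∃ c ∈ insert d J, e ∈ E c := by
            simpa only [Set.mem_iUnion, exists_prop] using hE
          have hce : contr x u v E c = ∅ := by
            rcases Finset.mem_insert.1 hc with rfl | hc
            · exact hemp
            · exact (hJ c (hJS hc)).2 hc
          rw [Finset.mem_insert]
          rcases T.of_contr_eq_empty h hce hE with rfl | rfl <;>
            rcases Sym2.mem_iff.1 hwe with rfl | rfl
          · exact Or.inl rfl
          · exact Or.inr (mem_cov_left T.huv)
          · exact Or.inl rfl
          · exact Or.inr (mem_cov_right T.huv)
      have h1 := Finset.card_le_card hcov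
      have h2 := Finset.card_insert_le x (cov F)
      rw [hN.card_cov] at h1
      rw [h.mat.card_cov] at h2
      omega
    have hdc : ∀ c ∈ S, c ∉ J → E c ≠ ∅ := by
      intro c hc hcJ hE
      refine hout c hc hcJ ?_
      rw [Set.eq_empty_iff_forall_notMem]
      rintro e ⟨-, f, hf, -⟩
      rw [hE] at hf; exact hf
    -- If `c ∈ J` had an edge of the triangle, it could replace `i` or `j` there.
    have hswap : ∀ {i' j' : ι} {c : ι}, Triangle F E S x u v i' j' → c ∈ J →
        (∃ d ∈ S, d ∉ J ∧ (∀ d' ∈ J, d' ≠ c → d' ≠ i' ∧ d' ≠ j') ∧ (d ≠ i' ∧ d ≠ j')) →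
        (c = i' ∨ c = j') → False := by
      rintro i' j' c T' hcJ ⟨d, hdS, hdJ, hother, hd⟩ hc
      obtain ⟨J', hJ'S, hJ't, hJ'⟩ := step T'
      have hsub : J' ⊆ J.erase c := by
        intro e he
        have heS := hJ'S he
        have heS' := heS
        simp only [Finset.mem_erase] at heS'
        refine Finset.mem_erase.2 ⟨?_, ?_⟩
        · rintro rfl
          rcases hc with rfl | rfl
          · exact heS'.2.1 rfl
          · exact heS'.1 rfl
        · by_contra heJ
          exact hout e heS'.2.2 heJ ((hJ' e heS).2 he)
      have h1 := Finset.card_le_card hsub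
      have h2 := Finset.card_erase_add_one hcJ
      omega
    refine ⟨J, hJS', hJt, fun c hc => ⟨fun hE => ?_, fun hcJ => ?_⟩⟩
    · by_contra hcJ
      exact hdc c hc hcJ hE
    · have hci : c ≠ i := fun h => hiJ (h ▸ hcJ)
      have hcj : c ≠ j := fun h => hjJ (h ▸ hcJ)
      rw [Set.eq_empty_iff_forall_notMem]
      intro e he
      rcases T.of_contr_eq_empty h ((hJ c (hJS hcJ)).2 hcJ) he with rfl | rfl
      · refine hswap ⟨T.hx, T.huv, hc, T.hj, hcj, he, T.hxv⟩ hcJ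
          ⟨i, T.hi, hiJ, fun d' hd' hne => ⟨hne, fun h => hjJ (h ▸ hd')⟩, hci.symm, T.hij⟩
          (Or.inl rfl)
      · refine hswap ⟨T.hx, T.huv, T.hi, hc, hci.symm, T.hxu, he⟩ hcJ
          ⟨j, T.hj, hjJ, fun d' hd' hne => ⟨fun h => hiJ (h ▸ hd'), hne⟩, T.hij.symm, hcj.symm⟩
          (Or.inr rfl)

end Contraction
end RainbowAAP

namespace RainbowAAP

/-! ### Origamistrips and families of matchings that form a badge -/

namespace Origamistrip

variable {V : Type*}

/-- The vertex `u i` or `v i`, according to the Boolean. -/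
def side (O : Origamistrip V) (b : Bool) (i : ℕ) : V := if b then O.u i else O.v i

/-- The matching of the strip that starts with the edge from `x` to `O.side b 1`. -/
def mt (O : Origamistrip V) (b : Bool) : Set (Sym2 V) := if b then O.matchingA else O.matchingB

variable (O : Origamistrip V)

lemma mem_mt {b : Bool} {e : Sym2 V} : e ∈ O.mt b ↔ e = s(O.x, O.side b 1) ∨
    e = s(O.side (!b) O.m, O.y) ∨
    ∃ i, 1 ≤ i ∧ i < O.m ∧ e = s(O.side (!b) i, O.side b (i + 1)) := by
  cases b <;> simp [mt, side, matchingA, matchingB, or_assoc]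

lemma mem_interior {w : V} :
    w ∈ O.interior ↔ ∃ b i, 1 ≤ i ∧ i ≤ O.m ∧ O.side b i = w := by
  constructor
  · rintro (⟨i, hi, rfl⟩ | ⟨i, hi, rfl⟩)
    · exact ⟨true, i, hi.1, hi.2, rfl⟩
    · exact ⟨false, i, hi.1, hi.2, rfl⟩
  · rintro ⟨b, i, h1, h2, rfl⟩
    cases b
    · exact Or.inr ⟨i, ⟨h1, h2⟩, rfl⟩
    · exact Or.inl ⟨i, ⟨h1, h2⟩, rfl⟩

lemma side_mem_interior (b : Bool) {i : ℕ} (h1 : 1 ≤ i) (h2 : i ≤ O.m) :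
    O.side b i ∈ O.interior := O.mem_interior.2 ⟨b, i, h1, h2, rfl⟩

lemma side_mem_skeleton (b : Bool) {i : ℕ} (h1 : 1 ≤ i) (h2 : i ≤ O.m) :
    s(O.side b i, O.side (!b) i) ∈ O.skeleton := by
  refine ⟨i, ⟨h1, h2⟩, ?_⟩
  cases b
  · exact Sym2.eq_swap
  · rfl

lemma side_ne_not (b : Bool) {i j : ℕ} (h1 : 1 ≤ i) (h2 : i ≤ O.m) (h3 : 1 ≤ j) (h4 : j ≤ O.m) :
    O.side b i ≠ O.side (!b) j := by
  cases b
  · exact (O.u_ne_v j ⟨h3, h4⟩ i ⟨h1, h2⟩).symm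
  · exact O.u_ne_v i ⟨h1, h2⟩ j ⟨h3, h4⟩

lemma x_notMem_interior : O.x ∉ O.interior := by
  rintro (⟨i, hi, h⟩ | ⟨i, hi, h⟩)
  · exact O.x_ne_u i hi h.symm
  · exact O.x_ne_v i hi h.symm

lemma x_ne_side (b : Bool) {i : ℕ} (h1 : 1 ≤ i) (h2 : i ≤ O.m) : O.x ≠ O.side b i :=
  fun h => O.x_notMem_interior (h ▸ O.side_mem_interior b h1 h2)

lemma first_mem_mt (b : Bool) : s(O.x, O.side b 1) ∈ O.mt b := O.mem_mt.2 (Or.inl rfl)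

lemma last_mem_mt (b : Bool) : s(O.side (!b) O.m, O.y) ∈ O.mt b := O.mem_mt.2 (Or.inr (Or.inl rfl))

/-- The only edge of `O.mt b` at `O.x` is the first one. -/
lemma eq_of_x_mem_mt {b : Bool} {w : V} (h : s(O.x, w) ∈ O.mt b) : w = O.side b 1 := by
  have hm := O.one_le_m
  rcases O.mem_mt.1 h with h | h | ⟨i, h1, h2, h⟩
  · exact Sym2.congr_right.1 h
  · exfalso
    have : O.x ∈ s(O.side (!b) O.m, O.y) := h ▸ Sym2.mem_mk_left _ _
    rcases Sym2.mem_iff.1 this with h | h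
    · exact O.x_ne_side _ hm le_rfl h
    · exact O.x_ne_y h
  · exfalso
    have : O.x ∈ s(O.side (!b) i, O.side b (i + 1)) := h ▸ Sym2.mem_mk_left _ _
    rcases Sym2.mem_iff.1 this with h | h
    · exact O.x_ne_side _ h1 h2.le h
    · exact O.x_ne_side _ (by omega) (by omega) h

lemma mem_of_mem_mt {b : Bool} {e : Sym2 V} (h : e ∈ O.mt b) {w : V} (hw : w ∈ e) :
    w ∈ O.interior ∨ w = O.x ∨ w = O.y := by
  have hm := O.one_le_m
  rcases O.mem_mt.1 h with rfl | rfl | ⟨i, h1, h2, rfl⟩ <;> rcases Sym2.mem_iff.1 hw with rfl | rfl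
  · simp
  · exact Or.inl (O.side_mem_interior _ le_rfl hm)
  · exact Or.inl (O.side_mem_interior _ hm le_rfl)
  · simp
  · exact Or.inl (O.side_mem_interior _ h1 h2.le)
  · exact Or.inl (O.side_mem_interior _ (by omega) (by omega))

lemma mt_ne (b : Bool) : O.mt b ≠ O.mt (!b) := by
  intro h
  have := O.eq_of_x_mem_mt (h ▸ O.first_mem_mt b)
  exact O.side_ne_not b le_rfl O.one_le_m le_rfl O.one_le_m this

lemma exists_finset_mt [DecidableEq V] (b : Bool) :
    ∃ T : Finset (Sym2 V), (∀ e, e ∈ T ↔ e ∈ O.mt b) ∧ T.card ≤ O.m + 1 := by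
  have hm := O.one_le_m
  refine ⟨insert s(O.x, O.side b 1) (insert s(O.side (!b) O.m, O.y)
    ((Finset.Ico 1 O.m).image fun i => s(O.side (!b) i, O.side b (i + 1)))), ?_, ?_⟩
  · intro e
    rw [mem_mt]
    simp only [Finset.mem_insert, Finset.mem_image, Finset.mem_Ico, and_assoc, eq_comm]
  · have h1 := Finset.card_image_le (s := Finset.Ico 1 O.m)
      (f := fun i => s(O.side (!b) i, O.side b (i + 1)))
    rw [Nat.card_Ico] at h1
    refine (Finset.card_insert_le _ _).trans ?_
    have := Finset.card_insert_le s(O.side (!b) O.m, O.y)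
      ((Finset.Ico 1 O.m).image fun i => s(O.side (!b) i, O.side b (i + 1)))
    omega

/-- Exchanging the vertices of each edge of the skeleton exchanges the two matchings. -/
lemma mt_not_eq_image (b : Bool) {μ : V → V} (hx : μ O.x = O.x) (hy : μ O.y = O.y)
    (hμ : ∀ b i, 1 ≤ i → i ≤ O.m → μ (O.side b i) = O.side (!b) i) :
    O.mt (!b) = Sym2.map μ '' O.mt b := by
  have hm := O.one_le_m
  ext e
  simp only [Set.mem_image, mem_mt, Bool.not_not]
  constructor
  · rintro (rfl | rfl | ⟨i, h1, h2, rfl⟩)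
    · exact ⟨_, Or.inl rfl, by rw [Sym2.map_mk, hx, hμ _ _ le_rfl hm]⟩
    · exact ⟨_, Or.inr (Or.inl rfl), by rw [Sym2.map_mk, hy, hμ _ _ hm le_rfl, Bool.not_not]⟩
    · exact ⟨_, Or.inr (Or.inr ⟨i, h1, h2, rfl⟩), by
        rw [Sym2.map_mk, hμ _ _ h1 h2.le, hμ _ _ (by omega) (by omega), Bool.not_not]⟩
  · rintro ⟨f, rfl | rfl | ⟨i, h1, h2, rfl⟩, rfl⟩
    · exact Or.inl (by rw [Sym2.map_mk, hx, hμ _ _ le_rfl hm])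
    · exact Or.inr (Or.inl (by rw [Sym2.map_mk, hy, hμ _ _ hm le_rfl, Bool.not_not]))
    · exact Or.inr (Or.inr ⟨i, h1, h2, by
        rw [Sym2.map_mk, hμ _ _ h1 h2.le, hμ _ _ (by omega) (by omega), Bool.not_not]⟩)

/-- The same strip, traversed from `y` to `x`. -/
def flip : Origamistrip V where
  m := O.m
  one_le_m := O.one_le_m
  u i := O.v (O.m + 1 - i)
  v i := O.u (O.m + 1 - i)
  x := O.y
  y := O.x
  u_injOn := by
    intro i hi j hj h
    simp only [Set.mem_Icc] at hi hj
    have := O.v_injOn (show O.m + 1 - i ∈ Set.Icc 1 O.m from ⟨by omega, by omega⟩)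
      (show O.m + 1 - j ∈ Set.Icc 1 O.m from ⟨by omega, by omega⟩) h
    omega
  v_injOn := by
    intro i hi j hj h
    simp only [Set.mem_Icc] at hi hj
    have := O.u_injOn (show O.m + 1 - i ∈ Set.Icc 1 O.m from ⟨by omega, by omega⟩)
      (show O.m + 1 - j ∈ Set.Icc 1 O.m from ⟨by omega, by omega⟩) h
    omega
  u_ne_v := by
    intro i hi j hj
    simp only [Set.mem_Icc] at hi hj
    exact (O.u_ne_v _ ⟨by omega, by omega⟩ _ ⟨by omega, by omega⟩).symm
  x_ne_y := O.x_ne_y.symm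
  x_ne_u := by
    intro i hi
    simp only [Set.mem_Icc] at hi
    exact O.y_ne_v _ ⟨by omega, by omega⟩
  x_ne_v := by
    intro i hi
    simp only [Set.mem_Icc] at hi
    exact O.y_ne_u _ ⟨by omega, by omega⟩
  y_ne_u := by
    intro i hi
    simp only [Set.mem_Icc] at hi
    exact O.x_ne_v _ ⟨by omega, by omega⟩
  y_ne_v := by
    intro i hi
    simp only [Set.mem_Icc] at hi
    exact O.x_ne_u _ ⟨by omega, by omega⟩

lemma flip_side (b : Bool) (i : ℕ) : O.flip.side b i = O.side (!b) (O.m + 1 - i) := by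
  cases b <;> rfl

lemma flip_interior : O.flip.interior = O.interior := by
  ext w
  simp only [mem_interior, flip_side]
  constructor
  · rintro ⟨b, i, h1, h2, rfl⟩
    have h2 : i ≤ O.m := h2
    exact ⟨!b, O.m + 1 - i, by omega, by omega, rfl⟩
  · rintro ⟨b, i, h1, h2, rfl⟩
    refine ⟨!b, O.m + 1 - i, by omega, show _ ≤ O.m by omega, ?_⟩
    rw [Bool.not_not, show O.m + 1 - (O.m + 1 - i) = i by omega]

lemma flip_skeleton : O.flip.skeleton = O.skeleton := by
  ext e
  simp only [skeleton, Set.mem_ofPred_eq, Set.mem_Icc]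
  constructor
  · rintro ⟨i, ⟨h1, h2⟩, rfl⟩
    have h2 : i ≤ O.m := h2
    exact ⟨O.m + 1 - i, ⟨by omega, by omega⟩, Sym2.eq_swap⟩
  · rintro ⟨i, ⟨h1, h2⟩, rfl⟩
    refine ⟨O.m + 1 - i, ⟨by omega, show _ ≤ O.m by omega⟩, ?_⟩
    simp only [flip, show O.m + 1 - (O.m + 1 - i) = i by omega]
    exact Sym2.eq_swap

lemma flip_mt (b : Bool) : O.flip.mt b = O.mt b := by
  have hm := O.one_le_m
  ext e
  simp only [mem_mt, flip_side, Bool.not_not]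
  have e1 : O.flip.m = O.m := rfl
  have e2 : O.flip.x = O.y := rfl
  have e3 : O.flip.y = O.x := rfl
  rw [e1, e2, e3, show O.m + 1 - 1 = O.m by omega, show O.m + 1 - O.m = 1 by omega]
  have key : (∃ i, 1 ≤ i ∧ i < O.m ∧ e = s(O.side b (O.m + 1 - i),
      O.side (!b) (O.m + 1 - (i + 1)))) ↔
      ∃ i, 1 ≤ i ∧ i < O.m ∧ e = s(O.side (!b) i, O.side b (i + 1)) := by
    constructor
    · rintro ⟨i, h1, h2, rfl⟩
      refine ⟨O.m - i, by omega, by omega, ?_⟩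
      rw [show O.m - i + 1 = O.m + 1 - i by omega, show O.m + 1 - (i + 1) = O.m - i by omega]
      exact Sym2.eq_swap
    · rintro ⟨i, h1, h2, rfl⟩
      refine ⟨O.m - i, by omega, by omega, ?_⟩
      rw [show O.m + 1 - (O.m - i) = i + 1 by omega, show O.m + 1 - (O.m - i + 1) = i by omega]
      exact Sym2.eq_swap
  rw [key, Sym2.eq_swap (a := O.y), Sym2.eq_swap (a := O.side b 1)]
  tauto

/-- The same strip with the names `u` and `v` exchanged. -/
def swap : Origamistrip V where
  m := O.m
  one_le_m := O.one_le_m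
  u := O.v
  v := O.u
  x := O.x
  y := O.y
  u_injOn := O.v_injOn
  v_injOn := O.u_injOn
  u_ne_v := fun i hi j hj => (O.u_ne_v j hj i hi).symm
  x_ne_y := O.x_ne_y
  x_ne_u := O.x_ne_v
  x_ne_v := O.x_ne_u
  y_ne_u := O.y_ne_v
  y_ne_v := O.y_ne_u

lemma swap_side (b : Bool) (i : ℕ) : O.swap.side b i = O.side (!b) i := by cases b <;> rfl

lemma swap_interior : O.swap.interior = O.interior := Set.union_comm _ _

lemma swap_skeleton : O.swap.skeleton = O.skeleton := by
  ext e
  simp only [skeleton, Set.mem_ofPred_eq]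
  exact exists_congr fun i => and_congr_right fun _ => by
    rw [show O.swap.u i = O.v i from rfl, show O.swap.v i = O.u i from rfl, Sym2.eq_swap]

lemma swap_mt (b : Bool) : O.swap.mt b = O.mt (!b) := by cases b <;> rfl

/-- Any strip can be presented so that it starts at a given endpoint, with a given matching as
`mt true`. -/
lemma exists_oriented (b : Bool) {x : V} (hx : x = O.x ∨ x = O.y) :
    ∃ O' : Origamistrip V, O'.x = x ∧ O'.m = O.m ∧ O'.interior = O.interior ∧
      O'.skeleton = O.skeleton ∧ (O'.y = O.x ∨ O'.y = O.y) ∧ O'.mt true = O.mt b ∧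
      O'.mt false = O.mt (!b) := by
  have h1 : ∃ O' : Origamistrip V, O'.x = x ∧ O'.m = O.m ∧ O'.interior = O.interior ∧
      O'.skeleton = O.skeleton ∧ (O'.y = O.x ∨ O'.y = O.y) ∧ ∀ b, O'.mt b = O.mt b := by
    rcases hx with rfl | rfl
    · exact ⟨O, rfl, rfl, rfl, rfl, Or.inr rfl, fun _ => rfl⟩
    · exact ⟨O.flip, rfl, rfl, O.flip_interior, O.flip_skeleton, Or.inl rfl, O.flip_mt⟩
  obtain ⟨O', h1, h2, h3, h4, h5, h6⟩ := h1
  cases b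
  · exact ⟨O'.swap, h1, h2, O'.swap_interior.trans h3, O'.swap_skeleton.trans h4, h5,
      (O'.swap_mt _).trans (h6 _), (O'.swap_mt _).trans (h6 _)⟩
  · exact ⟨O', h1, h2, h3, h4, h5, h6 _, h6 _⟩

/-- The strip of weight one with interior vertices `u` and `v`. -/
def single (x y u v : V) (hxy : x ≠ y) (huv : u ≠ v) (hxu : x ≠ u) (hxv : x ≠ v) (hyu : y ≠ u)
    (hyv : y ≠ v) : Origamistrip V where
  m := 1
  one_le_m := le_rfl
  u _ := u
  v _ := v
  x := x
  y := y
  u_injOn := by intro i hi j hj _; simp only [Set.mem_Icc] at hi hj; omega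
  v_injOn := by intro i hi j hj _; simp only [Set.mem_Icc] at hi hj; omega
  u_ne_v := fun _ _ _ _ => huv
  x_ne_y := hxy
  x_ne_u := fun _ _ => hxu
  x_ne_v := fun _ _ => hxv
  y_ne_u := fun _ _ => hyu
  y_ne_v := fun _ _ => hyv

lemma mt_of_m_eq_one (h : O.m = 1) (b : Bool) :
    O.mt b = {s(O.x, O.side b 1), s(O.side (!b) 1, O.y)} := by
  ext e
  rw [mem_mt, h]
  simp only [Set.mem_insert_iff, Set.mem_singleton_iff]
  refine or_congr_right (or_iff_left ?_)
  rintro ⟨i, h1, h2, -⟩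
  omega

/-- The strip obtained by inserting a new pair `u`, `v` between `x` and the first pair. -/
def extend (u v : V) (hu : u ∉ O.interior) (hv : v ∉ O.interior) (huv : u ≠ v) (hxu : O.x ≠ u)
    (hxv : O.x ≠ v) (hyu : O.y ≠ u) (hyv : O.y ≠ v) : Origamistrip V where
  m := O.m + 1
  one_le_m := by omega
  u i := if i = 1 then u else O.u (i - 1)
  v i := if i = 1 then v else O.v (i - 1)
  x := O.x
  y := O.y
  u_injOn := by
    intro i hi j hj h
    simp only [Set.mem_Icc] at hi hj
    have hI : ∀ i, 1 ≤ i → i ≤ O.m + 1 → i ≠ 1 → O.u (i - 1) ∈ O.interior := fun i h1 h2 h3 =>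
      O.side_mem_interior true (by omega) (by omega)
    by_cases hi1 : i = 1 <;> by_cases hj1 : j = 1 <;> simp only [hi1, hj1, if_true, if_false] at h
    · omega
    · exact absurd (h ▸ hI j hj.1 hj.2 hj1) hu
    · exact absurd (h ▸ hI i hi.1 hi.2 hi1) hu
    · have := O.u_injOn ⟨by omega, by omega⟩ ⟨by omega, by omega⟩ h
      omega
  v_injOn := by
    intro i hi j hj h
    simp only [Set.mem_Icc] at hi hj
    have hI : ∀ i, 1 ≤ i → i ≤ O.m + 1 → i ≠ 1 → O.v (i - 1) ∈ O.interior := fun i h1 h2 h3 =>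
      O.side_mem_interior false (by omega) (by omega)
    by_cases hi1 : i = 1 <;> by_cases hj1 : j = 1 <;> simp only [hi1, hj1, if_true, if_false] at h
    · omega
    · exact absurd (h ▸ hI j hj.1 hj.2 hj1) hv
    · exact absurd (h ▸ hI i hi.1 hi.2 hi1) hv
    · have := O.v_injOn ⟨by omega, by omega⟩ ⟨by omega, by omega⟩ h
      omega
  u_ne_v := by
    intro i hi j hj
    simp only [Set.mem_Icc] at hi hj
    by_cases hi1 : i = 1 <;> by_cases hj1 : j = 1 <;> simp only [hi1, hj1, if_true, if_false]
    · exact huv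
    · exact fun h => hu (h ▸ O.side_mem_interior false (by omega) (by omega))
    · exact fun h => hv (h ▸ O.side_mem_interior true (by omega) (by omega))
    · exact O.u_ne_v _ ⟨by omega, by omega⟩ _ ⟨by omega, by omega⟩
  x_ne_y := O.x_ne_y
  x_ne_u := by
    intro i hi
    simp only [Set.mem_Icc] at hi
    by_cases hi1 : i = 1 <;> simp only [hi1, if_true, if_false]
    · exact hxu
    · exact O.x_ne_u _ ⟨by omega, by omega⟩
  x_ne_v := by
    intro i hi
    simp only [Set.mem_Icc] at hi
    by_cases hi1 : i = 1 <;> simp only [hi1, if_true, if_false]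
    · exact hxv
    · exact O.x_ne_v _ ⟨by omega, by omega⟩
  y_ne_u := by
    intro i hi
    simp only [Set.mem_Icc] at hi
    by_cases hi1 : i = 1 <;> simp only [hi1, if_true, if_false]
    · exact hyu
    · exact O.y_ne_u _ ⟨by omega, by omega⟩
  y_ne_v := by
    intro i hi
    simp only [Set.mem_Icc] at hi
    by_cases hi1 : i = 1 <;> simp only [hi1, if_true, if_false]
    · exact hyv
    · exact O.y_ne_v _ ⟨by omega, by omega⟩

section extend

variable {O} {u v : V} {hu : u ∉ O.interior} {hv : v ∉ O.interior} {huv : u ≠ v} {hxu : O.x ≠ u}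
  {hxv : O.x ≠ v} {hyu : O.y ≠ u} {hyv : O.y ≠ v}

lemma extend_side_one (b : Bool) :
    (O.extend u v hu hv huv hxu hxv hyu hyv).side b 1 = if b then u else v := by
  cases b <;> rfl

lemma extend_side_succ (b : Bool) {i : ℕ} (hi : 1 ≤ i) :
    (O.extend u v hu hv huv hxu hxv hyu hyv).side b (i + 1) = O.side b i := by
  have : i ≠ 0 := by omega
  cases b <;> simp [side, extend, this]

lemma extend_interior :
    (O.extend u v hu hv huv hxu hxv hyu hyv).interior = insert u (insert v O.interior) := by
  ext w
  rw [mem_interior]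
  simp only [Set.mem_insert_iff, mem_interior]
  constructor
  · rintro ⟨b, i, h1, h2, rfl⟩
    obtain ⟨i, rfl⟩ : ∃ i', i = i' + 1 := ⟨i - 1, by omega⟩
    have h2 : i + 1 ≤ O.m + 1 := h2
    rcases Nat.eq_zero_or_pos i with rfl | hi
    · rw [extend_side_one]
      cases b <;> simp
    · rw [extend_side_succ _ hi]
      exact Or.inr (Or.inr ⟨b, i, hi, by omega, rfl⟩)
  · rintro (rfl | rfl | ⟨b, i, h1, h2, rfl⟩)
    · exact ⟨true, 1, le_rfl, show 1 ≤ O.m + 1 by omega, rfl⟩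
    · exact ⟨false, 1, le_rfl, show 1 ≤ O.m + 1 by omega, rfl⟩
    · exact ⟨b, i + 1, by omega, show i + 1 ≤ O.m + 1 by omega, extend_side_succ b h1⟩

lemma extend_skeleton :
    (O.extend u v hu hv huv hxu hxv hyu hyv).skeleton = insert s(u, v) O.skeleton := by
  ext e
  simp only [skeleton, Set.mem_ofPred_eq, Set.mem_Icc, Set.mem_insert_iff]
  constructor
  · rintro ⟨i, ⟨h1, h2⟩, rfl⟩
    obtain ⟨i, rfl⟩ : ∃ i', i = i' + 1 := ⟨i - 1, by omega⟩
    have h2 : i + 1 ≤ O.m + 1 := h2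
    rcases Nat.eq_zero_or_pos i with rfl | hi
    · exact Or.inl rfl
    · refine Or.inr ⟨i, ⟨hi, by omega⟩, ?_⟩
      have e1 := extend_side_succ (hu := hu) (hv := hv) (huv := huv) (hxu := hxu) (hxv := hxv)
        (hyu := hyu) (hyv := hyv) true hi
      have e2 := extend_side_succ (hu := hu) (hv := hv) (huv := huv) (hxu := hxu) (hxv := hxv)
        (hyu := hyu) (hyv := hyv) false hi
      exact congrArg₂ (fun a b => s(a, b)) e1 e2
  · rintro (rfl | ⟨i, ⟨h1, h2⟩, rfl⟩)
    · exact ⟨1, ⟨le_rfl, show 1 ≤ O.m + 1 by omega⟩, rfl⟩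
    · refine ⟨i + 1, ⟨by omega, show i + 1 ≤ O.m + 1 by omega⟩, ?_⟩
      have e1 := extend_side_succ (hu := hu) (hv := hv) (huv := huv) (hxu := hxu) (hxv := hxv)
        (hyu := hyu) (hyv := hyv) true h1
      have e2 := extend_side_succ (hu := hu) (hv := hv) (huv := huv) (hxu := hxu) (hxv := hxv)
        (hyu := hyu) (hyv := hyv) false h1
      exact (congrArg₂ (fun a b => s(a, b)) e1 e2).symm

lemma mem_extend_mt (b : Bool) {e : Sym2 V} :
    e ∈ (O.extend u v hu hv huv hxu hxv hyu hyv).mt b ↔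
      e = s(O.x, if b then u else v) ∨ e = s(if b then v else u, O.side b 1) ∨
      (e ∈ O.mt b ∧ O.x ∉ e) := by
  have hm := O.one_le_m
  have hx : (O.extend u v hu hv huv hxu hxv hyu hyv).x = O.x := rfl
  have hy : (O.extend u v hu hv huv hxu hxv hyu hyv).y = O.y := rfl
  have hm' : (O.extend u v hu hv huv hxu hxv hyu hyv).m = O.m + 1 := rfl
  have hlast : O.x ∉ s(O.side (!b) O.m, O.y) := by
    rw [Sym2.mem_iff, not_or]
    exact ⟨O.x_ne_side _ hm le_rfl, O.x_ne_y⟩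
  have hmid : ∀ i, 1 ≤ i → i < O.m → O.x ∉ s(O.side (!b) i, O.side b (i + 1)) := by
    intro i h1 h2
    rw [Sym2.mem_iff, not_or]
    exact ⟨O.x_ne_side _ h1 h2.le, O.x_ne_side _ (by omega) (by omega)⟩
  rw [mem_mt, hx, hy, hm', extend_side_one, extend_side_succ _ hm]
  refine or_congr_right ?_
  constructor
  · rintro (rfl | ⟨i, h1, h2, rfl⟩)
    · exact Or.inr ⟨O.last_mem_mt b, hlast⟩
    · rw [extend_side_succ _ h1]
      rcases Nat.lt_or_ge 1 i with hi | hi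
      · obtain ⟨i, rfl⟩ : ∃ i', i = i' + 1 := ⟨i - 1, by omega⟩
        rw [extend_side_succ _ (by omega)]
        exact Or.inr ⟨O.mem_mt.2 (Or.inr (Or.inr ⟨i, by omega, by omega, rfl⟩)),
          hmid i (by omega) (by omega)⟩
      · obtain rfl : i = 1 := by omega
        rw [extend_side_one]
        left
        cases b <;> rfl
  · rintro (rfl | ⟨he, hxe⟩)
    · refine Or.inr ⟨1, le_rfl, by omega, ?_⟩
      rw [extend_side_one, extend_side_succ _ le_rfl]
      cases b <;> rfl
    · rcases O.mem_mt.1 he with rfl | rfl | ⟨i, h1, h2, rfl⟩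
      · simp at hxe
      · exact Or.inl rfl
      · refine Or.inr ⟨i + 1, by omega, by omega, ?_⟩
        rw [extend_side_succ _ h1, extend_side_succ _ (by omega)]

end extend

end Origamistrip

section BadgeFamilies

variable {V ι : Type*} [DecidableEq V] [DecidableEq ι]

set_option linter.unusedSectionVars false

/-- The colours `c ∈ S` with `E c = M`. -/
noncomputable def colourClass (E : ι → Set (Sym2 V)) (S : Finset ι) (M : Set (Sym2 V)) :
    Finset ι :=
  @Finset.filter ι (fun c => E c = M) (Classical.decPred _) S

lemma mem_colourClass {E : ι → Set (Sym2 V)} {S : Finset ι} {M : Set (Sym2 V)} {c : ι} :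
    c ∈ colourClass E S M ↔ c ∈ S ∧ E c = M := by
  simp [colourClass]

/-- The strips `st s` form a badge with skeleton `F`, and the sets `E c`, `c ∈ S`, are the matchings
`mt b` of the strips, each taken as often as the weight of the strip. -/
structure BadgeFamily {σ : Type} (st : σ → Origamistrip V) (F : Finset (Sym2 V))
    (E : ι → Set (Sym2 V)) (S : Finset ι) : Prop where
  disj : ∀ s s', s ≠ s' → Disjoint (st s).interior (st s').interior
  x_not : ∀ s, (st s).x ∉ cov F
  y_not : ∀ s, (st s).y ∉ cov F
  skel : ∀ e, e ∈ F ↔ ∃ s, e ∈ (st s).skeleton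
  cover : ∀ c ∈ S, ∃ s b, E c = (st s).mt b
  card : ∀ s b, (colourClass E S ((st s).mt b)).card = (st s).m

/-- The sets `E c`, `c ∈ S`, are the matchings of a badge with skeleton `F`. -/
def IsBadgeFamily (F : Finset (Sym2 V)) (E : ι → Set (Sym2 V)) (S : Finset ι) : Prop :=
  ∃ (σ : Type) (_ : Fintype σ) (st : σ → Origamistrip V), BadgeFamily st F E S

namespace BadgeFamily

variable {σ : Type} {st : σ → Origamistrip V} {F : Finset (Sym2 V)} {E : ι → Set (Sym2 V)}
  {S : Finset ι}

lemma interior_subset (B : BadgeFamily st F E S) {s : σ} {w : V} (hw : w ∈ (st s).interior) :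
    w ∈ cov F := by
  obtain ⟨b, i, h1, h2, rfl⟩ := (st s).mem_interior.1 hw
  exact mem_cov_left ((B.skel _).2 ⟨s, (st s).side_mem_skeleton b h1 h2⟩)

lemma mt_inj (B : BadgeFamily st F E S) {s s' : σ} {b b' : Bool}
    (h : (st s).mt b = (st s').mt b') : s = s' ∧ b = b' := by
  have hs : s = s' := by
    by_contra hne
    have hin := (st s).side_mem_interior b le_rfl (st s).one_le_m
    have hm := (st s).first_mem_mt b
    rw [h] at hm
    rcases (st s').mem_of_mem_mt hm (Sym2.mem_mk_right _ _) with h1 | h1 | h1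
    · exact Set.disjoint_left.1 (B.disj s s' hne) hin h1
    · exact B.x_not s' (h1 ▸ B.interior_subset hin)
    · exact B.y_not s' (h1 ▸ B.interior_subset hin)
  subst hs
  refine ⟨rfl, ?_⟩
  by_contra hb
  have : b' = !b := by cases b <;> cases b' <;> simp_all
  exact (st s).mt_ne b (this ▸ h)

lemma exists_colour (B : BadgeFamily st F E S) (s : σ) (b : Bool) :
    ∃ c ∈ S, E c = (st s).mt b := by
  have h1 := B.card s b
  have h2 := (st s).one_le_m
  obtain ⟨c, hc⟩ := Finset.card_pos.1 (show 0 < (colourClass E S ((st s).mt b)).card by omega)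
  exact ⟨c, mem_colourClass.1 hc⟩

end BadgeFamily

/-- The other end of the edge of `F` at `w`, or `w` itself if `w` is uncovered. -/
noncomputable def partner (F : Finset (Sym2 V)) (w : V) : V :=
  @dite V (∃ w', s(w, w') ∈ F) (Classical.dec _) (fun h => h.choose) (fun _ => w)

lemma partner_eq {F : Finset (Sym2 V)} (hF : IsMat F) {w w' : V} (h : s(w, w') ∈ F) :
    partner F w = w' := by
  have hex : ∃ w', s(w, w') ∈ F := ⟨w', h⟩
  rw [partner, dif_pos hex]
  exact hF.partner_unique hex.choose_spec h

lemma partner_of_notMem {F : Finset (Sym2 V)} {w : V} (h : w ∉ cov F) : partner F w = w := by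
  rw [partner, dif_neg]
  rintro ⟨w', hw'⟩
  exact h (mem_cov_left hw')

namespace BadgeFamily

variable {σ σ' : Type} {st : σ → Origamistrip V} {st' : σ' → Origamistrip V}
  {F : Finset (Sym2 V)} {E : ι → Set (Sym2 V)} {S S' : Finset ι}

lemma mt_not (B : BadgeFamily st F E S) (hF : IsMat F) (s : σ) (b : Bool) :
    (st s).mt (!b) = Sym2.map (partner F) '' (st s).mt b :=
  (st s).mt_not_eq_image b (partner_of_notMem (B.x_not s)) (partner_of_notMem (B.y_not s))
    fun b _ h1 h2 => partner_eq hF ((B.skel _).2 ⟨s, (st s).side_mem_skeleton b h1 h2⟩)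

/-- If two badge families with the same skeleton differ in one colour only, that colour has the
same set in both. The reason is that a badge family has as many copies of a matching as of its
mirror image under `partner F`. -/
lemma eq_of_replace (B : BadgeFamily st F E S) (B' : BadgeFamily st' F E S') (hF : IsMat F)
    {i c : ι} (hi : i ∉ S) (hc : c ∈ S) (hS' : S' = insert i (S.erase c)) : E i = E c := by
  by_contra hne
  obtain ⟨f, b, hfb⟩ := B.cover c hc
  obtain ⟨c', hc', hfb'⟩ := B.exists_colour f (!b)
  have hcc' : c' ≠ c := by
    rintro rfl
    exact (st f).mt_ne b (hfb.symm.trans hfb')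
  have hc'S' : c' ∈ S' := by
    rw [hS']; exact Finset.mem_insert_of_mem (Finset.mem_erase.2 ⟨hcc', hc'⟩)
  obtain ⟨g, b', hgb⟩ := B'.cover c' hc'S'
  have h1 : (st f).mt (!b) = (st' g).mt b' := hfb'.symm.trans hgb
  have h2 : (st f).mt b = (st' g).mt (!b') := by
    have := B.mt_not hF f (!b)
    rw [Bool.not_not] at this
    rw [this, h1, B'.mt_not hF g b']
  have e1 := B.card f b
  have e2 := B.card f (!b)
  have e3 := B'.card g b'
  have e4 := B'.card g (!b')
  rw [← h1] at e3
  rw [← h2] at e4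
  have s1 : colourClass E S ((st f).mt (!b)) ⊆ colourClass E S' ((st f).mt (!b)) := by
    intro d hd
    obtain ⟨hdS, hd⟩ := mem_colourClass.1 hd
    refine mem_colourClass.2 ⟨?_, hd⟩
    rw [hS']
    refine Finset.mem_insert_of_mem (Finset.mem_erase.2 ⟨?_, hdS⟩)
    rintro rfl
    exact (st f).mt_ne b (hfb.symm.trans hd)
  have hcm : c ∈ colourClass E S ((st f).mt b) := mem_colourClass.2 ⟨hc, hfb⟩
  have s2 : colourClass E S' ((st f).mt b) ⊆ (colourClass E S ((st f).mt b)).erase c := by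
    intro d hd
    obtain ⟨hdS, hd⟩ := mem_colourClass.1 hd
    rw [hS'] at hdS
    rcases Finset.mem_insert.1 hdS with rfl | hdS
    · exact absurd (hd.trans hfb.symm) hne
    · obtain ⟨hdc, hdS⟩ := Finset.mem_erase.1 hdS
      exact Finset.mem_erase.2 ⟨hdc, mem_colourClass.2 ⟨hdS, hd⟩⟩
  have k1 := Finset.card_le_card s1
  have k2 := Finset.card_le_card s2
  have k3 := Finset.card_erase_add_one hcm
  omega

end BadgeFamily

end BadgeFamilies
end RainbowAAP

namespace RainbowAAP

/-! ### Undoing the contraction of a triangle -/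

section Uncontraction

variable {V ι : Type*} [DecidableEq V] [DecidableEq ι]

set_option linter.unusedSectionVars false

variable {F : Finset (Sym2 V)} {E : ι → Set (Sym2 V)} {S : Finset ι} {x u v : V} {i j : ι}

namespace Triangle

/-- An edge is one of the coloured edges of the triangle, or avoids the triangle, or joins it to
another vertex. -/
lemma edge_cases (T : Triangle F E S x u v i j) {t : ℕ} (h : Inst F E S t) {c : ι} {e : Sym2 V}
    (he : e ∈ E c) : e = s(x, u) ∨ e = s(x, v) ∨
      (e ∈ contr x u v E c ∧ x ∉ e ∧ u ∉ e ∧ v ∉ e) ∨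
      ∃ y a, (y = x ∨ y = u ∨ y = v) ∧ (a ≠ x ∧ a ≠ u ∧ a ≠ v) ∧ e = s(y, a) ∧
        s(x, a) ∈ contr x u v E c := by
  induction e using Sym2.ind with
  | _ a b =>
  have hne : a ≠ b := by simpa using h.nodiag c _ he
  have huvF : s(u, v) ∉ E c := fun h' => h.disj c _ h' T.huv
  have hvuF : s(v, u) ∉ E c := fun h' => h.disj c _ h' T.symm.huv
  by_cases ha : a = x ∨ a = u ∨ a = v <;> by_cases hb : b = x ∨ b = u ∨ b = v
  · rcases ha with rfl | rfl | rfl <;> rcases hb with rfl | rfl | rfl <;>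
      first
        | exact absurd rfl hne
        | exact absurd he huvF
        | exact absurd he hvuF
        | simp [Sym2.eq_swap]
  · push Not at hb
    exact Or.inr (Or.inr (Or.inr ⟨a, b, ha, hb, rfl, T.mem_contr_x ha hb he⟩))
  · push Not at ha
    exact Or.inr (Or.inr (Or.inr ⟨b, a, hb, ha, Sym2.eq_swap,
      T.mem_contr_x hb ha (Sym2.eq_swap ▸ he)⟩))
  · push Not at ha hb
    refine Or.inr (Or.inr (Or.inl ⟨mem_contr hne ha hb.2 he, ?_, ?_, ?_⟩)) <;>
      rw [Sym2.mem_iff, not_or]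
    · exact ⟨ha.1.symm, hb.1.symm⟩
    · exact ⟨ha.2.1.symm, hb.2.1.symm⟩
    · exact ⟨ha.2.2.symm, hb.2.2.symm⟩

/-- An edge of the contracted graph away from `x` is an edge of the original graph. -/
lemma mem_of_mem_contr (T : Triangle F E S x u v i j) {c : ι} {e : Sym2 V}
    (he : e ∈ contr x u v E c) (hx : x ∉ e) : e ∈ E c := by
  induction e using Sym2.ind with
  | _ a b =>
  rw [Sym2.mem_iff, not_or] at hx
  exact (T.of_mem_contr he).2.2.2.1 (Ne.symm hx.1) (Ne.symm hx.2)

lemma notMem_of_mem_contr (T : Triangle F E S x u v i j) {c : ι} {e : Sym2 V}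
    (he : e ∈ contr x u v E c) {w : V} (hw : w ∈ e) : w ≠ u ∧ w ≠ v := by
  obtain ⟨w', rfl⟩ := Sym2.mem_iff_exists.1 hw
  exact (T.of_mem_contr he).2.1

end Triangle

/-- `O` is a strip of the contracted graph that starts at the vertex `x` of the triangle. -/
structure Arm (F : Finset (Sym2 V)) (x u v : V) (O : Origamistrip V) : Prop where
  hx : O.x = x
  hy : O.y ∉ cov F
  int : ∀ w ∈ O.interior, w ∈ cov F ∧ w ≠ u ∧ w ≠ v
  skel : ∀ e ∈ O.skeleton, e ∈ F

namespace Arm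

variable {O : Origamistrip V}

lemma swap (A : Arm F x u v O) : Arm F x v u O.swap where
  hx := A.hx
  hy := A.hy
  int := fun w hw => ⟨(A.int w (O.swap_interior ▸ hw)).1, (A.int w (O.swap_interior ▸ hw)).2.symm⟩
  skel := fun e he => A.skel e (O.swap_skeleton ▸ he)

lemma side_int (A : Arm F x u v O) (b : Bool) :
    O.side b 1 ∈ cov F ∧ O.side b 1 ≠ u ∧ O.side b 1 ≠ v :=
  A.int _ (O.side_mem_interior b le_rfl O.one_le_m)

/-- The set of a colour whose contraction is the matching `O.mt b` meets the triangle in one of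
three ways, since it forms with `F` a graph in which all vertices of the strip and the triangle
are matched. -/
lemma first_edge (A : Arm F x u v O) (T : Triangle F E S x u v i j) (h : Inst F E S 0) {d : ι}
    (hd : d ∈ S) {b : Bool} (hdO : contr x u v E d = O.mt b) :
    s(x, O.side b 1) ∈ E d ∨ (s(u, O.side b 1) ∈ E d ∧ s(x, v) ∈ E d) ∨
      (s(v, O.side b 1) ∈ E d ∧ s(x, u) ∈ E d) := by
  obtain ⟨N, hN, hNZ, hNc⟩ := h.aug {d} (by simpa using hd) (by simp)
  have hNd : ∀ e ∈ N, e ∈ F ∨ e ∈ E d := by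
    intro e he
    rcases hNZ he with h | h
    · exact Or.inl h
    · exact Or.inr (by simpa using h)
  have hcov : cov N ⊆ insert x (insert O.y (cov F)) := by
    intro w hw
    obtain ⟨e, he, hwe⟩ := mem_cov.1 hw
    simp only [Finset.mem_insert]
    have hmt : ∀ e' ∈ contr x u v E d, ∀ w ∈ e', w = x ∨ w = O.y ∨ w ∈ cov F := by
      intro e' he' w hw
      rw [hdO] at he'
      rcases O.mem_of_mem_mt he' hw with h1 | h1 | h1
      · exact Or.inr (Or.inr (A.int _ h1).1)
      · exact Or.inl (h1.trans A.hx)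
      · exact Or.inr (Or.inl h1)
    have hu := mem_cov_left T.huv
    have hv := mem_cov_right T.huv
    rcases hNd e he with hF | hE
    · exact Or.inr (Or.inr (mem_cov.2 ⟨e, hF, hwe⟩))
    rcases T.edge_cases h hE with rfl | rfl | ⟨h1, -⟩ | ⟨y, a, hy, -, rfl, h1⟩
    · rcases Sym2.mem_iff.1 hwe with rfl | rfl <;> simp [hu]
    · rcases Sym2.mem_iff.1 hwe with rfl | rfl <;> simp [hv]
    · exact hmt e h1 w hwe
    · rcases Sym2.mem_iff.1 hwe with rfl | rfl
      · rcases hy with rfl | rfl | rfl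
        · exact Or.inl rfl
        · exact Or.inr (Or.inr hu)
        · exact Or.inr (Or.inr hv)
      · exact hmt _ h1 _ (Sym2.mem_mk_right _ _)
  have hxy : x ≠ O.y := A.hx ▸ O.x_ne_y
  have heq := hN.cov_eq_of_subset hcov (by
    have h1 := Finset.card_insert_le x (insert O.y (cov F))
    have h2 := Finset.card_insert_le O.y (cov F)
    rw [h.mat.card_cov] at h2
    omega)
  -- the possible partners of `x`, and then of `u` or `v`
  obtain ⟨p, hp⟩ := exists_mk_of_mem_cov (show x ∈ cov N by rw [heq]; simp)
  have hfirst : ∀ {a}, s(x, a) ∈ contr x u v E d → a = O.side b 1 := by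
    intro a ha
    rw [hdO, ← A.hx] at ha
    exact O.eq_of_x_mem_mt ha
  have hpE : s(x, p) ∈ E d := (hNd _ hp).resolve_left (IsMat.notMem_of_notMem_cov T.hx)
  have other : ∀ {u v : V} {i j : ι}, Triangle F E S x u v i j → s(x, u) ∈ N →
      (∀ {a}, s(x, a) ∈ contr x u v E d → a = O.side b 1) →
      v ∈ cov N → s(v, O.side b 1) ∈ E d := by
    intro u v i j T hxu hfirst hv
    have huv := T.u_ne_v h
    obtain ⟨q, hq⟩ := exists_mk_of_mem_cov hv
    have hqx : q ≠ x := by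
      rintro rfl
      rw [Sym2.eq_swap] at hq
      exact huv (hN.partner_unique hxu hq)
    have hqu : q ≠ u := by
      rintro rfl
      rw [Sym2.eq_swap] at hq hxu
      exact T.x_ne_v (hN.partner_unique hxu hq)
    have hqv : q ≠ v := (hN.ne hq).symm
    have hqE : s(v, q) ∈ E d := by
      refine (hNd _ hq).resolve_left fun hF => hqu ?_
      exact h.mat.partner_unique hF T.symm.huv
    have := hfirst (T.mem_contr_x (Or.inr (Or.inr rfl)) ⟨hqx, hqu, hqv⟩ hqE)
    rwa [← this]
  by_cases hpu : p = u
  · subst hpu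
    refine Or.inr (Or.inr ⟨other T hp hfirst ?_, hpE⟩)
    rw [heq]; simp only [Finset.mem_insert]
    exact Or.inr (Or.inr (mem_cov_right T.huv))
  by_cases hpv : p = v
  · subst hpv
    refine Or.inr (Or.inl ⟨other T.symm hp ?_ ?_, hpE⟩)
    · intro a ha
      rw [contr_comm] at ha
      exact hfirst ha
    · rw [heq]; simp only [Finset.mem_insert]
      exact Or.inr (Or.inr (mem_cov_left T.huv))
  · have := hfirst (T.mem_contr_x (Or.inl rfl) ⟨(hN.ne hp).symm, hpu, hpv⟩ hpE)
    rw [← this]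
    exact Or.inl hpE

/-- Flipping `F` along the strip, from `y` to its first vertex, gives a matching as large as `F`
without `uv`, whose edges outside `F` are available in every colour of the strip. -/
lemma exists_tail (A : Arm F x u v O) (T : Triangle F E S x u v i j) (h : Inst F E S 0) {d : ι}
    (hd : d ∈ S) {b : Bool} (hdO : contr x u v E d = O.mt b) :
    ∃ P : Finset (Sym2 V), IsMat P ∧ P.card + 1 = F.card ∧ x ∉ cov P ∧ u ∉ cov P ∧ v ∉ cov P ∧
      O.side b 1 ∉ cov P ∧ (P \ F).card ≤ O.m ∧
      ∀ e ∈ P \ F, ∀ d', contr x u v E d' = O.mt b → e ∈ E d' := by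
  obtain ⟨N, hN, hNZ, hNc⟩ := T.contr_aug h (h.aug {d} (by simpa using hd) (by simp))
  have hcard := Finset.card_erase_add_one T.huv
  have hNd : ∀ e ∈ N, e ∈ F.erase s(u, v) ∨ e ∈ O.mt b := by
    intro e he
    rcases hNZ he with h | h
    · exact Or.inl h
    · rw [← hdO]; exact Or.inr (by simpa using h)
  have hF1 := h.mat.erase s(u, v)
  have huv : ∀ w ∈ cov N, w ≠ u ∧ w ≠ v := by
    intro w hw
    obtain ⟨e, he, hwe⟩ := mem_cov.1 hw
    rcases hNd e he with h1 | h1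
    · exact ((T.erase_cov h).1 (mem_cov.2 ⟨e, h1, hwe⟩)).2
    · rw [← hdO] at h1
      exact T.notMem_of_mem_contr h1 hwe
  have hcov : cov N ⊆ insert x (insert O.y (cov (F.erase s(u, v)))) := by
    intro w hw
    have hw' := huv w hw
    obtain ⟨e, he, hwe⟩ := mem_cov.1 hw
    simp only [Finset.mem_insert]
    rcases hNd e he with h1 | h1
    · exact Or.inr (Or.inr (mem_cov.2 ⟨e, h1, hwe⟩))
    · rcases O.mem_of_mem_mt h1 hwe with h1 | h1 | h1
      · exact Or.inr (Or.inr ((T.erase_cov h).2 (A.int _ h1)))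
      · exact Or.inl (h1.trans A.hx)
      · exact Or.inr (Or.inl h1)
  have heq := hN.cov_eq_of_subset hcov (by
    have h1 := Finset.card_insert_le x (insert O.y (cov (F.erase s(u, v))))
    have h2 := Finset.card_insert_le O.y (cov (F.erase s(u, v)))
    rw [hF1.card_cov] at h2
    omega)
  obtain ⟨p, hp⟩ := exists_mk_of_mem_cov (show x ∈ cov N by rw [heq]; simp)
  have hxF : ∀ {a}, s(x, a) ∉ F := IsMat.notMem_of_notMem_cov T.hx
  have hpO : s(x, p) ∈ O.mt b :=
    (hNd _ hp).resolve_left fun hF => hxF (Finset.mem_of_mem_erase hF)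
  have hpa : p = O.side b 1 := by
    rw [← A.hx] at hpO; exact O.eq_of_x_mem_mt hpO
  have hce := hN.cov_erase hp
  have hxP : x ∉ cov (N.erase s(x, p)) := by rw [hce]; simp
  have hPF : ∀ e ∈ N.erase s(x, p) \ F, e ∈ O.mt b := by
    intro e he
    obtain ⟨h1, h2⟩ := Finset.mem_sdiff.1 he
    exact (hNd e (Finset.mem_of_mem_erase h1)).resolve_left
      fun hF => h2 (Finset.mem_of_mem_erase hF)
  refine ⟨N.erase s(x, p), hN.erase _, ?_, hxP, ?_, ?_, ?_, ?_, ?_⟩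
  · have := Finset.card_erase_add_one hp; omega
  · exact fun h => (huv u (cov_mono (Finset.erase_subset _ _) h)).1 rfl
  · exact fun h => (huv v (cov_mono (Finset.erase_subset _ _) h)).2 rfl
  · rw [hce, hpa]; simp
  · obtain ⟨R, hR, hRc⟩ := O.exists_finset_mt b
    have hsub : N.erase s(x, p) \ F ⊆ R.erase s(x, p) := by
      intro e he
      refine Finset.mem_erase.2 ⟨?_, (hR e).2 (hPF e he)⟩
      exact Finset.ne_of_mem_erase (Finset.mem_sdiff.1 he).1
    have h1 := Finset.card_le_card hsub
    have h2 := Finset.card_erase_add_one ((hR _).2 hpO)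
    omega
  · intro e he d' hd'
    refine T.mem_of_mem_contr (c := d') (by rw [hd']; exact hPF e he) ?_
    exact fun hxe => hxP (mem_cov.2 ⟨e, (Finset.mem_sdiff.1 he).1, hxe⟩)

variable {C : Finset ι}

/-- If more colours contract to `O.mt b` than the weight of the strip, none of them contains the
first edge of the strip. -/
lemma first_notMem (A : Arm F x u v O) (T : Triangle F E S x u v i j) (h : Inst F E S 0) {b : Bool}
    (hCS : C ⊆ S) (hCm : C.card = O.m + 1) (hC : ∀ d ∈ C, contr x u v E d = O.mt b) {d : ι}
    (hd : d ∈ C) : s(x, O.side b 1) ∉ E d := by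
  intro hxa
  obtain ⟨P, hP, hPc, hxP, huP, hvP, haP, hPm, hPE⟩ := A.exists_tail T h (hCS hd) (hC d hd)
  have ha := A.side_int b
  have hxa' : x ≠ O.side b 1 := by rintro h; exact T.hx (h ▸ ha.1)
  have hN1 := hP.insert_mk (T.u_ne_v h) huP hvP
  have hx1 : x ∉ cov (insert s(u, v) P) := by rw [cov_insert_mk]; simp [T.x_ne_u, T.x_ne_v, hxP]
  have ha1 : O.side b 1 ∉ cov (insert s(u, v) P) := by
    rw [cov_insert_mk]; simp [ha.2.1, ha.2.2, haP]
  have : Nonempty ι := ⟨d⟩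
  have hR : Rainbow E (C.erase d) (P \ F) := by
    refine Rainbow.of_card_le ?_ fun e he d' hd' =>
      hPE e he d' (hC d' (Finset.mem_of_mem_erase hd'))
    have := Finset.card_erase_add_one hd
    omega
  have hR1 := hR.insert (Finset.notMem_erase _ _) hxa
  rw [Finset.insert_erase hd] at hR1
  refine h.norb _ (hN1.insert_mk hxa' hx1 ha1) ?_ (hR1.mono ?_ hCS)
  · rw [IsMat.card_insert_mk hx1, IsMat.card_insert_mk huP]; omega
  · intro e he
    obtain ⟨h1, h2⟩ := Finset.mem_sdiff.1 he
    rcases Finset.mem_insert.1 h1 with rfl | h1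
    · exact Finset.mem_insert_self _ _
    rcases Finset.mem_insert.1 h1 with rfl | h1
    · exact absurd T.huv h2
    · exact Finset.mem_insert_of_mem (Finset.mem_sdiff.2 ⟨h1, h2⟩)

/-- If more colours contract to `O.mt b` than the weight of the strip, then the strip cannot be
continued to `x` through the pair `p`, `q` with a colour from outside. -/
lemma no_detour (A : Arm F x u v O) (T : Triangle F E S x u v i j) (h : Inst F E S 0) {b : Bool}
    (hCS : C ⊆ S) (hCm : C.card = O.m + 1) (hC : ∀ d ∈ C, contr x u v E d = O.mt b) {d e : ι}
    (hd : d ∈ C) (he : e ∈ S) (heC : e ∉ C) {p q : V} (hpq : p = u ∧ q = v ∨ p = v ∧ q = u)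
    (hpa : s(p, O.side b 1) ∈ E d) (hqx : s(x, q) ∈ E e) : False := by
  obtain ⟨P, hP, hPc, hxP, huP, hvP, haP, hPm, hPE⟩ := A.exists_tail T h (hCS hd) (hC d hd)
  have ha := A.side_int b
  have huv := T.u_ne_v h
  have hxa' : x ≠ O.side b 1 := by rintro h; exact T.hx (h ▸ ha.1)
  have hp : p ∉ cov P ∧ q ∉ cov P ∧ p ≠ q ∧ x ≠ p ∧ x ≠ q ∧ O.side b 1 ≠ p ∧ O.side b 1 ≠ q := by
    rcases hpq with ⟨rfl, rfl⟩ | ⟨rfl, rfl⟩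
    · exact ⟨huP, hvP, huv, T.x_ne_u, T.x_ne_v, ha.2.1, ha.2.2⟩
    · exact ⟨hvP, huP, huv.symm, T.x_ne_v, T.x_ne_u, ha.2.2, ha.2.1⟩
  obtain ⟨hpP, hqP, hpq', hxp, hxq, hap, haq⟩ := hp
  have hN1 := hP.insert_mk hap.symm hpP haP
  have hx1 : x ∉ cov (insert s(p, O.side b 1) P) := by rw [cov_insert_mk]; simp [hxp, hxa', hxP]
  have hq1 : q ∉ cov (insert s(p, O.side b 1) P) := by
    rw [cov_insert_mk]; simp [hpq'.symm, haq.symm, hqP]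
  have : Nonempty ι := ⟨d⟩
  have hR : Rainbow E (C.erase d) (P \ F) := by
    refine Rainbow.of_card_le ?_ fun e he d' hd' =>
      hPE e he d' (hC d' (Finset.mem_of_mem_erase hd'))
    have := Finset.card_erase_add_one hd
    omega
  have hR1 := hR.insert (Finset.notMem_erase _ _) hpa
  rw [Finset.insert_erase hd] at hR1
  have hR2 := hR1.insert heC hqx
  refine h.norb _ (hN1.insert_mk hxq hx1 hq1) ?_ (hR2.mono ?_ (Finset.insert_subset he hCS))
  · rw [IsMat.card_insert_mk hx1, IsMat.card_insert_mk hpP]; omega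
  · intro e he
    obtain ⟨h1, h2⟩ := Finset.mem_sdiff.1 he
    rcases Finset.mem_insert.1 h1 with rfl | h1
    · exact Finset.mem_insert_self _ _
    rcases Finset.mem_insert.1 h1 with rfl | h1
    · exact Finset.mem_insert_of_mem (Finset.mem_insert_self _ _)
    · exact Finset.mem_insert_of_mem (Finset.mem_insert_of_mem (Finset.mem_sdiff.2 ⟨h1, h2⟩))

/-- If more colours contract to `O.mt b` than the weight of the strip, and `j` is not one of them,
then they all contain `xu` and continue the strip from `v`, and no other colour contains `xu`. -/
lemma extended (A : Arm F x u v O) (T : Triangle F E S x u v i j) (h : Inst F E S 0) {b : Bool}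
    (hCS : C ⊆ S) (hCm : C.card = O.m + 1) (hC : ∀ d ∈ C, contr x u v E d = O.mt b)
    (hjC : j ∉ C) :
    (∀ d ∈ C, s(x, u) ∈ E d ∧ s(v, O.side b 1) ∈ E d ∧ s(u, O.side b 1) ∉ E d ∧
      s(x, O.side b 1) ∉ E d) ∧ ∀ e ∈ S, e ∉ C → s(x, u) ∉ E e := by
  have h1 : ∀ d ∈ C, s(x, u) ∈ E d ∧ s(v, O.side b 1) ∈ E d ∧ s(u, O.side b 1) ∉ E d ∧
      s(x, O.side b 1) ∉ E d := by
    intro d hd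
    have n1 := A.first_notMem T h hCS hCm hC hd
    have n2 : s(u, O.side b 1) ∉ E d := fun hu =>
      A.no_detour T h hCS hCm hC hd T.hj hjC (Or.inl ⟨rfl, rfl⟩) hu T.hxv
    rcases A.first_edge T h (hCS hd) (hC d hd) with h1 | h1 | h1
    · exact absurd h1 n1
    · exact absurd h1.1 n2
    · exact ⟨h1.2, h1.1, n2, n1⟩
  refine ⟨h1, fun e he heC hxu => ?_⟩
  obtain ⟨d, hd⟩ := Finset.card_pos.1 (show 0 < C.card by omega)
  exact A.no_detour T h hCS hCm hC hd he heC (Or.inr ⟨rfl, rfl⟩) (h1 d hd).2.1 hxu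

end Arm

namespace Triangle

variable {σ : Type} {st : σ → Origamistrip V}

/-- The strips of the contracted graph have their endpoints outside the original `F`. -/
lemma endpoints_notMem (T : Triangle F E S x u v i j) (h : Inst F E S 0)
    (B : BadgeFamily st (F.erase s(u, v)) (contr x u v E) ((S.erase i).erase j)) (s : σ) :
    (st s).x ∉ cov F ∧ (st s).y ∉ cov F := by
  obtain ⟨c, -, hc⟩ := B.exists_colour s true
  have hx := T.notMem_of_mem_contr (c := c) (by rw [hc]; exact (st s).first_mem_mt true)
    (Sym2.mem_mk_left _ _)
  have hy := T.notMem_of_mem_contr (c := c) (by rw [hc]; exact (st s).last_mem_mt true)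
    (Sym2.mem_mk_right _ _)
  exact ⟨fun h' => B.x_not s ((T.erase_cov h).2 ⟨h', hx⟩),
    fun h' => B.y_not s ((T.erase_cov h).2 ⟨h', hy⟩)⟩

/-- A strip of the contracted graph that has `x` as an endpoint, presented as an arm. -/
lemma exists_arm (T : Triangle F E S x u v i j) (h : Inst F E S 0)
    (B : BadgeFamily st (F.erase s(u, v)) (contr x u v E) ((S.erase i).erase j)) {s : σ}
    (hx : x = (st s).x ∨ x = (st s).y) (b : Bool) :
    ∃ O : Origamistrip V, Arm F x u v O ∧ O.m = (st s).m ∧ O.interior = (st s).interior ∧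
      O.skeleton = (st s).skeleton ∧ O.mt true = (st s).mt b ∧ O.mt false = (st s).mt (!b) := by
  obtain ⟨O, h1, h2, h3, h4, h5, h6, h7⟩ := (st s).exists_oriented b hx
  refine ⟨O, ⟨h1, ?_, ?_, ?_⟩, h2, h3, h4, h6, h7⟩
  · have := T.endpoints_notMem h B s
    rcases h5 with h5 | h5 <;> rw [h5]
    exacts [this.1, this.2]
  · intro w hw
    rw [h3] at hw
    exact (T.erase_cov h).1 (B.interior_subset hw)
  · intro e he
    rw [h4] at he
    exact Finset.mem_of_mem_erase ((B.skel e).2 ⟨s, he⟩)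

/-- If none of the colours of a strip has an edge of the triangle, then contraction does not change
their sets. -/
lemma eq_of_no_edge (T : Triangle F E S x u v i j) (h : Inst F E S 0)
    (hS : S.card = 2 * F.card + 0)
    (B : BadgeFamily st (F.erase s(u, v)) (contr x u v E) ((S.erase i).erase j)) {s : σ} {b : Bool}
    {c : ι} (hc : c ∈ (S.erase i).erase j) (hcs : contr x u v E c = (st s).mt b)
    (hno : ∀ d ∈ (S.erase i).erase j, ∀ b', contr x u v E d = (st s).mt b' →
      s(x, u) ∉ E d ∧ s(x, v) ∉ E d) : E c = contr x u v E c := by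
  have hsub : E c ⊆ contr x u v E c := by
    intro e he
    rcases T.edge_cases h he with rfl | rfl | ⟨h1, -⟩ | ⟨y, a, hy, ha, rfl, h1⟩
    · exact absurd he (hno c hc b hcs).1
    · exact absurd he (hno c hc b hcs).2
    · exact h1
    · -- an edge at `u` or `v` would close an odd cycle of length five through `x`
      have hxs : x = (st s).x ∨ x = (st s).y := by
        rw [hcs] at h1
        rcases (st s).mem_of_mem_mt h1 (Sym2.mem_mk_left _ _) with h2 | h2 | h2
        · exact absurd (Finset.mem_coe.1 (B.interior_subset h2))
            (fun h' => T.hx (cov_mono (Finset.erase_subset _ _) h'))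
        · exact Or.inl h2
        · exact Or.inr h2
      obtain ⟨O, A, -, -, -, hO1, hO2⟩ := T.exists_arm h B hxs b
      obtain ⟨c', hc', hcs'⟩ := B.exists_colour s (!b)
      have haO : a = O.side true 1 := by
        rw [hcs, ← hO1, ← A.hx] at h1
        exact O.eq_of_x_mem_mt h1
      have hc'S := hc'
      simp only [Finset.mem_erase] at hc hc'S
      have hx' : s(x, O.side false 1) ∈ E c' := by
        have hn := hno c' hc' _ hcs'
        rcases A.first_edge T h hc'S.2.2 (hcs'.trans hO2.symm) with h2 | h2 | h2
        · exact h2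
        · exact absurd h2.2 hn.2
        · exact absurd h2.2 hn.1
      have hcc' : c ≠ c' := by
        rintro rfl
        exact (st s).mt_ne b (hcs.symm.trans hcs')
      have haa : s(a, O.side false 1) ∈ F := by
        rw [haO]
        exact A.skel _ (O.side_mem_skeleton true le_rfl O.one_le_m)
      have hne : s(u, v) ≠ s(a, O.side false 1) := by
        intro h'
        have : a ∈ s(u, v) := h' ▸ Sym2.mem_mk_left _ _
        rcases Sym2.mem_iff.1 this with h' | h'
        exacts [ha.2.1 h', ha.2.2 h']
      rcases hy with rfl | rfl | rfl
      · exact h1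
      · exact (h.no_five_cycle hS T.hx T.symm.huv haa (by rwa [Sym2.eq_swap]) T.hj hc.2.2
          hc'S.2.2 (Ne.symm hc.1) (Ne.symm hc'S.1) hcc' T.hxv he (Sym2.eq_swap ▸ hx')).elim
      · exact (h.no_five_cycle hS T.hx T.huv haa hne T.hi hc.2.2 hc'S.2.2 (Ne.symm hc.2.1)
          (Ne.symm hc'S.2.1) hcc' T.hxu he (Sym2.eq_swap ▸ hx')).elim
  refine Set.Subset.antisymm hsub fun e he => ?_
  obtain ⟨-, f, hf, hfe⟩ := he
  have hf' := hsub hf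
  have : f.map (fold x u v) = f := by
    induction f using Sym2.ind with
    | _ p q =>
    have h1 := T.of_mem_contr hf'
    rw [Sym2.map_mk, fold_of_ne h1.2.1.1 h1.2.1.2, fold_of_ne h1.2.2.1.1 h1.2.2.1.2]
  rw [← hfe, this]
  exact hf

/-- A colour other than `i` that contains `xu` contracts to the same set as `i`: the two can be
exchanged in the triangle. -/
lemma contr_eq_of_mem (T : Triangle F E S x u v i j) (h : Inst F E S 0)
    (hB : ∀ {x u v : V} {i j : ι}, Triangle F E S x u v i j →
      IsBadgeFamily (F.erase s(u, v)) (contr x u v E) ((S.erase i).erase j))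
    {c : ι} (hc : c ∈ (S.erase i).erase j) (hxu : s(x, u) ∈ E c) :
    contr x u v E i = contr x u v E c := by
  have hcS := hc
  simp only [Finset.mem_erase] at hcS
  have T' : Triangle F E S x u v c j := ⟨T.hx, T.huv, hcS.2.2, T.hj, hcS.1, hxu, T.hxv⟩
  obtain ⟨σ, -, st, B⟩ := hB T
  obtain ⟨σ', -, st', B'⟩ := hB T'
  refine B.eq_of_replace B' (h.mat.erase _) (by simp) hc ?_
  ext d
  have := T.hij
  have := T.hi
  simp only [Finset.mem_erase, Finset.mem_insert]
  by_cases hdi : d = i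
  · subst hdi; simp [*, Ne.symm hcS.2.1]
  · simp [hdi]; tauto

/-- If a colour other than `i` contains `xu`, its strip in the contracted graph ends at `x`. -/
lemma endpoint_of_mem (T : Triangle F E S x u v i j) (h : Inst F E S 0)
    (B : BadgeFamily st (F.erase s(u, v)) (contr x u v E) ((S.erase i).erase j)) {c : ι}
    (hc : c ∈ (S.erase i).erase j) {s : σ} {b : Bool} (hcs : contr x u v E c = (st s).mt b)
    (hic : contr x u v E i = contr x u v E c) : x = (st s).x ∨ x = (st s).y := by
  by_contra hx
  push Not at hx
  have hxm : ∀ e ∈ (st s).mt b, x ∉ e := by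
    intro e he hxe
    rcases (st s).mem_of_mem_mt he hxe with h2 | h2 | h2
    · exact T.hx (cov_mono (Finset.erase_subset _ _) (B.interior_subset h2))
    · exact hx.1 h2
    · exact hx.2 h2
  have hcS := hc
  simp only [Finset.mem_erase] at hcS
  have hiC : i ∉ colourClass (contr x u v E) ((S.erase i).erase j) ((st s).mt b) := by
    rw [mem_colourClass]; simp
  -- The strip can be augmented with one colour more than its weight.
  obtain ⟨N, hN, hNZ, hNc⟩ := T.contr_aug h (h.aug {c} (by simpa using hcS.2.2) (by simp))
  have hcard := Finset.card_erase_add_one T.huv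
  have hNd : ∀ e ∈ N, e ∈ F.erase s(u, v) ∨ e ∈ (st s).mt b := by
    intro e he
    rcases hNZ he with h | h
    · exact Or.inl h
    · rw [← hcs]; exact Or.inr (by simpa using h)
  have huv : ∀ w ∈ cov N, w ≠ u ∧ w ≠ v := by
    intro w hw
    obtain ⟨e, he, hwe⟩ := mem_cov.1 hw
    rcases hNd e he with h1 | h1
    · exact ((T.erase_cov h).1 (mem_cov.2 ⟨e, h1, hwe⟩)).2
    · rw [← hcs] at h1
      exact T.notMem_of_mem_contr h1 hwe
  have huN : u ∉ cov N := fun h' => (huv u h').1 rfl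
  have hNF : insert s(u, v) N \ F ⊆ N \ F.erase s(u, v) := by
    intro e he
    obtain ⟨h1, h2⟩ := Finset.mem_sdiff.1 he
    rcases Finset.mem_insert.1 h1 with rfl | h1
    · exact absurd T.huv h2
    · exact Finset.mem_sdiff.2 ⟨h1, fun h' => h2 (Finset.mem_of_mem_erase h')⟩
  have hmt : ∀ e ∈ N \ F.erase s(u, v), e ∈ (st s).mt b := by
    intro e he
    obtain ⟨h1, h2⟩ := Finset.mem_sdiff.1 he
    exact (hNd e h1).resolve_left h2
  have : Nonempty ι := ⟨i⟩
  refine h.norb (insert s(u, v) N)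
    (hN.insert_mk (T.u_ne_v h) huN fun h' => (huv v h').2 rfl) ?_ ?_
  · rw [IsMat.card_insert_mk huN]; omega
  · refine (Rainbow.of_card_le (S := insert i
      (colourClass (contr x u v E) ((S.erase i).erase j) ((st s).mt b))) ?_ ?_).mono hNF ?_
    · rw [Finset.card_insert_of_notMem hiC, B.card]
      obtain ⟨R, hR, hRc⟩ := (st s).exists_finset_mt b
      exact (Finset.card_le_card fun e he => (hR e).2 (hmt e he)).trans hRc
    · intro e he d hd
      have hdE : contr x u v E d = (st s).mt b := by
        rcases Finset.mem_insert.1 hd with rfl | hd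
        · exact hic.trans hcs
        · exact (mem_colourClass.1 hd).2
      exact T.mem_of_mem_contr (by rw [hdE]; exact hmt e he) (hxm e (hmt e he))
    · refine Finset.insert_subset T.hi fun d hd => ?_
      have := (mem_colourClass.1 hd).1
      simp only [Finset.mem_erase] at this
      exact this.2.2

end Triangle

end Uncontraction
end RainbowAAP

namespace RainbowAAP

/-! ### Extending the badge of the contracted graph -/

section Badges

variable {V ι : Type*} [DecidableEq V] [DecidableEq ι]

set_option linter.unusedSectionVars false

variable {F : Finset (Sym2 V)} {E : ι → Set (Sym2 V)} {S : Finset ι} {x u v : V} {i j : ι}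

/-- The set of a colour that extends the strip by the pair `u`, `v` is determined. -/
lemma Arm.mem_iff_of_extended {O : Origamistrip V} (A : Arm F x u v O)
    (T : Triangle F E S x u v i j) (h : Inst F E S 0) {b : Bool} {d : ι}
    (hd : contr x u v E d = O.mt b) (hxu : s(x, u) ∈ E d) (hva : s(v, O.side b 1) ∈ E d)
    (hua : s(u, O.side b 1) ∉ E d) (hxa : s(x, O.side b 1) ∉ E d) (hxv : s(x, v) ∉ E d)
    (e : Sym2 V) :
    e ∈ E d ↔ e = s(x, u) ∨ e = s(v, O.side b 1) ∨ (e ∈ O.mt b ∧ x ∉ e) := by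
  constructor
  · intro he
    rcases T.edge_cases h he with rfl | rfl | ⟨h1, h2, -⟩ | ⟨y, a, hy, ha, rfl, h1⟩
    · exact Or.inl rfl
    · exact absurd he hxv
    · exact Or.inr (Or.inr ⟨hd ▸ h1, h2⟩)
    · rw [hd, ← A.hx] at h1
      have := O.eq_of_x_mem_mt h1
      subst this
      rcases hy with rfl | rfl | rfl
      · exact absurd he hxa
      · exact absurd he hua
      · exact Or.inr (Or.inl rfl)
  · rintro (rfl | rfl | ⟨h1, h2⟩)
    · exact hxu
    · exact hva
    · exact T.mem_of_mem_contr (hd ▸ h1) h2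

namespace Triangle

/-- If a third colour contains an edge of the triangle, a strip of the contracted badge is to be
extended by the pair `u`, `v`. -/
lemma isBadgeFamily_of_mem (T : Triangle F E S x u v i j) (h : Inst F E S 0)
    (hS : S.card = 2 * F.card + 0)
    (hB : ∀ {x u v : V} {i j : ι}, Triangle F E S x u v i j →
      IsBadgeFamily (F.erase s(u, v)) (contr x u v E) ((S.erase i).erase j))
    {c : ι} (hc : c ∈ (S.erase i).erase j) (hxu : s(x, u) ∈ E c) : IsBadgeFamily F E S := by
  obtain ⟨σ, hσ, st, B⟩ := hB T
  obtain ⟨f, b, hcf⟩ := B.cover c hc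
  have hic := T.contr_eq_of_mem h hB hc hxu
  obtain ⟨O, A, hOm, hOi, hOs, hO1, hO2⟩ :=
    T.exists_arm h B (T.endpoint_of_mem h B hc hcf hic) b
  rw [← hO1] at hcf
  have hS1 : ∀ {d}, d ∈ (S.erase i).erase j ↔ d ≠ j ∧ d ≠ i ∧ d ∈ S := by
    intro d; simp only [Finset.mem_erase]
  -- the colours `C` that continue one side of the strip
  have hm : ∀ b, (colourClass (contr x u v E) ((S.erase i).erase j) (O.mt b)).card = O.m := by
    intro b'
    cases b'
    · rw [hO2, hOm]; exact B.card f _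
    · rw [hO1, hOm]; exact B.card f _
  have hside : ∀ {l : ι} {b : Bool}, l ∈ S → (l = i ∨ l = j) → contr x u v E l = O.mt b →
      insert l (colourClass (contr x u v E) ((S.erase i).erase j) (O.mt b)) ⊆ S ∧
      (insert l (colourClass (contr x u v E) ((S.erase i).erase j) (O.mt b))).card = O.m + 1 ∧
      ∀ d ∈ insert l (colourClass (contr x u v E) ((S.erase i).erase j) (O.mt b)),
        contr x u v E d = O.mt b := by
    intro l b hl hlij hlb
    refine ⟨Finset.insert_subset hl fun d hd => (hS1.1 (mem_colourClass.1 hd).1).2.2, ?_, ?_⟩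
    · rw [Finset.card_insert_of_notMem, hm]
      intro hlc
      have := hS1.1 (mem_colourClass.1 hlc).1
      rcases hlij with rfl | rfl
      exacts [this.2.1 rfl, this.1 rfl]
    · intro d hd
      rcases Finset.mem_insert.1 hd with rfl | hd
      exacts [hlb, (mem_colourClass.1 hd).2]
  obtain ⟨hCS, hCm, hCd⟩ := hside T.hi (Or.inl rfl) (hic.trans hcf)
  set C := insert i (colourClass (contr x u v E) ((S.erase i).erase j) (O.mt true)) with hC
  have hjC : j ∉ C := by
    rw [hC, Finset.mem_insert, mem_colourClass, hS1]
    have := T.hij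
    tauto
  have hcC : c ∈ C := Finset.mem_insert_of_mem (mem_colourClass.2 ⟨hc, hcf⟩)
  have hiC : i ∈ C := Finset.mem_insert_self _ _
  obtain ⟨hA1, hA2⟩ := A.extended T h hCS hCm hCd hjC
  -- the colours `C'` that continue the other side
  obtain ⟨c', hc', hcf'⟩ := B.exists_colour f (!b)
  rw [← hO2] at hcf'
  have hc'S := hS1.1 hc'
  have hc'C : c' ∉ C := by
    intro h'
    exact O.mt_ne true ((hCd c' h').symm.trans hcf')
  have haa : s(O.side true 1, O.side false 1) ∈ F :=
    A.skel _ (O.side_mem_skeleton true le_rfl O.one_le_m)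
  have hne : s(u, v) ≠ s(O.side true 1, O.side false 1) := by
    intro h'
    have : O.side true 1 ∈ s(u, v) := h' ▸ Sym2.mem_mk_left _ _
    have := (A.side_int true).2
    simp_all
  have hxv' : s(x, v) ∈ E c' := by
    rcases A.first_edge T h hc'S.2.2 hcf' with h1 | h1 | h1
    · exact (h.no_five_cycle hS T.hx T.huv haa hne T.hi (hCS hcC) hc'S.2.2
        (Ne.symm (hS1.1 hc).2.1) (Ne.symm hc'S.2.1) (fun h' => hc'C (h' ▸ hcC)) T.hxu
        (hA1 c hcC).2.1 (Sym2.eq_swap ▸ h1)).elim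
    · exact h1.2
    · exact absurd h1.2 (hA2 c' hc'S.2.2 hc'C)
  have hjc : contr x u v E j = contr x u v E c' := by
    have := T.symm.contr_eq_of_mem h hB (by rw [Finset.erase_right_comm]; exact hc') hxv'
    rwa [contr_comm] at this
  obtain ⟨hCS', hCm', hCd'⟩ := hside T.hj (Or.inr rfl) (hjc.trans hcf')
  set C' := insert j (colourClass (contr x u v E) ((S.erase i).erase j) (O.mt false)) with hC'
  have hiC' : i ∉ C' := by
    rw [hC', Finset.mem_insert, mem_colourClass, hS1]
    have := T.hij
    tauto
  have hjC' : j ∈ C' := Finset.mem_insert_self _ _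
  have hCC' : ∀ d ∈ C, d ∉ C' := fun d hd hd' =>
    O.mt_ne true ((hCd d hd).symm.trans (hCd' d hd'))
  obtain ⟨hA1', hA2'⟩ := A.swap.extended T.symm h (b := true) hCS' hCm'
    (fun d hd => by rw [contr_comm, O.swap_mt]; exact hCd' d hd) hiC'
  simp only [O.swap_side, Bool.not_true] at hA1'
  have hother : ∀ d ∈ S, d ∉ C → d ∉ C' → d ∈ (S.erase i).erase j ∧
      contr x u v E d ≠ O.mt true ∧ contr x u v E d ≠ O.mt false := by
    intro d hd hdC hdC'
    have h1 : d ∈ (S.erase i).erase j :=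
      hS1.2 ⟨fun h' => hdC' (h' ▸ hjC'), fun h' => hdC (h' ▸ hiC), hd⟩
    exact ⟨h1, fun h' => hdC (Finset.mem_insert_of_mem (mem_colourClass.2 ⟨h1, h'⟩)),
      fun h' => hdC' (Finset.mem_insert_of_mem (mem_colourClass.2 ⟨h1, h'⟩))⟩
  have hOb : ∀ b', ∃ b'', (st f).mt b' = O.mt b'' := by
    intro b'
    by_cases hb : b' = b
    · exact ⟨true, by rw [hO1, hb]⟩
    · refine ⟨false, ?_⟩
      rw [hO2]
      congr 1
      cases b <;> cases b' <;> simp_all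
  -- the other strips are not affected by the contraction
  have hexact : ∀ d ∈ (S.erase i).erase j, ∀ g, g ≠ f → ∀ b', contr x u v E d = (st g).mt b' →
      E d = contr x u v E d := by
    intro d hd g hgf b' hdg
    refine T.eq_of_no_edge h hS B hd hdg ?_
    intro d' hd' b'' hd'g
    have hn : ∀ b, contr x u v E d' ≠ O.mt b := by
      intro b₀ h'
      have h2 : ∃ b₁, O.mt b₀ = (st f).mt b₁ := by
        cases b₀
        exacts [⟨_, hO2⟩, ⟨_, hO1⟩]
      obtain ⟨b₁, hb₁⟩ := h2
      exact hgf (B.mt_inj (hd'g.symm.trans (h'.trans hb₁))).1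
    have hd'S := (hS1.1 hd').2.2
    exact ⟨hA2 d' hd'S fun h' => hn _ (hCd d' h'), hA2' d' hd'S fun h' => hn _ (hCd' d' h')⟩
  have hu := mem_cov_left T.huv
  have hv := mem_cov_right T.huv
  have hux : O.x ≠ u := A.hx ▸ T.x_ne_u
  have hvx : O.x ≠ v := A.hx ▸ T.x_ne_v
  have hyu : O.y ≠ u := by rintro h'; exact A.hy (h' ▸ hu)
  have hyv : O.y ≠ v := by rintro h'; exact A.hy (h' ▸ hv)
  set O' := O.extend u v (fun h' => (A.int u h').2.1 rfl) (fun h' => (A.int v h').2.2 rfl)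
    (T.u_ne_v h) hux hvx hyu hyv with hO'
  have hO'i : O'.interior = insert u (insert v (st f).interior) := by
    rw [← hOi]; exact Origamistrip.extend_interior
  have hEC : ∀ d ∈ C, E d = O'.mt true := by
    intro d hd
    obtain ⟨a1, a2, a3, a4⟩ := hA1 d hd
    ext e
    rw [A.mem_iff_of_extended T h (hCd d hd) a1 a2 a3 a4 (hA2' d (hCS hd) (hCC' d hd)),
      Origamistrip.mem_extend_mt, A.hx]
    simp
  have hEC' : ∀ d ∈ C', E d = O'.mt false := by
    intro d hd
    obtain ⟨a1, a2, a3, a4⟩ := hA1' d hd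
    ext e
    rw [A.swap.mem_iff_of_extended T.symm h (b := true)
      (by rw [contr_comm, O.swap_mt]; exact hCd' d hd) a1
      (by rw [O.swap_side]; exact a2) (by rw [O.swap_side]; exact a3)
      (by rw [O.swap_side]; exact a4) (hA2 d (hCS' hd) fun h' => hCC' d h' hd),
      Origamistrip.mem_extend_mt, A.hx, O.swap_side, O.swap_mt]
    simp
  have hxuO' : s(x, u) ∈ O'.mt true := by rw [← hEC i hiC]; exact T.hxu
  have hxvO' : s(x, v) ∈ O'.mt false := by rw [← hEC' j hjC']; exact T.hxv
  have hint : ∀ s, u ∉ (st s).interior ∧ v ∉ (st s).interior := fun s =>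
    ⟨fun h' => ((T.erase_cov h).1 (B.interior_subset h')).2.1 rfl,
      fun h' => ((T.erase_cov h).1 (B.interior_subset h')).2.2 rfl⟩
  classical
  obtain ⟨st', hpos, hneg⟩ : ∃ st' : σ → Origamistrip V, st' f = O' ∧ ∀ {s}, s ≠ f → st' s = st s :=
    ⟨fun s => if s = f then O' else st s, if_pos rfl, fun hs => if_neg hs⟩
  refine ⟨σ, hσ, st', ?_, ?_, ?_, ?_, ?_, ?_⟩
  · have hd : ∀ s, s ≠ f → Disjoint O'.interior (st s).interior := by
      intro s hs
      rw [hO'i, Set.disjoint_insert_left, Set.disjoint_insert_left]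
      exact ⟨(hint s).1, (hint s).2, B.disj f s (Ne.symm hs)⟩
    intro s s' hss
    by_cases hs : s = f
    · subst hs
      rw [hpos, hneg (Ne.symm hss)]
      exact hd s' (Ne.symm hss)
    · by_cases hs' : s' = f
      · subst hs'
        rw [hpos, hneg hs]
        exact (hd s hs).symm
      · rw [hneg hs, hneg hs']
        exact B.disj s s' hss
  · intro s
    by_cases hs : s = f
    · subst hs; rw [hpos]; exact A.hx ▸ T.hx
    · rw [hneg hs]; exact (T.endpoints_notMem h B s).1
  · intro s
    by_cases hs : s = f
    · subst hs; rw [hpos]; exact A.hy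
    · rw [hneg hs]; exact (T.endpoints_notMem h B s).2
  · have hO's : O'.skeleton = insert s(u, v) (st f).skeleton := by
      rw [← hOs]; exact Origamistrip.extend_skeleton
    intro e
    constructor
    · intro he
      by_cases heuv : e = s(u, v)
      · exact ⟨f, by rw [hpos, hO's]; exact Or.inl heuv⟩
      · obtain ⟨s, hs⟩ := (B.skel e).1 (Finset.mem_erase.2 ⟨heuv, he⟩)
        by_cases hsf : s = f
        · subst hsf
          exact ⟨s, by rw [hpos, hO's]; exact Or.inr hs⟩
        · exact ⟨s, by rw [hneg hsf]; exact hs⟩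
    · rintro ⟨s, hs⟩
      by_cases hsf : s = f
      · subst hsf
        rw [hpos, hO's] at hs
        rcases hs with rfl | hs
        · exact T.huv
        · exact Finset.mem_of_mem_erase ((B.skel e).2 ⟨s, hs⟩)
      · rw [hneg hsf] at hs
        exact Finset.mem_of_mem_erase ((B.skel e).2 ⟨s, hs⟩)
  · intro d hd
    by_cases hdC : d ∈ C
    · exact ⟨f, true, by rw [hpos]; exact hEC d hdC⟩
    by_cases hdC' : d ∈ C'
    · exact ⟨f, false, by rw [hpos]; exact hEC' d hdC'⟩
    obtain ⟨h1, h2, h3⟩ := hother d hd hdC hdC'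
    obtain ⟨g, b', hg⟩ := B.cover d h1
    have hgf : g ≠ f := by
      rintro rfl
      obtain ⟨b'', hb''⟩ := hOb b'
      cases b''
      exacts [h3 (hg.trans hb''), h2 (hg.trans hb'')]
    exact ⟨g, b', by rw [hneg hgf, hexact d h1 g hgf b' hg, hg]⟩
  · intro s b'
    by_cases hs : s = f
    · subst hs
      rw [hpos, show O'.m = O.m + 1 from rfl]
      cases b'
      · rw [← hCm']
        congr 1
        ext d
        rw [mem_colourClass]
        refine ⟨fun ⟨h1, h2⟩ => ?_, fun h1 => ⟨hCS' h1, hEC' d h1⟩⟩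
        by_contra hd
        exact hA2' d h1 hd (h2 ▸ hxvO')
      · rw [← hCm]
        congr 1
        ext d
        rw [mem_colourClass]
        refine ⟨fun ⟨h1, h2⟩ => ?_, fun h1 => ⟨hCS h1, hEC d h1⟩⟩
        by_contra hd
        exact hA2 d h1 hd (h2 ▸ hxuO')
    · rw [hneg hs, ← B.card s b']
      congr 1
      ext d
      rw [mem_colourClass, mem_colourClass]
      constructor
      · rintro ⟨h1, h2⟩
        have hnot : ∀ w, w = u ∨ w = v → ∀ w', s(w', w) ∉ (st s).mt b' := by
          intro w hw w' hm
          have hwF : w ∈ cov F := by rcases hw with rfl | rfl <;> assumption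
          rcases (st s).mem_of_mem_mt hm (Sym2.mem_mk_right _ _) with h3 | h3 | h3
          · rcases hw with rfl | rfl
            exacts [(hint s).1 h3, (hint s).2 h3]
          · exact (T.endpoints_notMem h B s).1 (h3 ▸ hwF)
          · exact (T.endpoints_notMem h B s).2 (h3 ▸ hwF)
        have hdC : d ∉ C := fun hdC => hnot u (Or.inl rfl) x (h2 ▸ (hA1 d hdC).1)
        have hdC' : d ∉ C' := fun hdC' => hnot v (Or.inr rfl) x (h2 ▸ (hA1' d hdC').1)
        obtain ⟨h3, h4, h5⟩ := hother d h1 hdC hdC'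
        obtain ⟨g, b'', hg⟩ := B.cover d h3
        have hgf : g ≠ f := by
          rintro rfl
          obtain ⟨b''', hb'''⟩ := hOb b''
          cases b'''
          exacts [h5 (hg.trans hb'''), h4 (hg.trans hb''')]
        exact ⟨h3, (hexact d h3 g hgf b'' hg).symm.trans h2⟩
      · rintro ⟨h1, h2⟩
        exact ⟨(hS1.1 h1).2.2, (hexact d h1 s hs b' h2).trans h2⟩

/-- If the two colours of the triangle have no further edges than those of a strip of weight one,
and no third colour contains an edge of the triangle, this strip is added to the contracted
badge. -/
lemma isBadgeFamily_of_pair (T : Triangle F E S x u v i j) (h : Inst F E S 0)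
    (hS : S.card = 2 * F.card + 0)
    (hB : IsBadgeFamily (F.erase s(u, v)) (contr x u v E) ((S.erase i).erase j))
    (hno : ∀ d ∈ (S.erase i).erase j, s(x, u) ∉ E d ∧ s(x, v) ∉ E d) {y : V} (hyx : y ≠ x)
    (hy : y ∉ cov F) (hEi : E i = {s(x, u), s(v, y)}) (hEj : E j = {s(x, v), s(u, y)}) :
    IsBadgeFamily F E S := by
  obtain ⟨σ, hσ, st, B⟩ := hB
  have huv := T.u_ne_v h
  have hu := mem_cov_left T.huv
  have hv := mem_cov_right T.huv
  have hyu : y ≠ u := by rintro rfl; exact hy hu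
  have hyv : y ≠ v := by rintro rfl; exact hy hv
  set O := Origamistrip.single x y u v hyx.symm huv T.x_ne_u T.x_ne_v hyu hyv with hO
  have hO1 : O.mt true = E i := by rw [hEi]; exact O.mt_of_m_eq_one rfl true
  have hO2 : O.mt false = E j := by rw [hEj]; exact O.mt_of_m_eq_one rfl false
  have hOi : ∀ w, w ∈ O.interior → w = u ∨ w = v := by
    intro w hw
    obtain ⟨b, k, -, -, rfl⟩ := O.mem_interior.1 hw
    cases b
    exacts [Or.inr rfl, Or.inl rfl]
  have hint : ∀ s, u ∉ (st s).interior ∧ v ∉ (st s).interior := fun s =>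
    ⟨fun h' => ((T.erase_cov h).1 (B.interior_subset h')).2.1 rfl,
      fun h' => ((T.erase_cov h).1 (B.interior_subset h')).2.2 rfl⟩
  have hdisj : ∀ s, Disjoint O.interior (st s).interior := by
    intro s
    rw [Set.disjoint_left]
    intro w hw hw'
    rcases hOi w hw with rfl | rfl
    exacts [(hint s).1 hw', (hint s).2 hw']
  have hexact : ∀ d ∈ (S.erase i).erase j, E d = contr x u v E d := by
    intro d hd
    obtain ⟨g, b, hg⟩ := B.cover d hd
    exact T.eq_of_no_edge h hS B hd hg fun d' hd' _ _ => hno d' hd'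
  have hS1 : ∀ {d}, d ∈ (S.erase i).erase j ↔ d ≠ j ∧ d ≠ i ∧ d ∈ S := by
    intro d; simp only [Finset.mem_erase]
  have hnot : ∀ s b w, w = u ∨ w = v → ∀ w', s(w', w) ∉ (st s).mt b := by
    intro s b w hw w' hm
    have hwF : w ∈ cov F := by rcases hw with rfl | rfl <;> assumption
    rcases (st s).mem_of_mem_mt hm (Sym2.mem_mk_right _ _) with h3 | h3 | h3
    · rcases hw with rfl | rfl
      exacts [(hint s).1 h3, (hint s).2 h3]
    · exact (T.endpoints_notMem h B s).1 (h3 ▸ hwF)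
    · exact (T.endpoints_notMem h B s).2 (h3 ▸ hwF)
  have hij : E i ≠ E j := fun h' => O.mt_ne true (hO1.trans (h'.trans hO2.symm))
  refine ⟨Option σ, inferInstance, fun s => s.elim O st, ?_, ?_, ?_, ?_, ?_, ?_⟩
  · rintro (_ | s) (_ | s') hss
    · exact absurd rfl hss
    · exact hdisj s'
    · exact (hdisj s).symm
    · exact B.disj s s' fun h' => hss (congrArg some h')
  · rintro (_ | s)
    · exact T.hx
    · exact (T.endpoints_notMem h B s).1
  · rintro (_ | s)
    · exact hy
    · exact (T.endpoints_notMem h B s).2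
  · intro e
    constructor
    · intro he
      by_cases heuv : e = s(u, v)
      · exact ⟨none, 1, ⟨le_rfl, le_rfl⟩, heuv⟩
      · obtain ⟨s, hs⟩ := (B.skel e).1 (Finset.mem_erase.2 ⟨heuv, he⟩)
        exact ⟨some s, hs⟩
    · rintro ⟨_ | s, hs⟩
      · obtain ⟨k, -, rfl⟩ := hs
        exact T.huv
      · exact Finset.mem_of_mem_erase ((B.skel e).2 ⟨s, hs⟩)
  · intro d hd
    by_cases hdi : d = i
    · exact ⟨none, true, by rw [hdi]; exact hO1.symm⟩
    by_cases hdj : d = j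
    · exact ⟨none, false, by rw [hdj]; exact hO2.symm⟩
    have hd1 := hS1.2 ⟨hdj, hdi, hd⟩
    obtain ⟨g, b, hg⟩ := B.cover d hd1
    exact ⟨some g, b, (hexact d hd1).trans hg⟩
  · rintro (_ | s) b
    · change (colourClass E S (O.mt b)).card = 1
      rw [Finset.card_eq_one]
      cases b
      · refine ⟨j, ?_⟩
        ext d
        rw [mem_colourClass, Finset.mem_singleton, hO2]
        refine ⟨fun ⟨h1, h2⟩ => ?_, fun h1 => ⟨h1 ▸ T.hj, by rw [h1]⟩⟩
        by_contra hdj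
        have hdi : d ≠ i := by rintro rfl; exact hij h2
        exact (hno d (hS1.2 ⟨hdj, hdi, h1⟩)).2 (h2 ▸ T.hxv)
      · refine ⟨i, ?_⟩
        ext d
        rw [mem_colourClass, Finset.mem_singleton, hO1]
        refine ⟨fun ⟨h1, h2⟩ => ?_, fun h1 => ⟨h1 ▸ T.hi, by rw [h1]⟩⟩
        by_contra hdi
        have hdj : d ≠ j := by rintro rfl; exact hij h2.symm
        exact (hno d (hS1.2 ⟨hdj, hdi, h1⟩)).1 (h2 ▸ T.hxu)
    · change (colourClass E S ((st s).mt b)).card = (st s).m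
      rw [← B.card s b]
      congr 1
      ext d
      rw [mem_colourClass, mem_colourClass]
      constructor
      · rintro ⟨h1, h2⟩
        have hdi : d ≠ i := by
          rintro rfl; exact hnot s b u (Or.inl rfl) x (h2 ▸ T.hxu)
        have hdj : d ≠ j := by
          rintro rfl; exact hnot s b v (Or.inr rfl) x (h2 ▸ T.hxv)
        have hd1 := hS1.2 ⟨hdj, hdi, h1⟩
        exact ⟨hd1, (hexact d hd1).symm.trans h2⟩
      · rintro ⟨h1, h2⟩
        exact ⟨(hS1.1 h1).2.2, (hexact d h1).trans h2⟩

/-- If `F` has a single edge, the sets of the two colours of a triangle form a strip of weight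
one. -/
lemma exists_pair_of_card_eq_one (T : Triangle F E S x u v i j) (h : Inst F E S 0)
    (hF : F.card = 1) : ∃ y, y ≠ x ∧ y ∉ cov F ∧ E i = {s(x, u), s(v, y)} ∧
      E j = {s(x, v), s(u, y)} := by
  obtain rfl : F = {s(u, v)} := by
    obtain ⟨e, rfl⟩ := Finset.card_eq_one.1 hF
    rw [Finset.mem_singleton.1 T.huv]
  have huv := T.u_ne_v h
  have hcov : ∀ {w}, w ∈ cov {s(u, v)} ↔ w = u ∨ w = v := by
    intro w; simp [mem_cov]
  have : Nonempty ι := ⟨i⟩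
  -- every coloured edge meets `uv`
  have hmeet : ∀ {c}, c ∈ S → ∀ {e}, e ∈ E c → u ∈ e ∨ v ∈ e := by
    intro c hc e he
    by_contra hcon
    push Not at hcon
    induction e using Sym2.ind with
    | _ p q =>
    simp only [Sym2.mem_iff, not_or] at hcon
    have hp : p ∉ cov {s(u, v)} := by
      rw [hcov, not_or]; exact ⟨Ne.symm hcon.1.1, Ne.symm hcon.2.1⟩
    have hq : q ∉ cov {s(u, v)} := by
      rw [hcov, not_or]; exact ⟨Ne.symm hcon.1.2, Ne.symm hcon.2.2⟩
    have hR : Rainbow E S {s(p, q)} :=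
      (Rainbow.of_card_le (S := {c}) (by simp) (by simpa using he)).mono subset_rfl (by simpa)
    refine h.not_hasMat hR ?_
    exact HasMat.of_insert h.mat Set.subset_union_left
      (by simpa using h.nodiag c _ he) hp hq (Or.inr (by simp))
  -- every colour has edges from `u` and `v` to distinct uncovered vertices
  have hpath : ∀ {c}, c ∈ S → ∃ p q, p ≠ q ∧ (p ≠ u ∧ p ≠ v) ∧ (q ≠ u ∧ q ≠ v) ∧
      s(u, p) ∈ E c ∧ s(v, q) ∈ E c := by
    intro c hc
    obtain ⟨N, hN, hNZ, hNc⟩ := h.aug {c} (by simpa using hc) (by simp)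
    have hNd : ∀ e ∈ N, e = s(u, v) ∨ e ∈ E c := by
      intro e he
      rcases hNZ he with h | h
      · exact Or.inl (by simpa using h)
      · exact Or.inr (by simpa using h)
    have hNm : ∀ e ∈ N, u ∈ e ∨ v ∈ e := by
      intro e he
      rcases hNd e he with rfl | h
      · simp
      · exact hmeet hc h
    obtain ⟨e1, e2, h12, rfl⟩ := Finset.card_eq_two.1 (hNc.trans (by simp))
    have hkey : ∀ e1 e2, e1 ≠ e2 → IsMat {e1, e2} → (∀ e ∈ ({e1, e2} : Finset (Sym2 V)),
        e = s(u, v) ∨ e ∈ E c) → (∀ e ∈ ({e1, e2} : Finset (Sym2 V)), u ∈ e ∨ v ∈ e) →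
        u ∈ e1 → ∃ p q, p ≠ q ∧ (p ≠ u ∧ p ≠ v) ∧ (q ≠ u ∧ q ≠ v) ∧
          s(u, p) ∈ E c ∧ s(v, q) ∈ E c := by
      intro e1 e2 h12 hN hNd hNm hu1
      have hu2 : u ∉ e2 := fun hu2 => h12 (hN.2 e1 (by simp) e2 (by simp) u hu1 hu2)
      have hv2 : v ∈ e2 := (hNm e2 (by simp)).resolve_left hu2
      have hv1 : v ∉ e1 := fun hv1 => h12 (hN.2 e1 (by simp) e2 (by simp) v hv1 hv2)
      obtain ⟨p, rfl⟩ := Sym2.mem_iff_exists.1 hu1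
      obtain ⟨q, rfl⟩ := Sym2.mem_iff_exists.1 hv2
      simp only [Sym2.mem_iff, not_or] at hu2 hv1
      have hup : u ≠ p := hN.ne (a := u) (by simp)
      have hvq : v ≠ q := hN.ne (a := v) (by simp)
      refine ⟨p, q, ?_, ⟨hup.symm, Ne.symm hv1.2⟩, ⟨Ne.symm hu2.2, hvq.symm⟩, ?_, ?_⟩
      · rintro rfl
        exact h12 (hN.2 _ (by simp) _ (by simp) p (by simp) (by simp))
      · refine (hNd _ (by simp)).resolve_left fun h' => ?_
        exact hv1.2 (Sym2.congr_right.1 h').symm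
      · refine (hNd _ (by simp)).resolve_left fun h' => ?_
        rw [Sym2.eq_swap (a := u)] at h'
        exact hu2.2 (Sym2.congr_right.1 h').symm
    rcases hNm e1 (by simp) with hu1 | hv1
    · exact hkey e1 e2 h12 hN hNd hNm hu1
    · have hv2 : v ∉ e2 := fun hv2 => h12 (hN.2 e1 (by simp) e2 (by simp) v hv1 hv2)
      have hu2 : u ∈ e2 := (hNm e2 (by simp)).resolve_right hv2
      rw [Finset.pair_comm] at hN hNd hNm
      exact hkey e2 e1 h12.symm hN hNd hNm hu2
  -- two colours cannot reach distinct vertices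
  have hrb : ∀ {c d p q}, c ∈ S → d ∈ S → c ≠ d → (p ≠ u ∧ p ≠ v) → (q ≠ u ∧ q ≠ v) →
      s(u, p) ∈ E c → s(v, q) ∈ E d → p = q := by
    intro c d p q hc hd hcd hp hq hup hvq
    by_contra hpq
    have hR := ((Rainbow.empty (E := E) (S := ∅)).insert (d := c) (by simp) hup).insert (d := d)
      (by simp [hcd.symm]) hvq
    refine h.norb (insert s(v, q) (insert s(u, p) ∅)) ((isMat_empty.insert_mk hp.1.symm
      (by simp [mem_cov]) (by simp [mem_cov])).insert_mk hq.2.symm ?_ ?_) ?_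
      (hR.mono Finset.sdiff_subset ?_)
    · rw [cov_insert_mk]; simp [huv.symm, hp.2.symm, mem_cov]
    · rw [cov_insert_mk]; simp [hq.1, Ne.symm hpq, mem_cov]
    · rw [IsMat.card_insert_mk, IsMat.card_insert_mk]
      · simp
      · simp [mem_cov]
      · rw [cov_insert_mk]; simp [huv.symm, hp.2.symm, mem_cov]
    · intro l hl
      simp only [Finset.mem_insert, Finset.notMem_empty, or_false] at hl
      rcases hl with rfl | rfl <;> assumption
  have hxuv : x ≠ u ∧ x ≠ v := ⟨T.x_ne_u, T.x_ne_v⟩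
  have hux : s(u, x) ∈ E i := Sym2.eq_swap ▸ T.hxu
  have hvx : s(v, x) ∈ E j := Sym2.eq_swap ▸ T.hxv
  obtain ⟨y, x', hyx', hy, hx', huy, hvx'⟩ := hpath T.hj
  obtain ⟨x'', y', -, hx'', hy', hux'', hvy'⟩ := hpath T.hi
  obtain rfl := hrb T.hi T.hj T.hij hxuv hx' hux hvx'
  obtain rfl := hrb T.hj T.hi T.hij.symm hy hy' huy hvy'
  have hforms : ∀ {c}, c ∈ S → ∀ {e}, e ∈ E c → ∃ p, (p ≠ u ∧ p ≠ v) ∧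
      (e = s(u, p) ∨ e = s(v, p)) := by
    intro c hc e he
    have hd := h.nodiag c e he
    have hF : e ∉ ({s(u, v)} : Finset (Sym2 V)) := h.disj c e he
    rw [Finset.mem_singleton] at hF
    rcases hmeet hc he with hm | hm
    · obtain ⟨p, rfl⟩ := Sym2.mem_iff_exists.1 hm
      refine ⟨p, ⟨?_, ?_⟩, Or.inl rfl⟩
      · rintro rfl; exact hd rfl
      · rintro rfl; exact hF rfl
    · obtain ⟨p, rfl⟩ := Sym2.mem_iff_exists.1 hm
      refine ⟨p, ⟨?_, ?_⟩, Or.inr rfl⟩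
      · rintro rfl; exact hF Sym2.eq_swap
      · rintro rfl; exact hd rfl
  refine ⟨y, hyx', ?_, ?_, ?_⟩
  · rw [hcov, not_or]; exact hy
  · ext e
    simp only [Set.mem_insert_iff, Set.mem_singleton_iff]
    constructor
    · intro he
      obtain ⟨p, hp, rfl | rfl⟩ := hforms T.hi he
      · left; rw [hrb T.hi T.hj T.hij hp hxuv he hvx, Sym2.eq_swap]
      · right; rw [hrb T.hj T.hi T.hij.symm hy hp huy he]
    · rintro (rfl | rfl)
      exacts [T.hxu, hvy']
  · ext e
    simp only [Set.mem_insert_iff, Set.mem_singleton_iff]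
    constructor
    · intro he
      obtain ⟨p, hp, rfl | rfl⟩ := hforms T.hj he
      · right; rw [hrb T.hj T.hi T.hij.symm hp hy he hvy']
      · left; rw [← hrb T.hi T.hj T.hij hxuv hp hux he, Sym2.eq_swap]
    · rintro (rfl | rfl)
      exacts [T.hxv, huy]

end Triangle

end Badges
end RainbowAAP

namespace RainbowAAP

/-! ### Extremal families are badges -/

section Extremal

variable {V ι : Type*} [DecidableEq V] [DecidableEq ι]

set_option linter.unusedSectionVars false

variable {F : Finset (Sym2 V)} {E : ι → Set (Sym2 V)} {S : Finset ι} {x u v : V} {i j : ι}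

/-- If no triangle has an edge of a third colour, the sets of the two colours of a triangle form a
strip of weight one. They are read off from the badge obtained by contracting another triangle,
which leaves them unchanged. -/
lemma Triangle.exists_pair (T : Triangle F E S x u v i j) (h : Inst F E S 0)
    (hS : S.card = 2 * F.card + 0)
    (hB : ∀ {x u v : V} {i j : ι}, Triangle F E S x u v i j →
      IsBadgeFamily (F.erase s(u, v)) (contr x u v E) ((S.erase i).erase j))
    (hno : ∀ {x u v : V} {i j : ι}, Triangle F E S x u v i j →
      ∀ d ∈ (S.erase i).erase j, s(x, u) ∉ E d ∧ s(x, v) ∉ E d)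
    (hF : 2 ≤ F.card) :
    ∃ y, y ≠ x ∧ y ∉ cov F ∧ E i = {s(x, u), s(v, y)} ∧ E j = {s(x, v), s(u, y)} := by
  obtain ⟨σ, -, st, B⟩ := hB T
  have hcard := Finset.card_erase_add_one T.huv
  obtain ⟨e, he⟩ := Finset.card_pos.1 (show 0 < (F.erase s(u, v)).card by omega)
  obtain ⟨g, -⟩ := (B.skel e).1 he
  obtain ⟨q, hq, hqx⟩ : ∃ q, (q = (st g).x ∨ q = (st g).y) ∧ q ≠ x := by
    by_cases hx : (st g).x = x
    · exact ⟨_, Or.inr rfl, fun h' => (st g).x_ne_y (hx.trans h'.symm)⟩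
    · exact ⟨_, Or.inl rfl, hx⟩
  have hqF : q ∉ cov F := by
    have := T.endpoints_notMem h B g
    rcases hq with rfl | rfl
    exacts [this.1, this.2]
  obtain ⟨O, hOx, -, hOi, hOs, -, hO1, hO2⟩ := (st g).exists_oriented true hq
  have hside : ∀ b, O.side b 1 ∈ cov F ∧ O.side b 1 ≠ u ∧ O.side b 1 ≠ v := fun b =>
    (T.erase_cov h).1 (B.interior_subset (hOi ▸ O.side_mem_interior b le_rfl O.one_le_m))
  have hskel : s(O.side true 1, O.side false 1) ∈ F.erase s(u, v) :=
    (B.skel _).2 ⟨g, hOs ▸ O.side_mem_skeleton true le_rfl O.one_le_m⟩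
  have hq1 : ∀ {b d}, contr x u v E d = O.mt b → s(q, O.side b 1) ∈ E d := by
    intro b d hd
    refine T.mem_of_mem_contr ?_ ?_
    · rw [hd, ← hOx]; exact O.first_mem_mt b
    · rw [Sym2.mem_iff, not_or]
      exact ⟨hqx.symm, fun h' => T.hx (h' ▸ (hside b).1)⟩
  obtain ⟨c, hc, hcg⟩ := B.exists_colour g true
  obtain ⟨c', hc', hcg'⟩ := B.exists_colour g (!true)
  have hS1 : ∀ {d}, d ∈ (S.erase i).erase j ↔ d ≠ j ∧ d ≠ i ∧ d ∈ S := by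
    intro d; simp only [Finset.mem_erase]
  rw [hS1] at hc hc'
  have T' : Triangle F E S q (O.side true 1) (O.side false 1) c c' :=
    ⟨hqF, Finset.mem_of_mem_erase hskel, hc.2.2, hc'.2.2,
      fun h' => (st g).mt_ne true (hcg.symm.trans (h' ▸ hcg')),
      hq1 (hcg.trans hO1.symm), hq1 (hcg'.trans hO2.symm)⟩
  obtain ⟨σ', -, st', B'⟩ := hB T'
  have hi' : i ∈ (S.erase c).erase c' := by
    simp only [Finset.mem_erase]; exact ⟨Ne.symm hc'.2.1, Ne.symm hc.2.1, T.hi⟩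
  have hj' : j ∈ (S.erase c).erase c' := by
    simp only [Finset.mem_erase]; exact ⟨Ne.symm hc'.1, Ne.symm hc.1, T.hj⟩
  have hexact : ∀ d ∈ (S.erase c).erase c',
      E d = contr q (O.side true 1) (O.side false 1) E d := by
    intro d hd
    obtain ⟨s, b, hs⟩ := B'.cover d hd
    exact T'.eq_of_no_edge h hS B' hd hs fun d' hd' _ _ => hno T' d' hd'
  obtain ⟨s, b, hs⟩ := B'.cover i hi'
  rw [← hexact i hi'] at hs
  have hxs : x = (st' s).x ∨ x = (st' s).y := by
    rcases (st' s).mem_of_mem_mt (hs ▸ T.hxu) (Sym2.mem_mk_left _ _) with h1 | h1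
    · exact absurd (cov_mono (Finset.erase_subset _ _) (B'.interior_subset h1)) T.hx
    · exact h1
  obtain ⟨O', A, hOm', hOi', hOy', hO1', hO2', hOF⟩ :
      ∃ O' : Origamistrip V, O'.x = x ∧ O'.m = (st' s).m ∧ O'.interior = (st' s).interior ∧
        O'.y ∉ cov F ∧ O'.mt true = (st' s).mt b ∧ O'.mt false = (st' s).mt (!b) ∧
        s(O'.side true 1, O'.side false 1) ∈ F := by
    obtain ⟨O', h1, h2, h3, h4, h5, h6, h7⟩ := (st' s).exists_oriented b hxs
    refine ⟨O', h1, h2, h3, ?_, h6, h7, Finset.mem_of_mem_erase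
      ((B'.skel _).2 ⟨s, h4 ▸ O'.side_mem_skeleton true le_rfl O'.one_le_m⟩)⟩
    have := T'.endpoints_notMem h B' s
    rcases h5 with h5 | h5 <;> rw [h5]
    exacts [this.1, this.2]
  rw [← hO1'] at hs
  have hu : u = O'.side true 1 := O'.eq_of_x_mem_mt (by rw [A, ← hs]; exact T.hxu)
  have hv : v = O'.side false 1 := h.mat.partner_unique T.huv (hu ▸ hOF)
  have hjm : E j = O'.mt false := by
    obtain ⟨s', b', hs'⟩ := B'.cover j hj'
    rw [← hexact j hj'] at hs'
    have hvs : v ∈ (st' s).interior := by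
      rw [← hOi', hv]; exact O'.side_mem_interior false le_rfl O'.one_le_m
    have hvs' : v ∈ (st' s').interior := by
      have hvF := mem_cov_right T.huv
      rcases (st' s').mem_of_mem_mt (hs' ▸ T.hxv) (Sym2.mem_mk_right _ _) with h1 | h1 | h1
      · exact h1
      · exact absurd (h1 ▸ hvF) (T'.endpoints_notMem h B' s').1
      · exact absurd (h1 ▸ hvF) (T'.endpoints_notMem h B' s').2
    obtain rfl : s = s' := by
      by_contra hne
      exact Set.disjoint_left.1 (B'.disj s s' hne) hvs hvs'
    rcases Bool.eq_or_eq_not b' b with rfl | rfl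
    · have := O'.eq_of_x_mem_mt (b := true) (by rw [A, hO1', ← hs']; exact T.hxv)
      exact absurd (hu.trans this.symm) (T.u_ne_v h)
    · exact hs'.trans hO2'.symm
  have hm : O'.m = 1 := by
    refine le_antisymm ?_ O'.one_le_m
    rw [hOm', ← B'.card s b]
    refine (Finset.card_le_card (t := {i}) fun d hd => Finset.mem_singleton.2 ?_).trans_eq
      (Finset.card_singleton i)
    obtain ⟨hd, hdm⟩ := mem_colourClass.1 hd
    rw [← hexact d hd, ← hO1'] at hdm
    by_contra hdi
    have hdj : d ≠ j := by
      rintro rfl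
      exact O'.mt_ne true (hdm.symm.trans hjm)
    refine (hno T d (hS1.2 ⟨hdj, hdi, ?_⟩)).1 (by rw [hdm, ← hs]; exact T.hxu)
    simp only [Finset.mem_erase] at hd
    exact hd.2.2
  refine ⟨O'.y, A ▸ O'.x_ne_y.symm, hOy', ?_, ?_⟩
  · rw [hs, O'.mt_of_m_eq_one hm, A, hu, hv, Bool.not_true]
  · rw [hjm, O'.mt_of_m_eq_one hm, A, hu, hv, Bool.not_false]

/-- In the extremal case without empty sets, the sets are the matchings of a badge. -/
theorem isBadgeFamily_of_card_eq (n : ℕ) : ∀ {F : Finset (Sym2 V)} {E : ι → Set (Sym2 V)}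
    {S : Finset ι}, F.card = n → Inst F E S 0 → S.card = 2 * F.card + 0 →
    IsBadgeFamily F E S := by
  induction n with
  | zero =>
    intro F E S hn h hS
    obtain rfl : S = ∅ := Finset.card_eq_zero.1 (by omega)
    obtain rfl : F = ∅ := Finset.card_eq_zero.1 hn
    exact ⟨Empty, inferInstance, Empty.elim, nofun, nofun, nofun, by simp, by simp, nofun⟩
  | succ n ih =>
    intro F E S hn h hS
    have hB : ∀ {x u v : V} {i j : ι}, Triangle F E S x u v i j →
        IsBadgeFamily (F.erase s(u, v)) (contr x u v E) ((S.erase i).erase j) := by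
      intro x u v i j T
      have h1 := Finset.card_erase_add_one T.huv
      have h2 := T.card_colours
      exact ih (by omega) (T.contr_inst h) (by omega)
    by_cases hno : ∀ {x u v : V} {i j : ι}, Triangle F E S x u v i j →
      ∀ d ∈ (S.erase i).erase j, s(x, u) ∉ E d ∧ s(x, v) ∉ E d
    · obtain ⟨x, u, v, i, j, hx, huv, hi, hj, hij, hxu, hxv⟩ := h.exists_triangle hS (by omega)
      have T : Triangle F E S x u v i j := ⟨hx, huv, hi, hj, hij, hxu, hxv⟩
      obtain ⟨y, hyx, hy, hEi, hEj⟩ : ∃ y, y ≠ x ∧ y ∉ cov F ∧ E i = {s(x, u), s(v, y)} ∧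
          E j = {s(x, v), s(u, y)} := by
        by_cases hF : F.card = 1
        · exact T.exists_pair_of_card_eq_one h hF
        · exact T.exists_pair h hS hB hno (by omega)
      exact T.isBadgeFamily_of_pair h hS (hB T) (hno T) hyx hy hEi hEj
    · push Not at hno
      obtain ⟨x, u, v, i, j, T, d, hd, hd'⟩ := hno
      by_cases hxu : s(x, u) ∈ E d
      · exact T.isBadgeFamily_of_mem h hS hB hd hxu
      · exact T.symm.isBadgeFamily_of_mem h hS hB (Finset.erase_right_comm (a := i) ▸ hd) (hd' hxu)

end Extremal
end RainbowAAP

namespace RainbowAAP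

/-! ### Augmenting paths and matchings -/

section Walks

variable {V : Type*} [DecidableEq V]

set_option linter.unusedSectionVars false

/-- Switching a matching `M` along an alternating path between uncovered vertices gives a larger
matching. The switch is done two edges at a time: replacing the second edge by the first one frees
the third vertex. The set `P` marks the edges of the path that belong to `M`. -/
lemma hasMat_of_alternating {G : SimpleGraph V} {P : Set (Sym2 V)} (n : ℕ) :
    ∀ {M : Finset (Sym2 V)} {a b : V} (p : G.Walk a b), p.length ≤ n → p.IsPath → 0 < p.length →
      p.edges.IsChain (fun e f => e ∈ P ↔ f ∉ P) → IsMat M → a ∉ cov M → b ∉ cov M →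
      (∀ e ∈ p.edges, e ∈ P ↔ e ∈ M) → HasMat (↑M ∪ {e | e ∈ p.edges}) (M.card + 1) := by
  induction n with
  | zero => intro M a b p hn hp h0; omega
  | succ n ih =>
    intro M a b p hn hp h0 hch hM ha hb hP
    match p with
    | .nil => simp at h0
    | .cons hac .nil =>
      refine ⟨_, hM.insert_mk hac.ne ha hb, ?_, IsMat.card_insert_mk ha⟩
      intro e he
      rcases Finset.mem_insert.1 he with rfl | he
      · exact Or.inr (by simp)
      · exact Or.inl he
    | .cons (v := c) hac (.cons (v := d) hcd p) =>
      simp only [SimpleGraph.Walk.cons_isPath_iff, SimpleGraph.Walk.support_cons, List.mem_cons,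
        not_or] at hp
      obtain ⟨⟨hpp, hcp⟩, hac', hap⟩ := hp
      simp only [SimpleGraph.Walk.edges_cons, List.mem_cons] at hP hch
      simp only [SimpleGraph.Walk.length_cons] at hn
      have hacM : s(a, c) ∉ M := IsMat.notMem_of_notMem_cov ha
      have hcdM : s(c, d) ∈ M := by
        rw [List.isChain_cons_cons, hP _ (Or.inl rfl), hP _ (Or.inr (Or.inl rfl))] at hch
        by_contra h'
        exact hacM (hch.1.2 h')
      have hd := p.start_mem_support
      have hbs := p.end_mem_support
      have hda : d ≠ a := fun h' => hap (h' ▸ hd)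
      have hba : b ≠ a := fun h' => hap (h' ▸ hbs)
      have hbc : b ≠ c := fun h' => hcp (h' ▸ hbs)
      have hcov : ∀ w, w ∈ cov (M.erase s(c, d)) ↔ w ∈ cov M ∧ w ≠ c ∧ w ≠ d := by
        intro w; rw [hM.cov_erase hcdM]; simp; tauto
      have haM : a ∉ cov (M.erase s(c, d)) := fun h' => ha ((hcov a).1 h').1
      have hcM : c ∉ cov (M.erase s(c, d)) := fun h' => ((hcov c).1 h').2.1 rfl
      have hM' := (hM.erase s(c, d)).insert_mk hac' haM hcM
      have hcard : (insert s(a, c) (M.erase s(c, d))).card = M.card := by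
        rw [IsMat.card_insert_mk haM, Finset.card_erase_add_one hcdM]
      have hdM' : d ∉ cov (insert s(a, c) (M.erase s(c, d))) := by
        rw [cov_insert_mk]; simp [hcov, hda, hcd.ne']
      have hbM' : b ∉ cov (insert s(a, c) (M.erase s(c, d))) := by
        rw [cov_insert_mk]; simp [hcov, hba, hbc, hb]
      have h0' : 0 < p.length := by
        rw [Nat.pos_iff_ne_zero]
        intro h'
        exact hb (SimpleGraph.Walk.eq_of_length_eq_zero h' ▸ mem_cov_right hcdM)
      have hmem : ∀ e ∈ p.edges, e ≠ s(a, c) ∧ e ≠ s(c, d) := by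
        refine fun e he => ⟨?_, ?_⟩
        · rintro rfl; exact hap (p.fst_mem_support_of_mem_edges he)
        · rintro rfl; exact hcp (p.fst_mem_support_of_mem_edges he)
      have hres := ih (M := insert s(a, c) (M.erase s(c, d))) p (by omega) hpp h0'
        hch.tail.tail hM' hdM' hbM' (by
          intro e he
          rw [hP e (Or.inr (Or.inr he))]
          simp [hmem e he])
      rw [hcard] at hres
      refine hres.mono ?_
      rintro e (he | he)
      · rcases Finset.mem_insert.1 he with rfl | he
        · exact Or.inr (by simp)
        · exact Or.inl (Finset.mem_of_mem_erase he)
      · exact Or.inr (List.mem_cons_of_mem _ (List.mem_cons_of_mem _ he))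

lemma uncovered_iff {F : Finset (Sym2 V)} {w : V} :
    Uncovered (F : Set (Sym2 V)) w ↔ w ∉ cov F := by
  simp [Uncovered, mem_cov]

lemma IsAAP.hasMat {G : SimpleGraph V} {F : Finset (Sym2 V)} (hF : IsMat F) {a b : V}
    {p : G.Walk a b} (hp : IsAAP (F : Set (Sym2 V)) p) :
    HasMat (↑F ∪ {e | e ∈ p.edges}) (F.card + 1) :=
  hasMat_of_alternating _ p le_rfl hp.isPath hp.length_pos hp.alternating hF
    (uncovered_iff.1 hp.start_uncovered) (uncovered_iff.1 hp.end_uncovered) fun _ _ => Iff.rfl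

/-- A matching larger than `F` yields an augmenting path with edges in both matchings, by Berge's
theorem. -/
lemma exists_isAAP {G : SimpleGraph V} {F N : Finset (Sym2 V)} (hF : IsMat F) (hN : IsMat N)
    (hlt : F.card < N.card) (hG : ∀ e ∈ F ∪ N, e ∈ G.edgeSet) :
    ∃ (a b : V) (p : G.Walk a b), IsAAP (F : Set (Sym2 V)) p ∧ ∀ e ∈ p.edges, e ∈ F ∪ N := by
  obtain ⟨a, b, N', -, ha, hb, hN', -, hpath⟩ := exists_augmenting _ rfl hF hN hlt
  have hsub : N' ∪ F ⊆ F ∪ N := Finset.union_subset hN' Finset.subset_union_left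
  obtain ⟨p, hp, h0, hpe, -, -, hch⟩ := hpath G fun e he => hG e (hsub he)
  refine ⟨a, b, p, ⟨hp, h0, hch.imp ?_, uncovered_iff.2 ha, uncovered_iff.2 hb⟩,
    fun e he => hsub (hpe e he)⟩
  intro e f hef
  simp only [Finset.mem_coe]
  rcases hef with ⟨-, h1, h2, -⟩ | ⟨h1, -, -, h2⟩ <;> simp [h1, h2]

end Walks

/-- A set whose elements are injectively coloured by members of the family that contain them is
rainbow. -/
lemma isRainbowSet_of_injOn {ι α : Type*} [Nonempty α] {A : ι → Set α} {X : Set α} {c : α → ι}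
    (hc : Set.InjOn c X) (h : ∀ e ∈ X, e ∈ A (c e)) : IsRainbowSet A X := by
  refine ⟨c '' X, Function.invFunOn c X, ?_, hc.invFunOn_image subset_rfl⟩
  rintro _ ⟨e, he, rfl⟩
  rw [hc.leftInvOn_invFunOn he]
  exact h e he

/-! ### The generalized badge of a badge family -/

section Reindexing

lemma Badge.path_eq {V : Type*} (B : Badge V) (c : B.Index) :
    B.path c = (B.strip c.1).mt c.2.1 ∪ (B.strip c.1).skeleton := by
  obtain ⟨e, b, l⟩ := c
  cases b <;> rfl

variable {V ι : Type*} [DecidableEq V] [DecidableEq ι]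

/-- The index set of the badge is matched with the colours by grouping the colours according to
the strip and the side whose matching they carry. -/
lemma IsBadgeFamily.isGeneralizedBadge {F : Finset (Sym2 V)} {E A : ι → Set (Sym2 V)}
    {S : Finset ι} (h : IsBadgeFamily F E S) (hA : ∀ c, E c = A c \ F) {P : ι → Prop}
    (hP : ∀ c, c ∈ S ↔ P c) (hS : S.card = 2 * F.card) :
    IsGeneralizedBadge F.card (F : Set (Sym2 V)) (fun c : {c // P c} => A c) := by
  obtain ⟨σ, _, st, B⟩ := h
  set η := (Fintype.equivFin σ).symm
  have hnot : ∀ {w}, w ∉ cov F → ∀ s, w ∉ (st s).interior :=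
    fun hw s hws => hw (B.interior_subset hws)
  let B' : Badge V :=
    { n := Fintype.card σ
      strip := fun e => st (η e)
      interior_disjoint := fun e f hef => B.disj _ _ (η.injective.ne hef)
      x_notMem_interior := fun e f => hnot (B.x_not _) _
      y_notMem_interior := fun e f => hnot (B.y_not _) _ }
  have hτ : ∀ c : {c // P c}, ∃ q : Fin (Fintype.card σ) × Bool, E c = (st (η q.1)).mt q.2 := by
    intro c
    obtain ⟨s, b, hs⟩ := B.cover c ((hP _).2 c.2)
    exact ⟨(η.symm s, b), by simpa using hs⟩
  choose τ hτ using hτ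
  have hiff : ∀ (c : {c // P c}) q, τ c = q ↔ E c = (st (η q.1)).mt q.2 := by
    refine fun c q => ⟨fun h => h ▸ hτ c, fun h => ?_⟩
    obtain ⟨h1, h2⟩ := B.mt_inj ((hτ c).symm.trans h)
    exact Prod.ext (η.injective h1) h2
  -- the fibres of `τ` are the colour classes
  let fibre (q : Fin (Fintype.card σ) × Bool) : {c : {c // P c} // τ c = q} ≃ Fin (st (η q.1)).m :=
    Equiv.trans
      { toFun := fun c => (⟨c.1.1, mem_colourClass.2 ⟨(hP _).2 c.1.2, (hiff _ _).1 c.2⟩⟩ :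
          {c // c ∈ colourClass E S ((st (η q.1)).mt q.2)})
        invFun := fun c => ⟨⟨c.1, (hP _).1 (mem_colourClass.1 c.2).1⟩,
          (hiff _ _).2 (mem_colourClass.1 c.2).2⟩
        left_inv := fun _ => rfl
        right_inv := fun _ => rfl }
      (Finset.equivFinOfCardEq (B.card _ _))
  let regroup : (Σ q : Fin (Fintype.card σ) × Bool, Fin (st (η q.1)).m) ≃ B'.Index :=
    { toFun := fun z => ⟨z.1.1, z.1.2, z.2⟩
      invFun := fun z => ⟨(z.1, z.2.1), z.2.2⟩
      left_inv := fun _ => rfl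
      right_inv := fun _ => rfl }
  let φ : {c // P c} ≃ B'.Index :=
    ((Equiv.sigmaFiberEquiv τ).symm.trans (Equiv.sigmaCongrRight fibre)).trans regroup
  have hskel : B'.skeleton = F := by
    ext e
    rw [Badge.skeleton, Set.mem_iUnion, Finset.mem_coe, B.skel]
    exact (η.surjective.exists (p := fun s => e ∈ (st s).skeleton)).symm
  refine ⟨B', ?_, hskel, φ, ?_⟩
  · have h1 := Nat.card_congr φ
    rw [Nat.subtype_card S hP, Nat.card_eq_fintype_card, Fintype.card_sigma, hS] at h1
    simp only [Fintype.card_prod, Fintype.card_bool, Fintype.card_fin, ← Finset.mul_sum] at h1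
    rw [Badge.weight]
    omega
  · intro c e he
    have hpath : B'.path (φ c) = E c ∪ (B'.strip (φ c).1).skeleton := by
      rw [Badge.path_eq, hτ c]; rfl
    have hsub : (B'.strip (φ c).1).skeleton ⊆ F := hskel ▸ Set.subset_iUnion_of_subset _ subset_rfl
    rw [hpath, hA] at he
    by_contra heF
    rcases he with ⟨h1, h2⟩ | ⟨h1 | h1, h2⟩
    · exact h2 (Or.inl ⟨h1, heF⟩)
    · exact h2 h1.1
    · exact heF (hsub h1)

end Reindexing

/-! ### Families of edge sets of a graph -/

section Graphs

variable {V ι : Type*} [DecidableEq V] {G : SimpleGraph V}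

/-- A family of edge sets without a rainbow augmenting path, in the form used for matchings. -/
lemma inst_of_not_hasRainbowAAP [Fintype ι] {F : Finset (Sym2 V)} (hF : IsMat F)
    (hFG : ↑F ⊆ G.edgeSet) {A : ι → Set (Sym2 V)} (hA : ∀ c, A c ⊆ G.edgeSet) {t : ℕ}
    (hunion : ∀ I : Finset ι, I.card = t + 1 → ContainsAAP G F (⋃ i ∈ I, A i))
    (hno : ¬ HasRainbowAAP G F A) : Inst F (fun c => A c \ F) Finset.univ t where
  mat := hF
  nodiag c e he := G.not_isDiag_of_mem_edgeSet (hA c he.1)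
  disj c e he := he.2
  aug I _ hI := by
    obtain ⟨a, b, p, hp, hpA⟩ := hunion I hI
    refine (hp.hasMat hF).mono ?_
    rintro e (he | he)
    · exact Or.inl he
    · by_cases heF : e ∈ F
      · exact Or.inl heF
      · obtain ⟨i, hi, he⟩ := Set.mem_iUnion₂.1 (hpA he)
        exact Or.inr (Set.mem_iUnion₂.2 ⟨i, hi, he, heF⟩)
  norb N hN hNc := by
    rintro ⟨c, hc, hcE⟩
    have hNF : ∀ {e}, e ∈ N → e ∉ F → e ∈ N \ F := fun h1 h2 => Finset.mem_sdiff.2 ⟨h1, h2⟩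
    obtain ⟨a, b, p, hp, hpN⟩ := exists_isAAP (G := G) hF hN (by omega) (by
      intro e he
      by_cases heF : e ∈ F
      · exact hFG heF
      · exact hA _ (hcE e (hNF ((Finset.mem_union.1 he).resolve_left heF) heF)).2.1)
    have hsub : ({e | e ∈ p.edges} \ F : Set (Sym2 V)) ⊆ ↑(N \ F) := fun e he =>
      hNF ((Finset.mem_union.1 (hpN e he.1)).resolve_left he.2) he.2
    have : Nonempty (Sym2 V) := ⟨s(a, b)⟩
    exact hno ⟨a, b, p, hp, isRainbowSet_of_injOn (hc.mono hsub) fun e he =>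
      (hcE e (hsub he)).2.1⟩

end Graphs

lemma isMat_of_isMatching {V : Type*} {G : SimpleGraph V} {F : G.Subgraph} (hF : F.IsMatching)
    {M : Finset (Sym2 V)} (hM : (M : Set (Sym2 V)) = F.edgeSet) : IsMat M := by
  have hmem : ∀ {e}, e ∈ M ↔ e ∈ F.edgeSet := by intro e; rw [← hM]; rfl
  refine ⟨fun e he => G.not_isDiag_of_mem_edgeSet (F.edgeSet_subset (hmem.1 he)), ?_⟩
  intro e he f hf v hve hvf
  obtain ⟨a, rfl⟩ := Sym2.mem_iff_exists.1 hve
  obtain ⟨b, rfl⟩ := Sym2.mem_iff_exists.1 hvf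
  have ha : F.Adj v a := hmem.1 he
  have hb : F.Adj v b := hmem.1 hf
  rw [(hF ha.fst_mem).unique ha hb]

end RainbowAAP

theorem mainTheorem3 {V : Type*} (G : SimpleGraph V) (F : G.Subgraph) (hF : F.IsMatching)
    (hfin : F.edgeSet.Finite) (k t m : ℕ) (hk : F.edgeSet.ncard = k)
    (A : Fin m → Set (Sym2 V)) (hA : ∀ i, A i ⊆ G.edgeSet)
    (hunion : ∀ I : Finset (Fin m), I.card = t + 1 →
      RainbowAAP.ContainsAAP G F.edgeSet (⋃ i ∈ I, A i))
    (hno : ¬ RainbowAAP.HasRainbowAAP G F.edgeSet A) :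
    m ≤ 2 * k + t ∧
    (m = 2 * k + t →
      {j : Fin m | A j ⊆ F.edgeSet}.ncard = t ∧
      RainbowAAP.IsGeneralizedBadge k F.edgeSet
        (fun j : {j : Fin m // ¬ A j ⊆ F.edgeSet} => A j.1)) := by
  classical
  obtain ⟨M, hM⟩ : ∃ M : Finset (Sym2 V), (M : Set (Sym2 V)) = F.edgeSet :=
    ⟨hfin.toFinset, hfin.coe_toFinset⟩
  have hmat := RainbowAAP.isMat_of_isMatching hF hM
  have hMG : (M : Set (Sym2 V)) ⊆ G.edgeSet := hM ▸ F.edgeSet_subset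
  rw [← hM] at hk hunion hno ⊢
  rw [Set.ncard_coe_finset] at hk
  subst hk
  have h := RainbowAAP.inst_of_not_hasRainbowAAP hmat hMG hA hunion hno
  refine ⟨?_, fun hm => ?_⟩
  · rcases Nat.eq_zero_or_pos m with rfl | hm
    · omega
    · have : Nonempty (Fin m) := ⟨⟨0, hm⟩⟩
      have := h.bound RainbowAAP.Rainbow.empty
      simp only [Finset.card_univ, Fintype.card_fin, Finset.card_empty] at this
      omega
  · obtain ⟨J, -, hJt, hJ⟩ := RainbowAAP.card_empty_eq _ rfl h (by simpa using hm)
    have hJ' : ∀ j, j ∈ J ↔ A j ⊆ M := by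
      intro j
      rw [← hJ j (Finset.mem_univ j), Set.sdiff_eq_empty]
    have hJset : {j : Fin m | A j ⊆ M} = J := Set.ext fun j => (hJ' j).symm
    refine ⟨by rw [hJset, Set.ncard_coe_finset, hJt], ?_⟩
    have hcard : (Finset.univ \ J).card = 2 * M.card + 0 := by
      have := Finset.card_sdiff_add_card_eq_card (Finset.subset_univ J)
      rw [Finset.card_univ, Fintype.card_fin] at this
      omega
    -- the empty sets serve to complete a single further set to a collection of `t + 1` sets
    have h' : RainbowAAP.Inst M (fun c => A c \ M) (Finset.univ \ J) 0 :=
      { mat := hmat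
        nodiag := h.nodiag
        disj := h.disj
        aug := by
          intro I hI hIc
          obtain ⟨c, rfl⟩ := Finset.card_eq_one.1 hIc
          have hcJ : c ∉ J := (Finset.mem_sdiff.1 (hI (Finset.mem_singleton_self c))).2
          refine (h.aug (insert c J) (Finset.subset_univ _)
            (by rw [Finset.card_insert_of_notMem hcJ, hJt])).mono ?_
          refine Set.union_subset_union_right _ (Set.iUnion₂_subset fun i hi => ?_)
          rcases Finset.mem_insert.1 hi with rfl | hi
          · exact Set.subset_biUnion_of_mem (u := fun c => A c \ (M : Set (Sym2 V)))
              (Finset.mem_singleton_self i)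
          · rw [(hJ i (Finset.mem_univ i)).2 hi]
            exact Set.empty_subset _
        norb := fun N hN hNc hR => h.norb N hN hNc (hR.mono subset_rfl (Finset.subset_univ _)) }
    exact (RainbowAAP.isBadgeFamily_of_card_eq _ rfl h' hcard).isGeneralizedBadge (fun _ => rfl)
      (fun c => by simp [hJ']) hcard
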